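/- Let $p\ge 5$. A *mixed mesh* on an open connected $\Omega\subset\mathbb R^2$ consists of finitely many open triangles and quadrilaterals (elements), open line segments (edges) and points (vertices) whose disjoint union is $\overline\Omega$, such that every side of an element is an edge of the mesh and the end points of every edge are vertices of the mesh. Each closed triangle is the image of $\{u,v\ge 0,\ u+v\le 1\}$ under $F(u,v)=(1-u-v)V_1+uV_2+vV_3$, each closed quadrilateral the image of $[0,1]^2$ under $F(u,v)=(1-u)(1-v)V_1+u(1-v)V_2+uvV_3+(1-u)vV_4$, and $F$ is injective with invertible Jacobian on the closed parameter domain. Let $\mathcal A_p$ be the space of all $\varphi\in C^1(\overline\Omega)$ such that $\varphi\circ F$ is a polynomial of total degree at most $p$ for every triangle and of bi-degree at most $(p,p)$ for every quadrilateral, $\varphi$ is twice differentiable at every vertex, and the derivative of $\varphi$ in the direction of the unit normal $n$ of an edge is, along every edge, a polynomial of degree at most $p-1$ in the linear parameter of the edge. On a segment with end points $A,B$ put, with $N=2\lfloor p/2\rfloor-2$, $$\widetilde R_\ell=\tfrac{N-\ell}{N}\Big(\tfrac{p-2}{p}A+\tfrac2pB\Big)+\tfrac{\ell}{N}\Big(\tfrac2pA+\tfrac{p-2}{p}B\Big),\qquad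 1\le\ell\le N-1 .$$ For odd $p$ let $S_\ell=\widetilde R_\ell$ for $1\le\ell\le p-4$, and $R_\ell=\widetilde R_\ell$ for $1\le\ell\le\frac{p-5}2$, $R_\ell=\widetilde R_{\ell+1}$ for $\frac{p-3}2\le\ell\le p-5$. For even $p$ let $R_\ell=\widetilde R_\ell$ for $1\le\ell\le\frac{p-6}2$, $R_{(p-4)/2}=\widetilde R_{(p-2)/2}$, $R_\ell=\widetilde R_{\ell+2}$ for $\frac{p-2}2\le\ell\le p-5$, and $S_\ell=\widetilde R_\ell$ for $1\le\ell\le\frac{p-4}2$, $S_\ell=\widetilde R_{\ell+1}$ for $\frac{p-2}2\le\ell\le p-4$. In an element let $Q_{\ell,k}=F(\ell/p,k/p)$, where $2\le\ell,k\le p-2$ for a quadrilateral, and $\ell,k\ge2$, $\ell+k\le p-2$ for a triangle. For an element $T$ of the mesh and $\psi\in C^2(\overline T)$, the local projection $\Pi_p^T\psi$ is the member of $\mathcal A_p|_{\overline T}$ that has the same partial derivatives of order $0,1,2$ as $\psi$ at the vertices of $T$, the same values as $\psi$ at the points $R_\ell$ and the same normal derivatives as $\psi$ at the points $S_\ell$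 of every side of $T$, and the same values as $\psi$ at the points $Q_{\ell,k}$. An element is *shape regular with parameter $\rho>0$* if all angles of the triangle, respectively all angles of the four triangles into which the two diagonals split the quadrilateral (two for each diagonal), are at least $\rho$. **Lemma.** For every $p\ge5$, $\rho>0$ and $\theta>0$ there is a constant $\sigma>0$ such that, for every element $T$ of every mixed mesh such that $T$ is shape regular with parameter $\rho$ and $\mathrm{diam}(T)=\theta$, and for every $\psi\in C^2(\overline T)$, the local projection $\Pi_p^T\psi$ is well defined (it exists, is unique on $\overline T$, and is of class $C^2$ on $\overline T$), and $$\|\Pi_p^T\psi\|_{H^2(T)}\le\sigma\,\|\psi\|_{C^2(\overline T)},\qquad \|\Pi_p^T\psi\|_{L^\infty(T)}\le\sigma\,\|\psi\|_{C^2(\overline T)} .$$ Here $\|f\|_{H^2(T)}^2$ is the sum of the squares of the $L^2(T)$-norms of all partial derivatives of $f$ of order at most two, and $\|\psi\|_{C^2(\overline T)}$ is the supremum over $\overline T$ of the absolute values of all partial derivatives of $\psi$ of order at most two. -/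

import Mathlib

open Set MeasureTheory
open scoped ENNReal

noncomputable section

/-- The Euclidean plane. -/
abbrev Plane : Type := EuclideanSpace ℝ (Fin 2)

/-! ### Derivatives and norms -/

/-- The derivative of `f` in the direction `v`, relative to the set `D`. -/
def dirDerivWithin (D : Set Plane) (v : Plane) (f : Plane → ℝ) : Plane → ℝ :=
  fun x => fderivWithin ℝ f D x v

/-- The partial derivative `∂_x^a ∂_y^b f`, relative to the set `D`. -/
def partialWithin (D : Set Plane) (a b : ℕ) (f : Plane → ℝ) : Plane → ℝ :=
  (dirDerivWithin D !₂[1, 0])^[a] ((dirDerivWithin D !₂[0, 1])^[b] f)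

/-- The `C²`-norm on `K`: the supremum over `K` of the absolute values of all partial
derivatives of order at most two. -/
def c2Norm (K : Set Plane) (f : Plane → ℝ) : ℝ :=
  sSup {r : ℝ | ∃ x ∈ K, ∃ a b : ℕ, a + b ≤ 2 ∧ r = |partialWithin K a b f x|}

/-- The square of the `H^l`-seminorm on the open set `D`: the sum of the squares of the
`L²(D)`-norms of all partial derivatives of order `l`. It is applied to functions that are
of class `C^l` on `D` only, so that weak and classical derivatives agree. -/
def sobolevSeminormSq (D : Set Plane) (l : ℕ) (f : Plane → ℝ) : ℝ≥0∞ :=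
  ∑ ab ∈ Finset.HasAntidiagonal.antidiagonal l,
    eLpNorm (partialWithin D ab.1 ab.2 f) 2 (volume.restrict D) ^ 2

/-- The `H^m`-norm on the open set `D`. -/
def sobolevNorm (D : Set Plane) (m : ℕ) (f : Plane → ℝ) : ℝ≥0∞ :=
  (∑ l ∈ Finset.range (m + 1), sobolevSeminormSq D l f) ^ (1 / 2 : ℝ)

/-- The unit vector orthogonal to the segment from `A` to `B`, where `(x, y)^⊥ = (y, -x)`. -/
def unitNormal (A B : Plane) : Plane :=
  ‖B - A‖⁻¹ • !₂[(B - A) 1, -((B - A) 0)]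

/-! ### Triangles and quadrilaterals -/

/-- A triangle or a quadrilateral, given by its vertices in cyclic order. -/
inductive MeshElement : Type
  | tri (V₁ V₂ V₃ : Plane) : MeshElement
  | quad (V₁ V₂ V₃ V₄ : Plane) : MeshElement

namespace MeshElement

/-- The parameter triangle or the unit square. -/
def paramDomain : MeshElement → Set (ℝ × ℝ)
  | tri _ _ _ => {q | 0 ≤ q.1 ∧ q.1 ≤ 1 ∧ 0 ≤ q.2 ∧ q.2 ≤ 1 - q.1}
  | quad _ _ _ _ => Icc 0 1 ×ˢ Icc 0 1

/-- The linear or bilinear geometry mapping `F`. -/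
def param : MeshElement → ℝ × ℝ → Plane
  | tri V₁ V₂ V₃ => fun q => (1 - q.1 - q.2) • V₁ + q.1 • V₂ + q.2 • V₃
  | quad V₁ V₂ V₃ V₄ => fun q =>
      ((1 - q.1) * (1 - q.2)) • V₁ + (q.1 * (1 - q.2)) • V₂ + (q.1 * q.2) • V₃
        + ((1 - q.1) * q.2) • V₄

/-- The closed element. -/
def closedRegion (e : MeshElement) : Set Plane := e.param '' e.paramDomain

/-- The element as an open set. -/
def openRegion (e : MeshElement) : Set Plane := interior e.closedRegion

/-- The vertices of the element. -/
def corners : MeshElement → Set Plane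
  | tri V₁ V₂ V₃ => {V₁, V₂, V₃}
  | quad V₁ V₂ V₃ V₄ => {V₁, V₂, V₃, V₄}

/-- The pairs of end points of the sides of the element. -/
def sides : MeshElement → Set (Plane × Plane)
  | tri V₁ V₂ V₃ => {(V₁, V₂), (V₂, V₃), (V₃, V₁)}
  | quad V₁ V₂ V₃ V₄ => {(V₁, V₂), (V₂, V₃), (V₃, V₄), (V₄, V₁)}

/-- The geometry mapping is injective, and its Jacobian is invertible, on the closed parameter
domain. -/
def IsRegular (e : MeshElement) : Prop :=
  InjOn e.param e.paramDomain ∧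
    ∀ q ∈ e.paramDomain, Function.Bijective (fderiv ℝ e.param q)

/-- The functions on the parameter domain that are polynomials of total degree at most `p`
(triangle), or of bi-degree at most `(p, p)` (quadrilateral). -/
def IsLocalPolynomial (e : MeshElement) (p : ℕ) (f : ℝ × ℝ → ℝ) : Prop :=
  ∃ P : MvPolynomial (Fin 2) ℝ,
    (match e with
      | tri _ _ _ => P.totalDegree ≤ p
      | quad _ _ _ _ => P.degreeOf 0 ≤ p ∧ P.degreeOf 1 ≤ p) ∧
    ∀ q ∈ e.paramDomain, f q = MvPolynomial.eval ![q.1, q.2] P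

end MeshElement

/-- All angles of the triangle `A B C` are at least `ρ`. -/
def AnglesAtLeast (ρ : ℝ) (A B C : Plane) : Prop :=
  ρ ≤ EuclideanGeometry.angle A B C ∧ ρ ≤ EuclideanGeometry.angle B C A ∧
    ρ ≤ EuclideanGeometry.angle C A B

/-- Shape regularity with parameter `ρ`: all angles of the triangle, respectively of the four
triangles obtained by splitting the quadrilateral along either diagonal, are at least `ρ`. -/
def MeshElement.IsShapeRegular (ρ : ℝ) : MeshElement → Prop
  | .tri V₁ V₂ V₃ => AnglesAtLeast ρ V₁ V₂ V₃
  | .quad V₁ V₂ V₃ V₄ =>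
      AnglesAtLeast ρ V₁ V₂ V₃ ∧ AnglesAtLeast ρ V₁ V₃ V₄ ∧
        AnglesAtLeast ρ V₁ V₂ V₄ ∧ AnglesAtLeast ρ V₂ V₃ V₄

/-! ### Mixed meshes and the Argyris-like space -/

/-- A mixed triangle and quadrilateral mesh: the closure of an open connected domain is the
disjoint union of finitely many open elements, open edges and vertices. There are no hanging
vertices, that is, every side of an element is an edge of the mesh. -/
structure MixedMesh where
  domain : Set Plane
  vertices : Finset Plane
  edges : Finset (Plane × Plane)
  elements : Finset MeshElement
  isOpen_domain : IsOpen domain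
  isConnected_domain : IsConnected domain
  edge_endpoints : ∀ E ∈ edges, E.1 ∈ vertices ∧ E.2 ∈ vertices
  element_sides : ∀ e ∈ elements, ∀ s ∈ e.sides, s ∈ edges ∨ s.swap ∈ edges
  element_regular : ∀ e ∈ elements, e.IsRegular
  closure_domain : closure domain =
    (⋃ e ∈ elements, e.openRegion) ∪ (⋃ E ∈ edges, openSegment ℝ E.1 E.2) ∪ (vertices : Set Plane)
  elements_disjoint : ∀ e ∈ elements, ∀ e' ∈ elements, e ≠ e' →
    Disjoint e.openRegion e'.openRegion
  edges_disjoint : ∀ E ∈ edges, ∀ E' ∈ edges, E ≠ E' →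
    Disjoint (openSegment ℝ E.1 E.2) (openSegment ℝ E'.1 E'.2)
  elements_edges_disjoint : ∀ e ∈ elements, ∀ E ∈ edges,
    Disjoint e.openRegion (openSegment ℝ E.1 E.2)
  elements_vertices_disjoint : ∀ e ∈ elements, ∀ V ∈ vertices, V ∉ e.openRegion
  edges_vertices_disjoint : ∀ E ∈ edges, ∀ V ∈ vertices, V ∉ openSegment ℝ E.1 E.2

/-- The Argyris-like space `A_p` of a mixed mesh; only the values on the closed domain matter.
That `φ` is `C²` at a vertex means that it is twice differentiable there (the second derivatives
of the pieces that meet at the vertex agree), and not that `φ` is `C²` on a neighbourhood. -/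
def MixedMesh.argyrisSpace (M : MixedMesh) (p : ℕ) : Set (Plane → ℝ) :=
  {φ | ContDiffOn ℝ 1 φ (closure M.domain) ∧
    (∀ e ∈ M.elements, e.IsLocalPolynomial p (φ ∘ e.param)) ∧
    (∀ V ∈ M.vertices,
      DifferentiableWithinAt ℝ (fderivWithin ℝ φ (closure M.domain)) (closure M.domain) V) ∧
    (∀ E ∈ M.edges, ∃ P : Polynomial ℝ, P.natDegree ≤ p - 1 ∧
      ∀ v ∈ Ioo (0 : ℝ) 1,
        dirDerivWithin (closure M.domain) (unitNormal E.1 E.2) φ ((1 - v) • E.1 + v • E.2)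
          = P.eval v)}

/-! ### Interpolation points and the local projector -/

/-- The equidistant points on the segment from `A` to `B`. -/
def equidistantPoint (p : ℕ) (A B : Plane) (l : ℕ) : Plane :=
  let N : ℝ := 2 * ((p / 2 : ℕ) : ℝ) - 2
  ((N - l) / N) • ((((p : ℝ) - 2) / p) • A + (2 / (p : ℝ)) • B)
    + ((l : ℝ) / N) • ((2 / (p : ℝ)) • A + (((p : ℝ) - 2) / p) • B)

/-- The points `R_l`, `1 ≤ l ≤ p - 5`, for the interpolation of values. -/
def pointR (p : ℕ) (A B : Plane) (l : ℕ) : Plane :=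
  if Odd p then
    if l ≤ (p - 5) / 2 then equidistantPoint p A B l else equidistantPoint p A B (l + 1)
  else
    if l ≤ (p - 6) / 2 then equidistantPoint p A B l
    else if l = (p - 4) / 2 then equidistantPoint p A B ((p - 2) / 2)
    else equidistantPoint p A B (l + 2)

/-- The points `S_l`, `1 ≤ l ≤ p - 4`, for the interpolation of normal derivatives. -/
def pointS (p : ℕ) (A B : Plane) (l : ℕ) : Plane :=
  if Odd p then equidistantPoint p A B l
  else
    if l ≤ (p - 4) / 2 then equidistantPoint p A B l else equidistantPoint p A B (l + 1)

namespace MeshElement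

/-- The indices of the interior interpolation points. -/
def interiorIndices (p : ℕ) : MeshElement → Set (ℕ × ℕ)
  | tri _ _ _ => {m | 2 ≤ m.1 ∧ 2 ≤ m.2 ∧ m.1 + m.2 + 2 ≤ p}
  | quad _ _ _ _ => {m | 2 ≤ m.1 ∧ m.1 + 2 ≤ p ∧ 2 ≤ m.2 ∧ m.2 + 2 ≤ p}

/-- The interior interpolation points `Q_{l,k} = F(l/p, k/p)`. -/
def pointQ (e : MeshElement) (p : ℕ) (m : ℕ × ℕ) : Plane :=
  e.param ((m.1 : ℝ) / p, (m.2 : ℝ) / p)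

/-- The function `g` satisfies on the closed element `e` all interpolation conditions
for the data sampled from `ψ`. -/
structure Interpolates (e : MeshElement) (p : ℕ) (ψ g : Plane → ℝ) : Prop where
  vertex : ∀ V ∈ e.corners, ∀ a b : ℕ, a + b ≤ 2 →
    partialWithin e.closedRegion a b g V = partialWithin e.closedRegion a b ψ V
  edge_value : ∀ s ∈ e.sides, ∀ l : ℕ, 1 ≤ l → l ≤ p - 5 →
    g (pointR p s.1 s.2 l) = ψ (pointR p s.1 s.2 l)
  edge_normal : ∀ s ∈ e.sides, ∀ l : ℕ, 1 ≤ l → l ≤ p - 4 →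
    dirDerivWithin e.closedRegion (unitNormal s.1 s.2) g (pointS p s.1 s.2 l)
      = dirDerivWithin e.closedRegion (unitNormal s.1 s.2) ψ (pointS p s.1 s.2 l)
  interior_value : ∀ m ∈ e.interiorIndices p, g (e.pointQ p m) = ψ (e.pointQ p m)

end MeshElement

namespace MixedMesh

/-- On the closed element `e` the function `g` is the restriction of a member of `A_p`, and it
satisfies there the interpolation conditions for the data sampled from `ψ`. -/
def IsLocalInterpolant (M : MixedMesh) (p : ℕ) (e : MeshElement) (ψ g : Plane → ℝ) : Prop :=
  (∃ φ ∈ M.argyrisSpace p, EqOn g φ e.closedRegion) ∧ e.Interpolates p ψ g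

/-- The local projector: `M.localProjector p e ψ` is the local interpolant of `ψ` on the closed
element `e` (existence and uniqueness on `e` are part of the theorem). -/
def localProjector (M : MixedMesh) (p : ℕ) (e : MeshElement) (ψ : Plane → ℝ) : Plane → ℝ :=
  Classical.epsilon (M.IsLocalInterpolant p e ψ)

end MixedMesh

end

/-!
The interpolation conditions split along the boundary of an element. On a side from `X` to `Y`, the
trace (a polynomial of degree at most `p`) and the derivative in the direction of the unit normal
(of degree at most `p - 1`) solve two univariate Hermite problems, whose data are the derivatives
up to order two at `X` and `Y`, the values at the points `R_l` and the normal derivatives at the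
points `S_l`. So they exist, are unique, and depend on the data on this side alone
(`JetField.exists_isEdgePair`, `JetField.IsEdgePair.unique`); since the sets of points are
symmetric, the orientation of the side is irrelevant (`JetField.IsEdgePair.reverse`).

On the parameter domain, these polynomials prescribe the trace of the pull-back `P = g ∘ F` on every
side and its derivative in a direction transversal to the side. Together with the values at the
interior points they determine `P`: if all of them vanish, `P` vanishes to second order on the
boundary, and counting zeros on the lines `u = l / p` gives `P = 0`
(`CellKind.eq_zero_of_vanishesOnBoundary`). This proves that the local interpolant is unique
(`MixedMesh.IsLocalInterpolant.eqOn`). By a count of dimensions, `P` can be found for any traces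
that are compatible at the corners (`CellKind.exists_of_compatible_traces`), and those that come
from the edges are compatible since they arise from common derivatives at the vertices. For the
existence of a local interpolant a member of the space on the whole mesh is needed: the data are
continued by zero outside the element, and the interpolants of the single elements fit together,
because on a common side they have the same trace and the same normal derivative
(`MixedMesh.exists_mem_argyrisSpace`).

For the estimates, a polynomial is bounded by its interpolation data with a constant that depends
only on `p` (`Polynomial.exists_hermite_bound`, `CellKind.exists_bipartial_bound`). The passage
between the element and the parameter domain costs powers of the diameter, of the reciprocal
lengths of the sides, and of the reciprocal Jacobian. Shape regularity makes any two sides of the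
triangles in question comparable, which bounds the sides and the areas of these triangles from
below. These areas give the Jacobian at the corners, and as the Jacobian is affine and has no zero,
it is smallest at a corner (`MeshElement.exists_hasSize`). So the derivatives of order at most two
of the interpolant are bounded pointwise (`MixedMesh.exists_interpolant_bound`), and integration
over an element of bounded area gives the bound in the Sobolev norm.
-/

noncomputable section

/-! ### Families of linear functionals -/

section LinearAlgebra

variable {V ι : Type*} [AddCommGroup V] [Module ℝ V] [Fintype ι]

/-- A separating finite family of functionals recovers every vector by a fixed linear formula.
This is the source of all bounds on polynomials in terms of their interpolation data. -/
theorem exists_reconstruction_of_separating (l : ι → V →ₗ[ℝ] ℝ)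
    (h : ∀ v, (∀ i, l i v = 0) → v = 0) : ∃ B : ι → V, ∀ v, v = ∑ i, l i v • B i := by
  classical
  obtain ⟨g, hg⟩ := LinearMap.exists_leftInverse_of_injective (LinearMap.pi l)
    (LinearMap.ker_eq_bot'.2 fun v hv => h v fun i => congrFun hv i)
  refine ⟨fun i => g (Pi.single i 1), fun v => ?_⟩
  calc v = g (LinearMap.pi l v) := (LinearMap.congr_fun hg v).symm
    _ = _ := by
      rw [LinearMap.pi_apply_eq_sum_univ g]
      refine Finset.sum_congr rfl fun i _ => ?_
      rw [LinearMap.pi_apply]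
      congr 2
      ext j
      simp [Pi.single_apply, eq_comm]

/-- Unisolvence: as many separating functionals as the dimension attain arbitrary values. -/
theorem exists_of_separating_of_finrank_eq [FiniteDimensional ℝ V] (l : ι → V →ₗ[ℝ] ℝ)
    (h : ∀ v, (∀ i, l i v = 0) → v = 0) (hd : Module.finrank ℝ V = Fintype.card ι) (y : ι → ℝ) :
    ∃ v, ∀ i, l i v = y i := by
  have hinj : Function.Injective (LinearMap.pi l) := by
    rw [← LinearMap.ker_eq_bot]
    exact LinearMap.ker_eq_bot'.2 fun v hv => h v fun i => congrFun hv i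
  have hs := (LinearMap.injective_iff_surjective_of_finrank_eq_finrank
    (f := LinearMap.pi l) (by simp [hd])).1 hinj
  obtain ⟨v, hv⟩ := hs y
  exact ⟨v, fun i => congrFun hv i⟩

end LinearAlgebra

/-! ### Univariate Hermite interpolation -/

namespace Polynomial

/-- A polynomial of degree less than the number of its zeros, counted with multiplicities, is
zero. -/
theorem eq_zero_of_hermite_eq_zero {ι : Type*} {f : ℝ[X]} (s : Finset ι) (x : ι → ℝ)
    (hx : InjOn x s) (m : ι → ℕ) (hdeg : f.natDegree < ∑ i ∈ s, m i)
    (h : ∀ i ∈ s, ∀ j < m i, (derivative^[j] f).eval (x i) = 0) : f = 0 := by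
  classical
  by_contra hf
  have key : ∀ i ∈ s, m i ≤ f.roots.count (x i) := by
    intro i hi
    rw [count_roots]
    rcases Nat.eq_zero_or_pos (m i) with h0 | h0
    · omega
    · have := (lt_rootMultiplicity_iff_isRoot_iterate_derivative (p := f) (t := x i)
        (n := m i - 1) hf).2 fun j hj => h i hi j (by omega)
      omega
  have : ∑ i ∈ s, m i ≤ f.natDegree := by
    calc ∑ i ∈ s, m i ≤ ∑ i ∈ s, f.roots.count (x i) := Finset.sum_le_sum key
      _ = ∑ y ∈ s.image x, f.roots.count y :=
        (Finset.sum_image (f := fun y => f.roots.count y) hx).symm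
      _ ≤ ∑ y ∈ s.image x ∪ f.roots.toFinset, f.roots.count y :=
        Finset.sum_le_sum_of_subset Finset.subset_union_left
      _ = f.roots.card := by
        rw [Multiset.sum_count_eq_card]; intro a ha; simp_all
      _ ≤ f.natDegree := card_roots' f
  omega

/-- The functional `f ↦ f⁽ʲ⁾(x)` on the polynomials of degree less than `n`. -/
def hermiteFunctional (n : ℕ) (x : ℝ) (j : ℕ) : degreeLT ℝ n →ₗ[ℝ] ℝ :=
  (leval x) ∘ₗ ((derivative (R := ℝ)) ^ j) ∘ₗ (degreeLT ℝ n).subtype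

theorem hermiteFunctional_apply (n : ℕ) (x : ℝ) (j : ℕ) (f : degreeLT ℝ n) :
    hermiteFunctional n x j f = (derivative^[j] (f : ℝ[X])).eval x := by
  simp [hermiteFunctional, leval, Module.End.pow_apply]

theorem hermiteFunctional_separating (s : Finset ℝ) (m : ℝ → ℕ) {n : ℕ}
    (hn : n ≤ ∑ x ∈ s, m x) (f : degreeLT ℝ n)
    (h : ∀ i : (x : s) × Fin (m x), hermiteFunctional n i.1 i.2 f = 0) : f = 0 := by
  by_contra hne
  have hne' : (f : ℝ[X]) ≠ 0 := fun h0 => hne (Subtype.ext h0)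
  refine hne' (eq_zero_of_hermite_eq_zero s id (injOn_id _) m ?_ fun x hx j hj => ?_)
  · have := mem_degreeLT.1 f.2
    rw [degree_eq_natDegree hne'] at this
    have : (f : ℝ[X]).natDegree < n := by exact_mod_cast this
    omega
  · simpa [hermiteFunctional_apply] using h ⟨⟨x, hx⟩, ⟨j, hj⟩⟩

/-- The Hermite interpolation problem on the nodes `s` with multiplicities `m` is solvable. -/
theorem exists_hermite (s : Finset ℝ) (m : ℝ → ℕ) (n : ℕ) (hn : ∑ x ∈ s, m x = n + 1)
    (y : ℝ → ℕ → ℝ) : ∃ f : ℝ[X], f.natDegree ≤ n ∧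
      ∀ x ∈ s, ∀ j < m x, (derivative^[j] f).eval x = y x j := by
  have : FiniteDimensional ℝ (degreeLT ℝ (n + 1)) :=
    Module.Finite.equiv (degreeLTEquiv ℝ (n + 1)).symm
  obtain ⟨f, hf⟩ := exists_of_separating_of_finrank_eq
    (fun i : (x : s) × Fin (m x) => hermiteFunctional (n + 1) i.1 i.2)
    (hermiteFunctional_separating s m hn.ge)
    (by rw [(degreeLTEquiv ℝ (n + 1)).finrank_eq]
        simp [Fintype.card_sigma, ← hn, Finset.sum_attach s m]) (fun i => y i.1 i.2)
  refine ⟨f, ?_, fun x hx j hj => ?_⟩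
  · have := mem_degreeLT.1 f.2
    exact natDegree_le_of_degree_le (Order.le_of_lt_succ this)
  · simpa [hermiteFunctional_apply] using hf ⟨⟨x, hx⟩, ⟨j, hj⟩⟩

/-- The solution of a Hermite interpolation problem and its derivative are bounded by the data, with
a constant that depends on the nodes only. -/
theorem exists_hermite_bound (s : Finset ℝ) (m : ℝ → ℕ) (n : ℕ) (hn : ∑ x ∈ s, m x = n + 1) :
    ∃ C : ℝ, 0 ≤ C ∧ ∀ f : ℝ[X], f.natDegree ≤ n → ∀ M : ℝ,
      (∀ x ∈ s, ∀ j < m x, |(derivative^[j] f).eval x| ≤ M) →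
      ∀ t ∈ Icc (0 : ℝ) 1, |f.eval t| ≤ C * M ∧ |(derivative f).eval t| ≤ C * M := by
  obtain ⟨B, hB⟩ := exists_reconstruction_of_separating
    (fun i : (x : s) × Fin (m x) => hermiteFunctional (n + 1) i.1 i.2)
    (hermiteFunctional_separating s m hn.ge)
  have hb : ∀ g : ℝ[X], ∃ c, ∀ t ∈ Icc (0 : ℝ) 1, |g.eval t| ≤ c := fun g => by
    obtain ⟨c, hc⟩ := isCompact_Icc.exists_bound_of_continuousOn (s := Icc (0 : ℝ) 1)
      g.continuous.continuousOn
    exact ⟨c, hc⟩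
  choose c hc using hb
  have hc0 : ∀ g, 0 ≤ c g := fun g => (abs_nonneg _).trans (hc g 0 ⟨le_rfl, zero_le_one⟩)
  refine ⟨∑ i, (c (B i) + c (derivative (B i))),
    Finset.sum_nonneg fun i _ => add_nonneg (hc0 _) (hc0 _), fun f hf M hM t ht => ?_⟩
  have hf' : f ∈ degreeLT ℝ (n + 1) := mem_degreeLT.2 <|
    (degree_le_of_natDegree_le hf).trans_lt (by exact_mod_cast Nat.lt_succ_self n)
  have he : f = ∑ i : (x : s) × Fin (m x),
      ((derivative^[i.2] f).eval (i.1 : ℝ)) • (B i : ℝ[X]) := by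
    have := congrArg Subtype.val (hB ⟨f, hf'⟩)
    simpa [hermiteFunctional_apply] using this
  have hM' : ∀ i : (x : s) × Fin (m x), |(derivative^[i.2] f).eval (i.1 : ℝ)| ≤ M :=
    fun i => hM _ i.1.2 _ i.2.2
  have hest : ∀ g : (x : s) × Fin (m x) → ℝ, (∀ i, |g i| ≤ c (B i) + c (derivative (B i))) →
      |∑ i : (x : s) × Fin (m x), (derivative^[i.2] f).eval (i.1 : ℝ) * g i|
        ≤ (∑ i, (c (B i) + c (derivative (B i)))) * M := by
    intro g hg
    refine (Finset.abs_sum_le_sum_abs _ _).trans ?_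
    rw [Finset.sum_mul]
    refine Finset.sum_le_sum fun i _ => ?_
    rw [abs_mul, mul_comm]
    exact mul_le_mul (hg i) (hM' i) (abs_nonneg _) (add_nonneg (hc0 _) (hc0 _))
  constructor
  · have h1 := congrArg (eval t) he
    simp only [eval_finsetSum, eval_smul, smul_eq_mul] at h1
    rw [h1]
    exact hest _ fun i => (hc _ t ht).trans (le_add_of_nonneg_right (hc0 _))
  · have h1 := congrArg (fun g => eval t (derivative g)) he
    simp only [derivative_sum, derivative_smul, eval_finsetSum, eval_smul, smul_eq_mul] at h1
    rw [h1]
    exact hest _ fun i => (hc _ t ht).trans (le_add_of_nonneg_left (hc0 _))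

end Polynomial

/-! ### Bivariate polynomials with prescribed exponents -/

open Polynomial in
/-- The value at `q` of the partial derivative `∂_u^a ∂_v^b` of the polynomial
`∑ c (i, j) u^i v^j`, as a linear functional of the coefficients `c`. -/
def bipartial (S : Finset (ℕ × ℕ)) (a b : ℕ) (q : ℝ × ℝ) : (S → ℝ) →ₗ[ℝ] ℝ :=
  ∑ m : S, ((derivative^[a] (X ^ m.1.1 : ℝ[X])).eval q.1 *
    (derivative^[b] (X ^ m.1.2 : ℝ[X])).eval q.2) • LinearMap.proj m

/-- The derivative at `q` in the direction `w` of the polynomial with coefficients `c`. -/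
def bideriv (S : Finset (ℕ × ℕ)) (q w : ℝ × ℝ) : (S → ℝ) →ₗ[ℝ] ℝ :=
  w.1 • bipartial S 1 0 q + w.2 • bipartial S 0 1 q

section Bivariate

open Polynomial

variable {S : Finset (ℕ × ℕ)}

theorem bipartial_apply (a b : ℕ) (q : ℝ × ℝ) (c : S → ℝ) :
    bipartial S a b q c = ∑ m : S, (derivative^[a] (X ^ m.1.1 : ℝ[X])).eval q.1 *
      (derivative^[b] (X ^ m.1.2 : ℝ[X])).eval q.2 * c m := by
  simp [bipartial]

theorem bipartial_zero_zero (q : ℝ × ℝ) (c : S → ℝ) :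
    bipartial S 0 0 q c = ∑ m : S, q.1 ^ m.1.1 * q.2 ^ m.1.2 * c m := by
  simp [bipartial_apply]

theorem bideriv_apply (q w : ℝ × ℝ) (c : S → ℝ) :
    bideriv S q w c = w.1 * bipartial S 1 0 q c + w.2 * bipartial S 0 1 q c := by
  simp [bideriv]

theorem hasFDerivAt_bipartial (a b : ℕ) (c : S → ℝ) (q : ℝ × ℝ) :
    HasFDerivAt (fun q => bipartial S a b q c)
      (bipartial S (a + 1) b q c • ContinuousLinearMap.fst ℝ ℝ ℝ +
        bipartial S a (b + 1) q c • ContinuousLinearMap.snd ℝ ℝ ℝ) q := by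
  have h : ∀ m : S, HasFDerivAt (fun q : ℝ × ℝ => (derivative^[a] (X ^ m.1.1 : ℝ[X])).eval q.1 *
      (derivative^[b] (X ^ m.1.2 : ℝ[X])).eval q.2 * c m)
      ((((derivative^[a + 1] (X ^ m.1.1 : ℝ[X])).eval q.1 *
      (derivative^[b] (X ^ m.1.2 : ℝ[X])).eval q.2 * c m)) • ContinuousLinearMap.fst ℝ ℝ ℝ +
      (((derivative^[a] (X ^ m.1.1 : ℝ[X])).eval q.1 *
      (derivative^[b + 1] (X ^ m.1.2 : ℝ[X])).eval q.2 * c m)) •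
        ContinuousLinearMap.snd ℝ ℝ ℝ) q := by
    intro m
    have h1 : HasFDerivAt (fun q : ℝ × ℝ => (derivative^[a] (X ^ m.1.1 : ℝ[X])).eval q.1)
        ((derivative^[a + 1] (X ^ m.1.1 : ℝ[X])).eval q.1 • ContinuousLinearMap.fst ℝ ℝ ℝ) q := by
      rw [Function.iterate_succ_apply']
      exact (Polynomial.hasDerivAt _ _).comp_hasFDerivAt q hasFDerivAt_fst
    have h2 : HasFDerivAt (fun q : ℝ × ℝ => (derivative^[b] (X ^ m.1.2 : ℝ[X])).eval q.2)
        ((derivative^[b + 1] (X ^ m.1.2 : ℝ[X])).eval q.2 • ContinuousLinearMap.snd ℝ ℝ ℝ) q := by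
      rw [Function.iterate_succ_apply']
      exact (Polynomial.hasDerivAt _ _).comp_hasFDerivAt q hasFDerivAt_snd
    refine ((h1.mul h2).mul_const (c m)).congr_fderiv ?_
    ext <;> simp <;> ring
  have hs := HasFDerivAt.fun_sum (u := Finset.univ) fun m _ => h m
  refine (hs.congr_fderiv ?_).congr_of_eventuallyEq
    (Filter.Eventually.of_forall fun q => bipartial_apply a b q c)
  simp only [bipartial_apply]
  rw [Finset.sum_add_distrib, Finset.sum_smul, Finset.sum_smul]

theorem contDiff_bipartial (a b : ℕ) (c : S → ℝ) {n : WithTop ℕ∞} :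
    ContDiff ℝ n (fun q => bipartial S a b q c) := by
  have : (fun q => bipartial S a b q c) = fun q : ℝ × ℝ => ∑ m : S,
      (derivative^[a] (X ^ m.1.1 : ℝ[X])).eval q.1 *
      (derivative^[b] (X ^ m.1.2 : ℝ[X])).eval q.2 * c m := funext fun q => bipartial_apply a b q c
  rw [this]
  refine ContDiff.sum fun m _ => ?_
  have h : ∀ f : ℝ[X], ContDiff ℝ n fun x : ℝ => f.eval x := fun f => by
    have h : ContDiff ℝ n fun x : ℝ => aeval x f := f.contDiff_aeval n
    simpa only [coe_aeval_eq_eval] using h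
  exact (((h _).comp contDiff_fst).mul ((h _).comp contDiff_snd)).mul contDiff_const

/-- The restriction of a partial derivative to the line `t ↦ A + t τ`. -/
def linePolynomial (S : Finset (ℕ × ℕ)) (a b : ℕ) (A τ : ℝ × ℝ) (c : S → ℝ) : ℝ[X] :=
  ∑ m : S, C (c m) * ((derivative^[a] (X ^ m.1.1 : ℝ[X])).comp (C A.1 + C τ.1 * X) *
    (derivative^[b] (X ^ m.1.2 : ℝ[X])).comp (C A.2 + C τ.2 * X))

theorem eval_linePolynomial (a b : ℕ) (A τ : ℝ × ℝ) (c : S → ℝ) (t : ℝ) :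
    (linePolynomial S a b A τ c).eval t = bipartial S a b (A + t • τ) c := by
  rw [linePolynomial, bipartial_apply, eval_finsetSum]
  refine Finset.sum_congr rfl fun m _ => ?_
  rw [eval_C_mul, eval_mul, eval_comp, eval_comp]
  simp only [eval_add, eval_mul, eval_C, eval_X, Prod.fst_add, Prod.snd_add, Prod.smul_fst,
    Prod.smul_snd, smul_eq_mul]
  rw [mul_comm t, mul_comm t]
  ring

theorem derivative_linePolynomial (a b : ℕ) (A τ : ℝ × ℝ) (c : S → ℝ) :
    derivative (linePolynomial S a b A τ c) = C τ.1 * linePolynomial S (a + 1) b A τ c +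
      C τ.2 * linePolynomial S a (b + 1) A τ c := by
  simp only [linePolynomial, derivative_sum, Finset.mul_sum, ← Finset.sum_add_distrib]
  refine Finset.sum_congr rfl fun m _ => ?_
  simp only [Function.iterate_succ_apply', derivative_mul, derivative_comp, derivative_C,
    derivative_add, derivative_X]
  ring

theorem natDegree_comp_line_le (f : ℝ[X]) (x y : ℝ) :
    (f.comp (C x + C y * X)).natDegree ≤ f.natDegree := by
  refine natDegree_comp_le.trans ?_
  have : (C x + C y * X : ℝ[X]).natDegree ≤ 1 := by compute_degree
  nlinarith

theorem natDegree_linePolynomial_le (a b n : ℕ) (A τ : ℝ × ℝ) (c : S → ℝ)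
    (h : ∀ m ∈ S, a ≤ m.1 → b ≤ m.2 → m.1 - a + (m.2 - b) ≤ n) :
    (linePolynomial S a b A τ c).natDegree ≤ n := by
  refine natDegree_sum_le_of_forall_le _ _ fun m _ => ?_
  refine (natDegree_C_mul_le _ _).trans ?_
  by_cases ha : a ≤ m.1.1
  · by_cases hb : b ≤ m.1.2
    · refine natDegree_mul_le.trans ((add_le_add (natDegree_comp_line_le _ _ _)
        (natDegree_comp_line_le _ _ _)).trans (le_trans ?_ (h _ m.2 ha hb)))
      exact add_le_add ((natDegree_iterate_derivative _ _).trans (by simp))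
        ((natDegree_iterate_derivative _ _).trans (by simp))
    · rw [iterate_derivative_eq_zero (p := X ^ m.1.2) (x := b) (by simp; omega)]
      simp
  · rw [iterate_derivative_eq_zero (p := X ^ m.1.1) (x := a) (by simp; omega)]
    simp

/-- Along a line that is parallel to an axis the degree is bounded by the partial degrees. -/
theorem natDegree_linePolynomial_le_of_axis (a b n : ℕ) (A τ : ℝ × ℝ) (c : S → ℝ)
    (hτ : τ.1 = 0 ∨ τ.2 = 0) (h : ∀ m ∈ S, m.1 ≤ n ∧ m.2 ≤ n) :
    (linePolynomial S a b A τ c).natDegree ≤ n := by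
  refine natDegree_sum_le_of_forall_le _ _ fun m _ => ?_
  refine (natDegree_C_mul_le _ _).trans (natDegree_mul_le.trans ?_)
  have hm := h _ m.2
  have key : ∀ (a i : ℕ) (x y : ℝ), i ≤ n →
      ((derivative^[a] (X ^ i : ℝ[X])).comp (C x + C y * X)).natDegree ≤ n := fun a i x y hi =>
    (natDegree_comp_line_le _ _ _).trans ((natDegree_iterate_derivative _ _).trans (by simp; omega))
  have key0 : ∀ (f : ℝ[X]) (x : ℝ), (f.comp (C x + C 0 * X)).natDegree = 0 := by simp
  rcases hτ with h0 | h0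
  · rw [h0, key0, zero_add]; exact key _ _ _ _ hm.2
  · rw [h0, key0, add_zero]; exact key _ _ _ _ hm.1

/-- The coefficient of `v^j`, a polynomial in `u`. -/
def coeffPolynomial (S : Finset (ℕ × ℕ)) (c : S → ℝ) (j : ℕ) : ℝ[X] :=
  ∑ m : S, if m.1.2 = j then C (c m) * X ^ m.1.1 else 0

theorem natDegree_coeffPolynomial_le (c : S → ℝ) (j n : ℕ) (h : ∀ m ∈ S, m.2 = j → m.1 ≤ n) :
    (coeffPolynomial S c j).natDegree ≤ n := by
  refine natDegree_sum_le_of_forall_le _ _ fun m _ => ?_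
  split_ifs with hj
  · exact (natDegree_C_mul_X_pow_le _ _).trans (h _ m.2 hj)
  · simp

theorem eq_zero_of_coeffPolynomial_eq_zero (c : S → ℝ) (h : ∀ j, coeffPolynomial S c j = 0) :
    c = 0 := by
  funext m
  have := congrArg (fun f => f.coeff m.1.1) (h m.1.2)
  simp only [coeffPolynomial, finsetSum_coeff, coeff_zero] at this
  rw [Finset.sum_eq_single m] at this
  · simpa using this
  · intro b _ hb
    split_ifs with h2
    · rw [coeff_C_mul_X_pow, if_neg]
      intro h1
      exact hb (Subtype.ext (Prod.ext h1.symm h2))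
    · simp
  · simp

/-- A linear functional applied to the variable `u`; the result is a polynomial in `v`. -/
def rowPolynomial (S : Finset (ℕ × ℕ)) (l : ℝ[X] →ₗ[ℝ] ℝ) (c : S → ℝ) : ℝ[X] :=
  ∑ m : S, C (l (X ^ m.1.1) * c m) * X ^ m.1.2

theorem coeff_rowPolynomial (l : ℝ[X] →ₗ[ℝ] ℝ) (c : S → ℝ) (j : ℕ) :
    (rowPolynomial S l c).coeff j = l (coeffPolynomial S c j) := by
  simp only [rowPolynomial, coeffPolynomial, finsetSum_coeff, map_sum]
  refine Finset.sum_congr rfl fun m _ => ?_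
  rw [coeff_C_mul_X_pow, apply_ite l, map_zero, ← smul_eq_C_mul, map_smul, smul_eq_mul, mul_comm]
  simp only [eq_comm]

theorem eval_iterate_derivative_rowPolynomial (c : S → ℝ) (a b : ℕ) (u v : ℝ) :
    (derivative^[b] (rowPolynomial S (leval u ∘ₗ (derivative (R := ℝ)) ^ a) c)).eval v
      = bipartial S a b (u, v) c := by
  simp only [rowPolynomial, bipartial_apply, iterate_derivative_sum, iterate_derivative_C_mul,
    eval_finsetSum]
  refine Finset.sum_congr rfl fun m _ => ?_
  simp [leval, Module.End.pow_apply]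
  ring

end Bivariate

/-! ### Reference cells -/

/-- The two types of elements. -/
inductive CellKind : Type
  | tri : CellKind
  | quad : CellKind

namespace CellKind

/-- The number of sides. -/
abbrev sides : CellKind → ℕ
  | tri => 3
  | quad => 4

/-- The vertices of the parameter domain, in cyclic order. -/
def corner : (k : CellKind) → Fin k.sides → ℝ × ℝ
  | tri => ![(0, 0), (1, 0), (0, 1)]
  | quad => ![(0, 0), (1, 0), (1, 1), (0, 1)]

/-- The direction of a side, from its first end point to its second. -/
def along : (k : CellKind) → Fin k.sides → ℝ × ℝ
  | tri => ![(1, 0), (-1, 1), (0, -1)]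
  | quad => ![(1, 0), (0, 1), (-1, 0), (0, -1)]

/-- The direction from the first end point of a side to the preceding vertex, which is
transversal to the side. -/
def across : (k : CellKind) → Fin k.sides → ℝ × ℝ
  | tri => ![(0, 1), (-1, 0), (1, -1)]
  | quad => ![(0, 1), (-1, 0), (0, -1), (1, 0)]

/-- The following vertex. -/
def next : (k : CellKind) → Fin k.sides → Fin k.sides
  | tri => ![1, 2, 0]
  | quad => ![1, 2, 3, 0]

/-- The preceding vertex. -/
def prev : (k : CellKind) → Fin k.sides → Fin k.sides
  | tri => ![2, 0, 1]
  | quad => ![3, 0, 1, 2]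

/-- The parameter domain. -/
def cell : CellKind → Set (ℝ × ℝ)
  | tri => {q | 0 ≤ q.1 ∧ q.1 ≤ 1 ∧ 0 ≤ q.2 ∧ q.2 ≤ 1 - q.1}
  | quad => Icc 0 1 ×ˢ Icc 0 1

/-- The pairs `(i, j)` with `i + j < n` (triangle), or with `i, j < n` (quadrilateral). -/
def lattice : CellKind → ℕ → Finset (ℕ × ℕ)
  | tri, n => (Finset.range n ×ˢ Finset.range n).filter fun m => m.1 + m.2 < n
  | quad, n => Finset.range n ×ˢ Finset.range n

/-- The exponents of the monomials of total degree, respectively of bi-degree, at most `p`. -/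
def exponents (k : CellKind) (p : ℕ) : Finset (ℕ × ℕ) := k.lattice (p + 1)

/-- The indices of the interior interpolation points, shifted by `(2, 2)`. -/
def inner : CellKind → ℕ → Finset (ℕ × ℕ)
  | tri, p => tri.lattice (p - 5)
  | quad, p => quad.lattice (p - 3)

/-- The interior interpolation points. -/
def innerPoint (p : ℕ) (m : ℕ × ℕ) : ℝ × ℝ := (((m.1 + 2 : ℕ) : ℝ) / p, ((m.2 + 2 : ℕ) : ℝ) / p)

theorem corner_next (k : CellKind) (i : Fin k.sides) :
    k.corner (k.next i) = k.corner i + k.along i := by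
  cases k <;> fin_cases i <;> simp [corner, next, along]

theorem next_prev (k : CellKind) (i : Fin k.sides) : k.next (k.prev i) = i := by
  cases k <;> fin_cases i <;> rfl

theorem across_eq_neg_along_prev (k : CellKind) (i : Fin k.sides) :
    k.across i = -k.along (k.prev i) := by
  cases k <;> fin_cases i <;> simp [across, prev, along]

/-- The determinant of the side direction and the cross direction is one. -/
theorem along_across_det (k : CellKind) (i : Fin k.sides) :
    (k.along i).1 * (k.across i).2 - (k.along i).2 * (k.across i).1 = 1 := by
  cases k <;> fin_cases i <;> simp [across, along]

theorem corner_add_smul_along_mem (k : CellKind) (i : Fin k.sides) {t : ℝ}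
    (ht : t ∈ Icc (0 : ℝ) 1) : k.corner i + t • k.along i ∈ k.cell := by
  obtain ⟨h0, h1⟩ := ht
  cases k <;> fin_cases i <;> simp [cell, corner, along] <;> constructor <;> linarith

end CellKind

namespace Polynomial

theorem eq_zero_of_eval_eq_zero_on_Icc {f : ℝ[X]} (h : ∀ t ∈ Icc (0 : ℝ) 1, f.eval t = 0) :
    f = 0 :=
  eq_zero_of_infinite_isRoot f ((Icc_infinite zero_lt_one).mono h)

end Polynomial

/-! ### Polynomials with vanishing boundary traces -/

namespace CellKind

open Polynomial

theorem mem_lattice_quad {n : ℕ} {m : ℕ × ℕ} : m ∈ quad.lattice n ↔ m.1 < n ∧ m.2 < n := by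
  simp [lattice]

theorem mem_lattice_tri {n : ℕ} {m : ℕ × ℕ} : m ∈ tri.lattice n ↔ m.1 + m.2 < n := by
  simp [lattice]; omega

/-- If a polynomial and its cross derivative vanish along a side, then so does its gradient. -/
theorem bipartial_eq_zero_of_traces {k : CellKind} {S : Finset (ℕ × ℕ)} {c : S → ℝ}
    {i : Fin k.sides}
    (h0 : ∀ t ∈ Icc (0 : ℝ) 1, bipartial S 0 0 (k.corner i + t • k.along i) c = 0)
    (h1 : ∀ t ∈ Icc (0 : ℝ) 1, bideriv S (k.corner i + t • k.along i) (k.across i) c = 0)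
    {t : ℝ} (ht : t ∈ Icc (0 : ℝ) 1) :
    bipartial S 1 0 (k.corner i + t • k.along i) c = 0 ∧
      bipartial S 0 1 (k.corner i + t • k.along i) c = 0 := by
  have hL : linePolynomial S 0 0 (k.corner i) (k.along i) c = 0 :=
    eq_zero_of_eval_eq_zero_on_Icc fun t ht => by rw [eval_linePolynomial, h0 t ht]
  have hD := congrArg (eval t) (derivative_linePolynomial 0 0 (k.corner i) (k.along i) c)
  simp only [hL, derivative_zero, eval_zero, eval_add, eval_mul, eval_C,
    eval_linePolynomial] at hD
  have hX := h1 t ht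
  rw [bideriv_apply] at hX
  have hdet := along_across_det k i
  simp only [zero_add] at hD
  constructor
  · linear_combination (-(bipartial S 1 0 (k.corner i + t • k.along i) c)) * hdet
      - (k.across i).2 * hD - (k.along i).2 * hX
  · linear_combination (-(bipartial S 0 1 (k.corner i + t • k.along i) c)) * hdet
      + (k.across i).1 * hD + (k.along i).1 * hX

/-- On every side the polynomial and its cross derivative vanish. -/
structure VanishesOnBoundary (k : CellKind) (S : Finset (ℕ × ℕ)) (c : S → ℝ) : Prop where
  trace : ∀ i, ∀ t ∈ Icc (0 : ℝ) 1, bipartial S 0 0 (k.corner i + t • k.along i) c = 0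
  cross : ∀ i, ∀ t ∈ Icc (0 : ℝ) 1, bideriv S (k.corner i + t • k.along i) (k.across i) c = 0

theorem VanishesOnBoundary.jet {k : CellKind} {S : Finset (ℕ × ℕ)} {c : S → ℝ}
    (h : VanishesOnBoundary k S c) (i : Fin k.sides) {t : ℝ} (ht : t ∈ Icc (0 : ℝ) 1)
    {q : ℝ × ℝ} (hq : q = k.corner i + t • k.along i) :
    bipartial S 0 0 q c = 0 ∧ bipartial S 1 0 q c = 0 ∧ bipartial S 0 1 q c = 0 := by
  subst hq
  exact ⟨h.trace i t ht, bipartial_eq_zero_of_traces (h.trace i) (h.cross i) ht⟩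

/-- The polynomial `∂_u^a P(u, ·)` vanishes if it has enough zeros. -/
theorem rowPolynomial_eq_zero {S : Finset (ℕ × ℕ)} {c : S → ℝ} (a n : ℕ) (u : ℝ)
    (hdeg : ∀ j > n, coeffPolynomial S c j = 0) (s : Finset ℕ) (x : ℕ → ℝ) (hx : InjOn x s)
    (m : ℕ → ℕ) (hm : n < ∑ i ∈ s, m i)
    (h : ∀ i ∈ s, ∀ b < m i, bipartial S a b (u, x i) c = 0) :
    ∀ j, (derivative^[a] (coeffPolynomial S c j)).eval u = 0 := by
  have h0 : rowPolynomial S (leval u ∘ₗ (derivative (R := ℝ)) ^ a) c = 0 := by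
    refine eq_zero_of_hermite_eq_zero s x hx m (lt_of_le_of_lt ?_ hm) fun i hi b hb => ?_
    · rw [natDegree_le_iff_coeff_eq_zero]
      intro j hj
      rw [coeff_rowPolynomial, hdeg j hj, map_zero]
    · rw [eval_iterate_derivative_rowPolynomial, h i hi b hb]
  intro j
  have := coeff_rowPolynomial (leval u ∘ₗ (derivative (R := ℝ)) ^ a) c j
  rw [h0, coeff_zero] at this
  simpa [leval, Module.End.pow_apply] using this.symm

theorem rowPolynomial_eq_zero_of_Icc {S : Finset (ℕ × ℕ)} {c : S → ℝ} (a : ℕ) (u : ℝ)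
    (h : ∀ v ∈ Icc (0 : ℝ) 1, bipartial S a 0 (u, v) c = 0) :
    ∀ j, (derivative^[a] (coeffPolynomial S c j)).eval u = 0 := by
  have h0 : rowPolynomial S (leval u ∘ₗ (derivative (R := ℝ)) ^ a) c = 0 :=
    eq_zero_of_eval_eq_zero_on_Icc fun v hv => by
      have := eval_iterate_derivative_rowPolynomial c a 0 u v
      rw [h v hv] at this
      simpa using this
  intro j
  have := coeff_rowPolynomial (leval u ∘ₗ (derivative (R := ℝ)) ^ a) c j
  rw [h0, coeff_zero] at this
  simpa [leval, Module.End.pow_apply] using this.symm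

theorem injOn_div_nat {p : ℕ} (hp : 0 < p) (s : Set ℕ) : InjOn (fun l : ℕ => (l : ℝ) / p) s := by
  intro a _ b _ h
  have hp' : (p : ℝ) ≠ 0 := by positivity
  simpa [div_left_inj' hp'] using h

theorem mem_Icc_div_nat {p l : ℕ} (h : l ≤ p) : (l : ℝ) / p ∈ Icc (0 : ℝ) 1 :=
  ⟨by positivity, div_le_one_of_le₀ (by exact_mod_cast h) (by positivity)⟩

/-- Multiplicity two at two (possibly equal) indices and one elsewhere. -/
def doubleAt (x y : ℕ) (l : ℕ) : ℕ := if l = x ∨ l = y then 2 else 1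

theorem sum_doubleAt {x y : ℕ} (hxy : x ≠ y) (s : Finset ℕ) (hx : x ∉ s) (hy : y ∉ s) :
    ∑ l ∈ insert x (insert y s), doubleAt x y l = 4 + s.card := by
  rw [Finset.sum_insert (by simp [hxy, hx]), Finset.sum_insert hy]
  have : ∑ l ∈ s, doubleAt x y l = ∑ l ∈ s, 1 := Finset.sum_congr rfl fun l hl => by
    rw [doubleAt, if_neg]; rintro (rfl | rfl) <;> contradiction
  rw [this]
  simp [doubleAt]
  ring

/-- A polynomial of bi-degree at most `(p, p)` that vanishes to second order on the boundary and
vanishes at the interior points is zero: so is its restriction to every line `u = l / p`. -/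
theorem eq_zero_of_vanishesOnBoundary_quad {p : ℕ} (hp : 5 ≤ p) {c : quad.exponents p → ℝ}
    (h : VanishesOnBoundary quad (quad.exponents p) c)
    (hin : ∀ m ∈ quad.inner p, bipartial (quad.exponents p) 0 0 (innerPoint p m) c = 0) :
    c = 0 := by
  have hp0 : (p : ℝ) ≠ 0 := by positivity
  have hS : ∀ m ∈ quad.exponents p, m.1 ≤ p ∧ m.2 ≤ p := fun m hm => by
    have := mem_lattice_quad.1 hm; omega
  have hu0 : ∀ v ∈ Icc (0 : ℝ) 1, _ := fun v hv => h.jet (q := (0, v)) 3 (t := 1 - v)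
    ⟨by linarith [hv.2], by linarith [hv.1]⟩ (by simp [corner, along])
  have hu1 : ∀ v ∈ Icc (0 : ℝ) 1, _ := fun v hv => h.jet (q := (1, v)) 1 hv
    (by simp [corner, along])
  have hv0 : ∀ u ∈ Icc (0 : ℝ) 1, _ := fun u hu => h.jet (q := (u, 0)) 0 hu
    (by simp [corner, along])
  have hv1 : ∀ u ∈ Icc (0 : ℝ) 1, _ := fun u hu => h.jet (q := (u, 1)) 2 (t := 1 - u)
    ⟨by linarith [hu.2], by linarith [hu.1]⟩ (by simp [corner, along])
  have hhigh : ∀ j > p, coeffPolynomial (quad.exponents p) c j = 0 := fun j hj => by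
    refine Finset.sum_eq_zero fun m _ => if_neg ?_
    have := (hS _ m.2).2
    omega
  have hcard : ∑ l ∈ insert 0 (insert p (Finset.Icc 2 (p - 2))), doubleAt 0 p l = p + 1 := by
    rw [sum_doubleAt (by omega) _ (by simp) (by simp; omega), Nat.card_Icc]; omega
  refine eq_zero_of_coeffPolynomial_eq_zero c fun j => ?_
  refine eq_zero_of_hermite_eq_zero (insert 0 (insert p (Finset.Icc 2 (p - 2))))
    (fun l : ℕ => (l : ℝ) / p) (injOn_div_nat (by omega) _) (doubleAt 0 p) ?_ ?_
  · rw [hcard]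
    exact Nat.lt_succ_of_le (natDegree_coeffPolynomial_le _ _ _ fun m hm _ => (hS m hm).1)
  intro l hl a ha
  simp only [Finset.mem_insert, Finset.mem_Icc] at hl
  have ha2 : a = 0 ∨ a = 1 := by
    have : doubleAt 0 p l ≤ 2 := by unfold doubleAt; split_ifs <;> omega
    omega
  rcases hl with rfl | rfl | hl
  · rcases ha2 with rfl | rfl
    · exact rowPolynomial_eq_zero_of_Icc 0 _ (fun v hv => by simpa using (hu0 v hv).1) j
    · exact rowPolynomial_eq_zero_of_Icc 1 _ (fun v hv => by simpa using (hu0 v hv).2.1) j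
  · rcases ha2 with rfl | rfl
    · exact rowPolynomial_eq_zero_of_Icc 0 _
        (fun v hv => by simpa [div_self hp0] using (hu1 v hv).1) j
    · exact rowPolynomial_eq_zero_of_Icc 1 _
        (fun v hv => by simpa [div_self hp0] using (hu1 v hv).2.1) j
  · have ha0 : a = 0 := by
      have : doubleAt 0 p l = 1 := if_neg (by omega)
      omega
    subst ha0
    have hlI := mem_Icc_div_nat (p := p) (l := l) (by omega)
    refine rowPolynomial_eq_zero 0 p _ hhigh (insert 0 (insert p (Finset.Icc 2 (p - 2))))
      (fun l : ℕ => (l : ℝ) / p) (injOn_div_nat (by omega) _) (doubleAt 0 p)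
      (by rw [hcard]; omega) (fun l' hl' b hb => ?_) j
    simp only [Finset.mem_insert, Finset.mem_Icc] at hl'
    have hb2 : b = 0 ∨ b = 1 := by
      have : doubleAt 0 p l' ≤ 2 := by unfold doubleAt; split_ifs <;> omega
      omega
    rcases hl' with rfl | rfl | hl'
    · rcases hb2 with rfl | rfl
      · simpa using (hv0 _ hlI).1
      · simpa using (hv0 _ hlI).2.2
    · rcases hb2 with rfl | rfl
      · simpa [div_self hp0] using (hv1 _ hlI).1
      · simpa [div_self hp0] using (hv1 _ hlI).2.2
    · have hb0 : b = 0 := by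
        have : doubleAt 0 p l' = 1 := if_neg (by omega)
        omega
      subst hb0
      have := hin (l - 2, l' - 2) (mem_lattice_quad.2 (by simp; omega))
      simpa [innerPoint, Nat.sub_add_cancel hl.1, Nat.sub_add_cancel hl'.1, Nat.cast_sub hl.1,
        Nat.cast_sub hl'.1] using this

/-- A polynomial of total degree at most `p` that vanishes to second order on the boundary and
vanishes at the interior points is zero. On the lines `u = 0` (twice), `u = 2 / p`,
`u = 3 / p`, … the restrictions vanish one after the other, and every line that is dealt with
lowers the degree in `v` of the next restriction by one. -/
theorem eq_zero_of_vanishesOnBoundary_tri {p : ℕ} (hp : 5 ≤ p) {c : tri.exponents p → ℝ}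
    (h : VanishesOnBoundary tri (tri.exponents p) c)
    (hin : ∀ m ∈ tri.inner p, bipartial (tri.exponents p) 0 0 (innerPoint p m) c = 0) :
    c = 0 := by
  have hp0 : (p : ℝ) ≠ 0 := by positivity
  have hS : ∀ m ∈ tri.exponents p, m.1 + m.2 ≤ p := fun m hm => by
    have := mem_lattice_tri.1 hm; omega
  have hu0 : ∀ v ∈ Icc (0 : ℝ) 1, _ := fun v hv => h.jet (q := (0, v)) 2 (t := 1 - v)
    ⟨by linarith [hv.2], by linarith [hv.1]⟩ (by simp [corner, along])
  have hv0 : ∀ u ∈ Icc (0 : ℝ) 1, _ := fun u hu => h.jet (q := (u, 0)) 0 hu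
    (by simp [corner, along])
  have hw : ∀ u ∈ Icc (0 : ℝ) 1, _ := fun u hu => h.jet (q := (u, 1 - u)) 1 (t := 1 - u)
    ⟨by linarith [hu.2], by linarith [hu.1]⟩ (by simp [corner, along])
  have hhigh : ∀ j > p, coeffPolynomial (tri.exponents p) c j = 0 := fun j hj => by
    refine Finset.sum_eq_zero fun m _ => if_neg ?_
    have := hS _ m.2
    omega
  have key : ∀ k ≤ p, coeffPolynomial (tri.exponents p) c (p - k) = 0 := by
    intro k
    induction k using Nat.strong_induction_on with
    | _ k ih =>
    intro hk
    -- the coefficients of `v^j` with `j > p - l` are known to vanish, so that on the line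
    -- `u = l / p` the degree in `v` is at most `p - l`, while there are `p - l + 1` zeros
    have hrows : ∀ l ≤ k, 2 ≤ l → (coeffPolynomial (tri.exponents p) c (p - k)).eval
        ((l : ℝ) / p) = 0 := by
      intro l hl hl2
      have hlow : ∀ j > p - l, coeffPolynomial (tri.exponents p) c j = 0 := by
        intro j hj
        rcases le_or_gt j p with hjp | hjp
        · have := ih (p - j) (by omega) (by omega)
          rwa [Nat.sub_sub_self hjp] at this
        · exact hhigh j hjp
      have hlI := mem_Icc_div_nat (p := p) (l := l) (by omega)
      have h1 : bipartial (tri.exponents p) 0 0 ((l : ℝ) / p, 0) c = 0 := (hv0 _ hlI).1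
      have h2 : bipartial (tri.exponents p) 0 1 ((l : ℝ) / p, 0) c = 0 := (hv0 _ hlI).2.2
      have hcast : 1 - (l : ℝ) / p = ((p - l : ℕ) : ℝ) / p := by
        rw [Nat.cast_sub (by omega)]; field_simp
      have h3 := (hw _ hlI).1
      have h4 := (hw _ hlI).2.2
      rw [hcast] at h3 h4
      rcases lt_or_eq_of_le (hl.trans hk) with hlp | rfl
      · refine rowPolynomial_eq_zero 0 (p - l) _ hlow
          (insert 0 (insert (p - l) (Finset.Icc 2 (p - 2 - l))))
          (fun l : ℕ => (l : ℝ) / p) (injOn_div_nat (by omega) _) (doubleAt 0 (p - l))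
          (by rw [sum_doubleAt (by omega) _ (by simp) (by simp; omega), Nat.card_Icc]; omega)
          (fun l' hl' b hb => ?_) (p - k)
        simp only [Finset.mem_insert, Finset.mem_Icc] at hl'
        have hb2 : b = 0 ∨ b = 1 := by
          have : doubleAt 0 (p - l) l' ≤ 2 := by unfold doubleAt; split_ifs <;> omega
          omega
        rcases hl' with rfl | rfl | hl'
        · rcases hb2 with rfl | rfl
          · simpa using h1
          · simpa using h2
        · rcases hb2 with rfl | rfl
          · exact h3
          · exact h4
        · have hb0 : b = 0 := by
            have : doubleAt 0 (p - l) l' = 1 := if_neg (by omega)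
            omega
          subst hb0
          have := hin (l - 2, l' - 2) (mem_lattice_tri.2 (by simp; omega))
          simpa [innerPoint, Nat.sub_add_cancel hl2, Nat.sub_add_cancel hl'.1, Nat.cast_sub hl2,
            Nat.cast_sub hl'.1] using this
      · refine rowPolynomial_eq_zero 0 (l - l) _ hlow {0} (fun _ => 0) (by simp) (fun _ => 1)
          (by simp) (fun l' hl' b hb => ?_) (l - k)
        obtain rfl : b = 0 := by omega
        exact h1
    refine eq_zero_of_hermite_eq_zero (insert 0 (Finset.Icc 2 k))
      (fun l : ℕ => (l : ℝ) / p) (injOn_div_nat (by omega) _)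
      (fun l => if l = 0 then min 2 (k + 1) else 1) ?_ ?_
    · refine lt_of_le_of_lt (natDegree_coeffPolynomial_le _ _ k fun m hm hj => ?_) ?_
      · have := hS m hm; omega
      · rw [Finset.sum_insert (by simp)]
        have : ∑ l ∈ Finset.Icc 2 k, (if l = 0 then min 2 (k + 1) else 1)
            = ∑ l ∈ Finset.Icc 2 k, 1 := Finset.sum_congr rfl fun l hl => by
          rw [if_neg]; simp at hl; omega
        rw [this]
        simp
        omega
    · intro l hl a ha
      simp only [Finset.mem_insert, Finset.mem_Icc] at hl
      rcases hl with rfl | hl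
      · have ha2 : a = 0 ∨ a = 1 := by simp at ha; omega
        rcases ha2 with rfl | rfl
        · exact rowPolynomial_eq_zero_of_Icc 0 _ (fun v hv => by simpa using (hu0 v hv).1) _
        · exact rowPolynomial_eq_zero_of_Icc 1 _ (fun v hv => by simpa using (hu0 v hv).2.1) _
      · have ha0 : a = 0 := by rw [if_neg (by omega)] at ha; omega
        subst ha0
        exact hrows l hl.2 hl.1
  refine eq_zero_of_coeffPolynomial_eq_zero c fun j => ?_
  rcases le_or_gt j p with hjp | hjp
  · have := key (p - j) (by omega)
    rwa [Nat.sub_sub_self hjp] at this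
  · exact hhigh j hjp

theorem eq_zero_of_vanishesOnBoundary {k : CellKind} {p : ℕ} (hp : 5 ≤ p)
    {c : k.exponents p → ℝ} (h : VanishesOnBoundary k (k.exponents p) c)
    (hin : ∀ m ∈ k.inner p, bipartial (k.exponents p) 0 0 (innerPoint p m) c = 0) : c = 0 := by
  cases k
  · exact eq_zero_of_vanishesOnBoundary_tri hp h hin
  · exact eq_zero_of_vanishesOnBoundary_quad hp h hin

end CellKind

/-! ### Unisolvence on the reference cells -/

namespace CellKind

open Polynomial

/-- The cross derivative of a polynomial along a side. -/
def crossPolynomial (k : CellKind) (S : Finset (ℕ × ℕ)) (i : Fin k.sides) (c : S → ℝ) : ℝ[X] :=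
  C (k.across i).1 * linePolynomial S 1 0 (k.corner i) (k.along i) c +
    C (k.across i).2 * linePolynomial S 0 1 (k.corner i) (k.along i) c

/-- The trace of a polynomial along a side. -/
def tracePolynomial (k : CellKind) (S : Finset (ℕ × ℕ)) (i : Fin k.sides) (c : S → ℝ) : ℝ[X] :=
  linePolynomial S 0 0 (k.corner i) (k.along i) c

theorem eval_tracePolynomial (k : CellKind) (S : Finset (ℕ × ℕ)) (i : Fin k.sides) (c : S → ℝ)
    (t : ℝ) : (k.tracePolynomial S i c).eval t
      = bipartial S 0 0 (k.corner i + t • k.along i) c := eval_linePolynomial _ _ _ _ _ _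

theorem eval_crossPolynomial (k : CellKind) (S : Finset (ℕ × ℕ)) (i : Fin k.sides) (c : S → ℝ)
    (t : ℝ) : (k.crossPolynomial S i c).eval t
      = bideriv S (k.corner i + t • k.along i) (k.across i) c := by
  simp [crossPolynomial, eval_linePolynomial, bideriv_apply]

/-- The maximal degree of the cross derivative along a side. -/
def crossDegree : CellKind → ℕ → ℕ
  | tri, p => p - 1
  | quad, p => p

theorem natDegree_tracePolynomial_le (k : CellKind) (p : ℕ) (i : Fin k.sides)
    (c : k.exponents p → ℝ) : (k.tracePolynomial (k.exponents p) i c).natDegree ≤ p := by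
  cases k
  · refine natDegree_linePolynomial_le _ _ _ _ _ _ fun m hm _ _ => ?_
    have := mem_lattice_tri.1 hm
    omega
  · refine natDegree_linePolynomial_le_of_axis _ _ _ _ _ _ ?_ fun m hm => ?_
    · fin_cases i <;> simp [along]
    · have := mem_lattice_quad.1 hm
      omega

theorem natDegree_crossPolynomial_le (k : CellKind) (p : ℕ) (i : Fin k.sides)
    (c : k.exponents p → ℝ) :
    (k.crossPolynomial (k.exponents p) i c).natDegree ≤ k.crossDegree p := by
  refine natDegree_add_le_of_degree_le ?_ ?_ <;> refine (natDegree_C_mul_le _ _).trans ?_ <;>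
    cases k
  · refine natDegree_linePolynomial_le _ _ _ _ _ _ fun m hm _ _ => ?_
    have := mem_lattice_tri.1 hm
    simp only [crossDegree]; omega
  · refine natDegree_linePolynomial_le_of_axis _ _ _ _ _ _ ?_ fun m hm => ?_
    · fin_cases i <;> simp [along]
    · have := mem_lattice_quad.1 hm
      simp only [crossDegree]; omega
  · refine natDegree_linePolynomial_le _ _ _ _ _ _ fun m hm _ _ => ?_
    have := mem_lattice_tri.1 hm
    simp only [crossDegree]; omega
  · refine natDegree_linePolynomial_le_of_axis _ _ _ _ _ _ ?_ fun m hm => ?_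
    · fin_cases i <;> simp [along]
    · have := mem_lattice_quad.1 hm
      simp only [crossDegree]; omega

theorem crossDegree_le (k : CellKind) (p : ℕ) : k.crossDegree p ≤ p := by
  cases k <;> simp [crossDegree]

theorem isCompact_cell (k : CellKind) : IsCompact k.cell := by
  cases k
  · refine (isCompact_Icc.prod isCompact_Icc).of_isClosed_subset
      (s := Icc (0 : ℝ) 1 ×ˢ Icc (0 : ℝ) 1)
      ?_ fun q hq => ?_
    · simp only [cell, ofPred_and]
      refine (isClosed_le (by fun_prop) (by fun_prop)).inter
        ((isClosed_le (by fun_prop) (by fun_prop)).inter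
        ((isClosed_le (by fun_prop) (by fun_prop)).inter
        (isClosed_le (by fun_prop) (by fun_prop))))
    · obtain ⟨h1, h2, h3, h4⟩ := hq
      exact ⟨⟨h1, h2⟩, h3, by linarith⟩
  · exact isCompact_Icc.prod isCompact_Icc

/-- The partial derivatives on the cell are controlled by the boundary traces and the values at
the interior points. -/
theorem exists_bipartial_bound (k : CellKind) {p : ℕ} (hp : 5 ≤ p) :
    ∃ K : ℝ, 0 ≤ K ∧ ∀ (c : k.exponents p → ℝ) (M : ℝ),
      (∀ i, ∀ t ∈ Icc (0 : ℝ) 1,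
        |bipartial (k.exponents p) 0 0 (k.corner i + t • k.along i) c| ≤ M) →
      (∀ i, ∀ t ∈ Icc (0 : ℝ) 1,
        |bideriv (k.exponents p) (k.corner i + t • k.along i) (k.across i) c| ≤ M) →
      (∀ m ∈ k.inner p, |bipartial (k.exponents p) 0 0 (innerPoint p m) c| ≤ M) →
      ∀ q ∈ k.cell, ∀ a < 3, ∀ b < 3, |bipartial (k.exponents p) a b q c| ≤ K * M := by
  set S := k.exponents p with hSdef
  let l : ((Fin k.sides × Fin (p + 1)) ⊕ (Fin k.sides × Fin (p + 1))) ⊕ k.inner p →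
      (S → ℝ) →ₗ[ℝ] ℝ := Sum.elim (Sum.elim
        (fun i => bipartial S 0 0 (k.corner i.1 + (((i.2 : ℕ) : ℝ) / p) • k.along i.1))
        (fun i => bideriv S (k.corner i.1 + (((i.2 : ℕ) : ℝ) / p) • k.along i.1) (k.across i.1)))
        (fun m => bipartial S 0 0 (innerPoint p m))
  have huniq : ∀ f : ℝ[X], f.natDegree ≤ p →
      (∀ j : Fin (p + 1), f.eval (((j : ℕ) : ℝ) / p) = 0) → f = 0 := by
    intro f hf h
    refine eq_zero_of_hermite_eq_zero (Finset.range (p + 1)) (fun l : ℕ => (l : ℝ) / p)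
      (injOn_div_nat (by omega) _) (fun _ => 1) (by simp; omega) fun i hi j hj => ?_
    obtain rfl : j = 0 := by omega
    exact h ⟨i, Finset.mem_range.1 hi⟩
  obtain ⟨B, hB⟩ := exists_reconstruction_of_separating l (by
    intro c hc
    refine eq_zero_of_vanishesOnBoundary hp ⟨fun i t _ => ?_, fun i t _ => ?_⟩ fun m hm => ?_
    · have h0 := huniq _ (natDegree_tracePolynomial_le k p i c) fun j => by
        rw [eval_tracePolynomial]; exact hc (.inl (.inl (i, j)))
      rw [← eval_tracePolynomial, h0, eval_zero]
    · have h0 := huniq _ ((natDegree_crossPolynomial_le k p i c).trans (crossDegree_le k p))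
        fun j => by rw [eval_crossPolynomial]; exact hc (.inl (.inr (i, j)))
      rw [← eval_crossPolynomial, h0, eval_zero]
    · exact hc (.inr ⟨m, hm⟩))
  have hb : ∀ (a b : ℕ) (c : S → ℝ), ∃ C, ∀ q ∈ k.cell, |bipartial S a b q c| ≤ C := by
    intro a b c
    obtain ⟨C, hC⟩ := k.isCompact_cell.exists_bound_of_continuousOn
      (contDiff_bipartial (n := 0) a b c).continuous.continuousOn
    exact ⟨C, hC⟩
  choose C hC using hb
  have hne : k.cell.Nonempty := by
    refine ⟨(0, 0), ?_⟩
    cases k <;> simp [cell]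
  obtain ⟨q0, hq0⟩ := hne
  have hC0 : ∀ a b c, 0 ≤ C a b c := fun a b c => (abs_nonneg _).trans (hC a b c q0 hq0)
  refine ⟨∑ i, ∑ a ∈ Finset.range 3, ∑ b ∈ Finset.range 3, C a b (B i),
    Finset.sum_nonneg fun i _ => Finset.sum_nonneg fun a _ => Finset.sum_nonneg fun b _ =>
      hC0 _ _ _, fun c M h0 h1 h2 q hq a ha b hb => ?_⟩
  have hl : ∀ i, |l i c| ≤ M := by
    have hI : ∀ j : Fin (p + 1), ((j : ℕ) : ℝ) / p ∈ Icc (0 : ℝ) 1 := fun j =>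
      mem_Icc_div_nat (by omega)
    rintro ((i | i) | m)
    · exact h0 _ _ (hI _)
    · exact h1 _ _ (hI _)
    · exact h2 _ m.2
  conv_lhs => rw [hB c]
  rw [map_sum, Finset.sum_mul]
  refine (Finset.abs_sum_le_sum_abs _ _).trans (Finset.sum_le_sum fun i _ => ?_)
  rw [map_smul, smul_eq_mul, abs_mul, mul_comm]
  refine mul_le_mul ?_ (hl i) (abs_nonneg _) (Finset.sum_nonneg fun a _ => Finset.sum_nonneg
    fun b _ => hC0 _ _ _)
  calc |bipartial S a b q (B i)| ≤ C a b (B i) := hC a b (B i) q hq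
    _ ≤ ∑ b ∈ Finset.range 3, C a b (B i) :=
      Finset.single_le_sum (f := fun b => C a b (B i)) (fun _ _ => hC0 _ _ _)
        (Finset.mem_range.2 hb)
    _ ≤ _ := Finset.single_le_sum (f := fun a => ∑ b ∈ Finset.range 3, C a b (B i))
        (fun _ _ => Finset.sum_nonneg fun b _ => hC0 _ _ _) (Finset.mem_range.2 ha)

/-- The first derivative in the direction `w` of a function with partial derivatives `J`. -/
def jetFirst (J : ℕ → ℕ → ℝ) (w : ℝ × ℝ) : ℝ := w.1 * J 1 0 + w.2 * J 0 1

/-- The second derivative in the directions `z`, `w` of a function with partial derivatives `J`. -/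
def jetSecond (J : ℕ → ℕ → ℝ) (z w : ℝ × ℝ) : ℝ :=
  z.1 * w.1 * J 2 0 + (z.1 * w.2 + z.2 * w.1) * J 1 1 + z.2 * w.2 * J 0 2

/-- At the parameter `x` the trace `f` and the cross derivative `g` along a side with direction
`τ` and cross direction `d` have the derivatives of a function with partial derivatives `J`. -/
structure MatchesJet (J : ℕ → ℕ → ℝ) (τ d : ℝ × ℝ) (f g : ℝ[X]) (x : ℝ) : Prop where
  trace_zero : f.eval x = J 0 0
  trace_one : (derivative f).eval x = jetFirst J τ
  trace_two : (derivative (derivative f)).eval x = jetSecond J τ τ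
  cross_zero : g.eval x = jetFirst J d
  cross_one : (derivative g).eval x = jetSecond J τ d

theorem matchesJet_bipartial (k : CellKind) (S : Finset (ℕ × ℕ)) (c : S → ℝ) (i : Fin k.sides)
    (x : ℝ) {q : ℝ × ℝ} (hq : q = k.corner i + x • k.along i) :
    MatchesJet (fun a b => bipartial S a b q c) (k.along i) (k.across i)
      (k.tracePolynomial S i c) (k.crossPolynomial S i c) x := by
  subst hq
  constructor
  · exact eval_tracePolynomial _ _ _ _ _
  · simp [tracePolynomial, derivative_linePolynomial, eval_linePolynomial, jetFirst]
  · simp [tracePolynomial, derivative_linePolynomial, eval_linePolynomial, jetSecond]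
    ring
  · exact eval_crossPolynomial _ _ _ _ _ |>.trans (bideriv_apply _ _ _)
  · simp [crossPolynomial, derivative_linePolynomial, eval_linePolynomial, jetSecond]
    ring

/-- The partial derivatives that serve as degrees of freedom at a vertex. For a quadrilateral the
pure second derivatives are left out; values of the traces on the two sides replace them, so that
the number of degrees of freedom is the dimension of the space. -/
def vertexJet : CellKind → Finset (ℕ × ℕ)
  | tri => {(0, 0), (1, 0), (0, 1), (2, 0), (1, 1), (0, 2)}
  | quad => {(0, 0), (1, 0), (0, 1), (1, 1)}

/-- The number of derivatives of the trace that are prescribed at an end point of a side. -/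
def traceOrder : CellKind → ℕ
  | tri => 3
  | quad => 2

/-- The number of additional values of the trace along a side. -/
def traceNodes : CellKind → ℕ → ℕ
  | tri, p => p - 5
  | quad, p => p - 3

/-- The number of additional values of the cross derivative along a side. -/
def crossNodes : CellKind → ℕ → ℕ
  | tri, p => p - 4
  | quad, p => p - 3

theorem eq_of_hermite_ends {f g : ℝ[X]} {p r n : ℕ} (hp : 0 < p) (hn : n < p)
    (hf : f.natDegree < 2 * r + n) (hg : g.natDegree < 2 * r + n)
    (h0 : ∀ j < r, (derivative^[j] f).eval 0 = (derivative^[j] g).eval 0)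
    (h1 : ∀ j < r, (derivative^[j] f).eval 1 = (derivative^[j] g).eval 1)
    (h : ∀ l ∈ Finset.Icc 1 n, f.eval ((l : ℝ) / p) = g.eval ((l : ℝ) / p)) : f = g := by
  have hp0 : (p : ℝ) ≠ 0 := by positivity
  rw [← sub_eq_zero]
  refine eq_zero_of_hermite_eq_zero (insert 0 (insert p (Finset.Icc 1 n)))
    (fun l : ℕ => (l : ℝ) / p) (injOn_div_nat hp _) (fun l => if l = 0 ∨ l = p then r else 1) ?_ ?_
  · rw [Finset.sum_insert (by simp; omega), Finset.sum_insert (by simp; omega)]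
    have : ∑ l ∈ Finset.Icc 1 n, (if l = 0 ∨ l = p then r else 1) = ∑ l ∈ Finset.Icc 1 n, 1 :=
      Finset.sum_congr rfl fun l hl => by rw [if_neg]; simp at hl; omega
    rw [this]
    simp only [Finset.sum_const, Nat.card_Icc, true_or, or_true, if_true, smul_eq_mul]
    refine lt_of_le_of_lt (natDegree_sub_le _ _) (max_lt ?_ ?_) <;> omega
  · intro l hl j hj
    simp only [Finset.mem_insert] at hl
    rw [iterate_derivative_sub, eval_sub, sub_eq_zero]
    rcases hl with rfl | rfl | hl
    · simpa using h0 j (by simpa using hj)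
    · simpa [div_self hp0] using h1 j (by simpa using hj)
    · have : j = 0 := by
        rw [if_neg] at hj
        · omega
        · simp at hl; omega
      subst this
      exact h l hl

/-- The trace and the cross derivative along a side are determined by the degrees of freedom. -/
theorem traces_eq {k : CellKind} {p : ℕ} (hp : 5 ≤ p) {i : Fin k.sides} {J J' : ℕ → ℕ → ℝ}
    {L L' : ℕ → ℕ → ℝ} {f g f' g' : ℝ[X]}
    (hJ : ∀ m ∈ k.vertexJet, J m.1 m.2 = J' m.1 m.2)
    (hL : ∀ m ∈ k.vertexJet, L m.1 m.2 = L' m.1 m.2)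
    (hf : f.natDegree ≤ p) (hf' : f'.natDegree ≤ p)
    (hg : g.natDegree ≤ k.crossDegree p) (hg' : g'.natDegree ≤ k.crossDegree p)
    (h0 : MatchesJet J (k.along i) (k.across i) f g 0)
    (h0' : MatchesJet J' (k.along i) (k.across i) f' g' 0)
    (h1 : MatchesJet L (k.along i) (k.across i) f g 1)
    (h1' : MatchesJet L' (k.along i) (k.across i) f' g' 1)
    (hf1 : ∀ l ∈ Finset.Icc 1 (k.traceNodes p), f.eval ((l : ℝ) / p) = f'.eval ((l : ℝ) / p))
    (hg1 : ∀ l ∈ Finset.Icc 1 (k.crossNodes p), g.eval ((l : ℝ) / p) = g'.eval ((l : ℝ) / p)) :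
    f = f' ∧ g = g' := by
  have first : ∀ {J J' : ℕ → ℕ → ℝ}, (∀ m ∈ k.vertexJet, J m.1 m.2 = J' m.1 m.2) →
      ∀ w, jetFirst J w = jetFirst J' w := by
    intro J J' hJ w
    have e1 := hJ (1, 0) (by cases k <;> simp [vertexJet])
    have e2 := hJ (0, 1) (by cases k <;> simp [vertexJet])
    simp only at e1 e2
    simp only [jetFirst, e1, e2]
  have zero : ∀ {J J' : ℕ → ℕ → ℝ}, (∀ m ∈ k.vertexJet, J m.1 m.2 = J' m.1 m.2) →
      J 0 0 = J' 0 0 := fun hJ => hJ (0, 0) (by cases k <;> simp [vertexJet])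
  have second : ∀ {J J' : ℕ → ℕ → ℝ}, (∀ m ∈ k.vertexJet, J m.1 m.2 = J' m.1 m.2) →
      jetSecond J (k.along i) (k.across i) = jetSecond J' (k.along i) (k.across i) := by
    intro J J' hJ
    have e := hJ (1, 1) (by cases k <;> simp [vertexJet])
    simp only at e
    cases k
    · have e1 := hJ (2, 0) (by simp [vertexJet])
      have e2 := hJ (0, 2) (by simp [vertexJet])
      simp only at e1 e2
      simp only [jetSecond, e, e1, e2]
    · fin_cases i <;> simp [jetSecond, along, across, e]
  have second' : ∀ {J J' : ℕ → ℕ → ℝ}, (∀ m ∈ k.vertexJet, J m.1 m.2 = J' m.1 m.2) →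
      2 < k.traceOrder → jetSecond J (k.along i) (k.along i)
        = jetSecond J' (k.along i) (k.along i) := by
    intro J J' hJ hk
    cases k
    · have e := hJ (1, 1) (by simp [vertexJet])
      have e1 := hJ (2, 0) (by simp [vertexJet])
      have e2 := hJ (0, 2) (by simp [vertexJet])
      simp only at e e1 e2
      simp only [jetSecond, e, e1, e2]
    · simp [traceOrder] at hk
  have hord : k.traceOrder ≤ 3 := by cases k <;> simp [traceOrder]
  constructor
  · refine eq_of_hermite_ends (p := p) (r := k.traceOrder) (n := k.traceNodes p) (by omega)
      (by cases k <;> simp only [traceNodes] <;> omega)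
      (by cases k <;> simp only [traceNodes, traceOrder] <;> omega)
      (by cases k <;> simp only [traceNodes, traceOrder] <;> omega) ?_ ?_ hf1
    all_goals
      intro j hj
      obtain rfl | rfl | rfl : j = 0 ∨ j = 1 ∨ j = 2 := by omega
    · exact h0.trace_zero.trans ((zero hJ).trans h0'.trace_zero.symm)
    · exact h0.trace_one.trans ((first hJ _).trans h0'.trace_one.symm)
    · exact h0.trace_two.trans ((second' hJ hj).trans h0'.trace_two.symm)
    · exact h1.trace_zero.trans ((zero hL).trans h1'.trace_zero.symm)
    · exact h1.trace_one.trans ((first hL _).trans h1'.trace_one.symm)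
    · exact h1.trace_two.trans ((second' hL hj).trans h1'.trace_two.symm)
  · refine eq_of_hermite_ends (p := p) (r := 2) (n := k.crossNodes p) (by omega)
      (by cases k <;> simp only [crossNodes] <;> omega)
      (by cases k <;> simp only [crossNodes, crossDegree] at * <;> omega)
      (by cases k <;> simp only [crossNodes, crossDegree] at * <;> omega) ?_ ?_ hg1
    all_goals
      intro j hj
      obtain rfl | rfl : j = 0 ∨ j = 1 := by omega
    · exact h0.cross_zero.trans ((first hJ _).trans h0'.cross_zero.symm)
    · exact h0.cross_one.trans ((second hJ).trans h0'.cross_one.symm)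
    · exact h1.cross_zero.trans ((first hL _).trans h1'.cross_zero.symm)
    · exact h1.cross_one.trans ((second hL).trans h1'.cross_one.symm)

theorem two_mul_card_lattice_tri (n : ℕ) : 2 * (tri.lattice n).card = n * (n + 1) := by
  have : tri.lattice n
      = (Finset.range n).biUnion fun s => Finset.HasAntidiagonal.antidiagonal s := by
    ext m
    simp [mem_lattice_tri]
  rw [this, Finset.card_biUnion]
  · simp only [Finset.Nat.card_antidiagonal]
    rw [Finset.sum_add_distrib, mul_add]
    have := Finset.sum_range_id_mul_two n
    simp
    cases n <;> simp at * <;> linarith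
  · intro s _ s' _ hne
    rw [Function.onFun, Finset.disjoint_left]
    intro m hm hm'
    simp at hm hm'
    omega

theorem card_degreesOfFreedom (k : CellKind) {p : ℕ} (hp : 5 ≤ p) :
    (k.exponents p).card = k.sides * k.vertexJet.card + k.sides * k.traceNodes p
      + k.sides * k.crossNodes p + (k.inner p).card := by
  obtain ⟨n, rfl⟩ := Nat.exists_eq_add_of_le hp
  cases k
  · have h1 := two_mul_card_lattice_tri (5 + n + 1)
    have h2 := two_mul_card_lattice_tri (5 + n - 5)
    have h3 : tri.vertexJet.card = 6 := by decide
    simp only [exponents, inner, traceNodes, crossNodes, h3]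
    have e1 : 5 + n - 5 = n := by omega
    have e2 : 5 + n - 4 = n + 1 := by omega
    rw [e1] at h2 ⊢
    rw [e2]
    simp only [sides]
    nlinarith
  · have h3 : quad.vertexJet.card = 4 := by decide
    simp only [exponents, inner, traceNodes, crossNodes, h3, lattice, Finset.card_product,
      Finset.card_range]
    have e1 : 5 + n - 3 = n + 2 := by omega
    rw [e1]
    ring

/-- Compatible traces and cross derivatives on the sides, together with values at the interior
points, are attained by a polynomial. The degrees of freedom separate the polynomials, and their
number is the dimension of the space. -/
theorem exists_of_compatible_traces (k : CellKind) {p : ℕ} (hp : 5 ≤ p)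
    (J : Fin k.sides → ℕ → ℕ → ℝ) (f g : Fin k.sides → ℝ[X]) (hf : ∀ i, (f i).natDegree ≤ p)
    (hg : ∀ i, (g i).natDegree ≤ k.crossDegree p)
    (h0 : ∀ i, MatchesJet (J i) (k.along i) (k.across i) (f i) (g i) 0)
    (h1 : ∀ i, MatchesJet (J (k.next i)) (k.along i) (k.across i) (f i) (g i) 1)
    (y : ℕ × ℕ → ℝ) :
    ∃ c : k.exponents p → ℝ,
      (∀ i t, bipartial (k.exponents p) 0 0 (k.corner i + t • k.along i) c = (f i).eval t) ∧
      (∀ i t, bideriv (k.exponents p) (k.corner i + t • k.along i) (k.across i) c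
        = (g i).eval t) ∧
      ∀ m ∈ k.inner p, bipartial (k.exponents p) 0 0 (innerPoint p m) c = y m := by
  set S := k.exponents p with hSdef
  let ι := (((Fin k.sides × k.vertexJet) ⊕ (Fin k.sides × Finset.Icc 1 (k.traceNodes p))) ⊕
    (Fin k.sides × Finset.Icc 1 (k.crossNodes p))) ⊕ k.inner p
  let l : ι → (S → ℝ) →ₗ[ℝ] ℝ := Sum.elim (Sum.elim (Sum.elim
        (fun i => bipartial S i.2.1.1 i.2.1.2 (k.corner i.1))
        (fun i => bipartial S 0 0 (k.corner i.1 + (((i.2 : ℕ) : ℝ) / p) • k.along i.1)))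
        (fun i => bideriv S (k.corner i.1 + (((i.2 : ℕ) : ℝ) / p) • k.along i.1) (k.across i.1)))
        (fun m => bipartial S 0 0 (innerPoint p m))
  have hm0 : ∀ (c : S → ℝ) i, MatchesJet (fun a b => bipartial S a b (k.corner i) c)
      (k.along i) (k.across i) (k.tracePolynomial S i c) (k.crossPolynomial S i c) 0 :=
    fun c i => matchesJet_bipartial k S c i 0 (by simp)
  have hm1 : ∀ (c : S → ℝ) i, MatchesJet (fun a b => bipartial S a b (k.corner (k.next i)) c)
      (k.along i) (k.across i) (k.tracePolynomial S i c) (k.crossPolynomial S i c) 1 :=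
    fun c i => matchesJet_bipartial k S c i 1 (by rw [corner_next]; simp)
  have hz : ∀ (τ d : ℝ × ℝ) (x : ℝ), MatchesJet (fun _ _ => 0) τ d 0 0 x := fun τ d x =>
    ⟨by simp, by simp [jetFirst], by simp [jetSecond], by simp [jetFirst], by simp [jetSecond]⟩
  obtain ⟨c, hc⟩ := exists_of_separating_of_finrank_eq l (by
    intro c hc
    have key := fun i => traces_eq (k := k) hp (i := i)
      (fun m hm => hc (.inl (.inl (.inl (i, ⟨m, hm⟩)))))
      (fun m hm => hc (.inl (.inl (.inl (k.next i, ⟨m, hm⟩)))))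
      (natDegree_tracePolynomial_le k p i c) (by simp) (natDegree_crossPolynomial_le k p i c)
      (by simp) (hm0 c i) (hz _ _ _) (hm1 c i) (hz _ _ _)
      (fun n hn => by
        rw [eval_tracePolynomial, eval_zero]; exact hc (.inl (.inl (.inr (i, ⟨n, hn⟩)))))
      (fun n hn => by
        rw [eval_crossPolynomial, eval_zero]; exact hc (.inl (.inr (i, ⟨n, hn⟩))))
    refine eq_zero_of_vanishesOnBoundary hp ⟨fun i t _ => ?_, fun i t _ => ?_⟩ fun m hm => ?_
    · rw [← eval_tracePolynomial, (key i).1, eval_zero]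
    · rw [← eval_crossPolynomial, (key i).2, eval_zero]
    · exact hc (.inr ⟨m, hm⟩))
    (by simp [ι, hSdef, card_degreesOfFreedom k hp])
    (Sum.elim (Sum.elim (Sum.elim (fun i => J i.1 i.2.1.1 i.2.1.2)
      (fun i => (f i.1).eval (((i.2 : ℕ) : ℝ) / p)))
      (fun i => (g i.1).eval (((i.2 : ℕ) : ℝ) / p))) fun m => y m)
  have key := fun i => traces_eq (k := k) hp (i := i)
      (fun m hm => hc (.inl (.inl (.inl (i, ⟨m, hm⟩)))))
      (fun m hm => hc (.inl (.inl (.inl (k.next i, ⟨m, hm⟩)))))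
      (natDegree_tracePolynomial_le k p i c) (hf i) (natDegree_crossPolynomial_le k p i c)
      (hg i) (hm0 c i) (h0 i) (hm1 c i) (h1 i)
      (fun n hn => by
        rw [eval_tracePolynomial]; exact hc (.inl (.inl (.inr (i, ⟨n, hn⟩)))))
      (fun n hn => by
        rw [eval_crossPolynomial]; exact hc (.inl (.inr (i, ⟨n, hn⟩))))
  refine ⟨c, fun i t => ?_, fun i t => ?_, fun m hm => hc (.inr ⟨m, hm⟩)⟩
  · rw [← eval_tracePolynomial, (key i).1]
  · rw [← eval_crossPolynomial, (key i).2]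

end CellKind

/-! ### The geometry mapping -/

namespace CellKind

theorem convex_cell (k : CellKind) : Convex ℝ k.cell := by
  cases k
  · rintro ⟨x, y⟩ ⟨h1, h2, h3, h4⟩ ⟨x', y'⟩ ⟨h1', h2', h3', h4'⟩ a b ha hb hab
    simp only at h1 h2 h3 h4 h1' h2' h3' h4'
    simp only [cell, Prod.smul_mk, Prod.mk_add_mk, smul_eq_mul, mem_ofPred_eq]
    refine ⟨by positivity, by nlinarith, by positivity, by nlinarith⟩
  · exact (convex_Icc 0 1).prod (convex_Icc 0 1)

/-- A point of the cell that lies on none of the sides is an interior point. -/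
theorem mem_interior_or_mem_side (k : CellKind) {q : ℝ × ℝ} (hq : q ∈ k.cell) :
    q ∈ interior k.cell ∨ ∃ i, ∃ t ∈ Icc (0 : ℝ) 1, q = k.corner i + t • k.along i := by
  obtain ⟨u, v⟩ := q
  cases k
  · obtain ⟨h1, h2, h3, h4⟩ := hq
    simp only at h1 h2 h3 h4
    by_cases hu : u = 0
    · exact .inr ⟨2, 1 - v, ⟨by linarith, by linarith⟩, by simp [corner, along, hu]⟩
    by_cases hv : v = 0
    · exact .inr ⟨0, u, ⟨by linarith, by linarith⟩, by simp [corner, along, hv]⟩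
    by_cases hw : v = 1 - u
    · exact .inr ⟨1, v, ⟨by linarith, by linarith⟩, by simp [corner, along, hw]⟩
    refine .inl (mem_interior.2 ⟨{q : ℝ × ℝ | 0 < q.1 ∧ 0 < q.2 ∧ q.2 < 1 - q.1}, ?_, ?_, ?_⟩)
    · rintro q ⟨h1, h2, h3⟩
      exact ⟨h1.le, by linarith, h2.le, h3.le⟩
    · simp only [ofPred_and]
      exact (isOpen_lt (by fun_prop) (by fun_prop)).inter
        ((isOpen_lt (by fun_prop) (by fun_prop)).inter (isOpen_lt (by fun_prop) (by fun_prop)))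
    · exact ⟨lt_of_le_of_ne h1 (Ne.symm hu), lt_of_le_of_ne h3 (Ne.symm hv), lt_of_le_of_ne h4 hw⟩
  · obtain ⟨⟨h1, h2⟩, h3, h4⟩ := hq
    simp only at h1 h2 h3 h4
    by_cases hu : u = 0
    · exact .inr ⟨3, 1 - v, ⟨by linarith, by linarith⟩, by simp [corner, along, hu]⟩
    by_cases hv : v = 0
    · exact .inr ⟨0, u, ⟨by linarith, by linarith⟩, by simp [corner, along, hv]⟩
    by_cases hu1 : u = 1
    · exact .inr ⟨1, v, ⟨by linarith, by linarith⟩, by simp [corner, along, hu1]⟩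
    by_cases hv1 : v = 1
    · exact .inr ⟨2, 1 - u, ⟨by linarith, by linarith⟩, by simp [corner, along, hv1]⟩
    refine .inl (mem_interior.2 ⟨Ioo 0 1 ×ˢ Ioo 0 1, prod_mono Ioo_subset_Icc_self
      Ioo_subset_Icc_self, isOpen_Ioo.prod isOpen_Ioo, ?_⟩)
    exact ⟨⟨lt_of_le_of_ne h1 (Ne.symm hu), lt_of_le_of_ne h2 hu1⟩,
      lt_of_le_of_ne h3 (Ne.symm hv), lt_of_le_of_ne h4 hv1⟩

theorem interior_cell_nonempty (k : CellKind) : (interior k.cell).Nonempty := by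
  have hq : ((1 / 4, 1 / 4) : ℝ × ℝ) ∈ k.cell := by
    cases k <;> norm_num [cell]
  refine ⟨_, (k.mem_interior_or_mem_side hq).resolve_right ?_⟩
  rintro ⟨i, t, _, h⟩
  cases k <;> fin_cases i <;> simp [corner, along] at h <;> linarith [h.1, h.2]

theorem uniqueDiffOn_cell (k : CellKind) : UniqueDiffOn ℝ k.cell :=
  uniqueDiffOn_convex k.convex_cell k.interior_cell_nonempty

theorem cell_subset_closure_interior (k : CellKind) : k.cell ⊆ closure (interior k.cell) := by
  rw [k.convex_cell.closure_interior_eq_closure_of_nonempty_interior k.interior_cell_nonempty]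
  exact subset_closure

theorem corner_mem_cell (k : CellKind) (i : Fin k.sides) : k.corner i ∈ k.cell := by
  simpa using k.corner_add_smul_along_mem i (t := 0) (by simp)

end CellKind

namespace MeshElement

/-- The type of an element. -/
def kind : MeshElement → CellKind
  | tri _ _ _ => .tri
  | quad _ _ _ _ => .quad

/-- The image of the origin under the geometry mapping. -/
def base : MeshElement → Plane
  | tri V₁ _ _ => V₁
  | quad V₁ _ _ _ => V₁

/-- The `u`-derivative of the geometry mapping at the origin. -/
def du : MeshElement → Plane
  | tri V₁ V₂ _ => V₂ - V₁
  | quad V₁ V₂ _ _ => V₂ - V₁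

/-- The `v`-derivative of the geometry mapping at the origin. -/
def dv : MeshElement → Plane
  | tri V₁ _ V₃ => V₃ - V₁
  | quad V₁ _ _ V₄ => V₄ - V₁

/-- The mixed second derivative of the geometry mapping. -/
def twist : MeshElement → Plane
  | tri _ _ _ => 0
  | quad V₁ V₂ V₃ V₄ => V₁ - V₂ + V₃ - V₄

/-- The derivative of the geometry mapping. -/
def paramDeriv (e : MeshElement) (q : ℝ × ℝ) : ℝ × ℝ →L[ℝ] Plane :=
  (ContinuousLinearMap.fst ℝ ℝ ℝ).smulRight (e.du + q.2 • e.twist) +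
    (ContinuousLinearMap.snd ℝ ℝ ℝ).smulRight (e.dv + q.1 • e.twist)

/-- The vertices of the element, in cyclic order. -/
def vertex (e : MeshElement) (i : Fin e.kind.sides) : Plane := e.param (e.kind.corner i)

theorem paramDomain_eq (e : MeshElement) : e.paramDomain = e.kind.cell := by
  cases e <;> rfl

theorem closedRegion_eq (e : MeshElement) : e.closedRegion = e.param '' e.kind.cell := by
  rw [closedRegion, paramDomain_eq]

theorem param_apply (e : MeshElement) (q : ℝ × ℝ) :
    e.param q = e.base + q.1 • e.du + q.2 • e.dv + (q.1 * q.2) • e.twist := by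
  cases e <;> simp only [param, base, du, dv, twist] <;> module

theorem paramDeriv_apply (e : MeshElement) (q w : ℝ × ℝ) :
    e.paramDeriv q w = w.1 • (e.du + q.2 • e.twist) + w.2 • (e.dv + q.1 • e.twist) := by
  simp [paramDeriv]

theorem contDiff_param (e : MeshElement) {n : WithTop ℕ∞} : ContDiff ℝ n e.param := by
  have : e.param = fun q => e.base + q.1 • e.du + q.2 • e.dv + (q.1 * q.2) • e.twist :=
    funext e.param_apply
  rw [this]
  fun_prop

theorem hasFDerivAt_param (e : MeshElement) (q : ℝ × ℝ) :
    HasFDerivAt e.param (e.paramDeriv q) q := by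
  have : e.param = fun q => e.base + q.1 • e.du + q.2 • e.dv + (q.1 * q.2) • e.twist :=
    funext e.param_apply
  rw [this]
  have h1 : HasFDerivAt (fun q : ℝ × ℝ => q.1) (ContinuousLinearMap.fst ℝ ℝ ℝ) q := hasFDerivAt_fst
  have h2 : HasFDerivAt (fun q : ℝ × ℝ => q.2) (ContinuousLinearMap.snd ℝ ℝ ℝ) q := hasFDerivAt_snd
  refine ((((hasFDerivAt_const e.base q).add (h1.smul_const e.du)).add (h2.smul_const e.dv)).add
    ((h1.mul h2).smul_const e.twist)).congr_fderiv ?_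
  ext w <;> simp [paramDeriv]

theorem paramDeriv_add (e : MeshElement) (q z w : ℝ × ℝ) :
    e.paramDeriv (q + z) w = e.paramDeriv q w + (z.1 * w.2 + z.2 * w.1) • e.twist := by
  simp only [paramDeriv_apply, Prod.fst_add, Prod.snd_add]
  module

/-- A triangle has no twist, and the sides of the unit square are parallel to the axes. -/
theorem along_mul_twist (e : MeshElement) (i : Fin e.kind.sides) :
    ((e.kind.along i).1 * (e.kind.along i).2) • e.twist = 0 := by
  cases e
  · simp [twist]
  · have : ∀ i, (CellKind.quad.along i).1 * (CellKind.quad.along i).2 = 0 := fun i => by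
      fin_cases i <;> simp [CellKind.along]
    exact (congrArg (· • twist _) (this i)).trans (zero_smul _ _)

/-- Along a side the geometry mapping is affine. -/
theorem param_side (e : MeshElement) (i : Fin e.kind.sides) (t : ℝ) :
    e.param (e.kind.corner i + t • e.kind.along i)
      = (1 - t) • e.vertex i + t • e.vertex (e.kind.next i) := by
  have h := e.along_mul_twist i
  simp only [vertex, CellKind.corner_next, param_apply, Prod.fst_add, Prod.snd_add, Prod.smul_fst,
    Prod.smul_snd, smul_eq_mul]
  linear_combination (norm := module) (t ^ 2 - t) • h

theorem paramDeriv_along (e : MeshElement) (i : Fin e.kind.sides) (t : ℝ) :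
    e.paramDeriv (e.kind.corner i + t • e.kind.along i) (e.kind.along i)
      = e.vertex (e.kind.next i) - e.vertex i := by
  have h := e.along_mul_twist i
  simp only [vertex, CellKind.corner_next, param_apply, paramDeriv_apply, Prod.fst_add,
    Prod.snd_add, Prod.smul_fst, Prod.smul_snd, smul_eq_mul]
  linear_combination (norm := module) (2 * t - 1) • h

theorem corners_eq (e : MeshElement) : e.corners = range e.vertex := by
  rcases e with ⟨V₁, V₂, V₃⟩ | ⟨V₁, V₂, V₃, V₄⟩ <;> ext x
  · change x ∈ ({V₁, V₂, V₃} : Set Plane) ↔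
      ∃ i : Fin 3, (tri V₁ V₂ V₃).param (CellKind.tri.corner i) = x
    simp [Fin.exists_fin_succ, CellKind.corner, param, eq_comm]
  · change x ∈ ({V₁, V₂, V₃, V₄} : Set Plane) ↔
      ∃ i : Fin 4, (quad V₁ V₂ V₃ V₄).param (CellKind.quad.corner i) = x
    simp [Fin.exists_fin_succ, CellKind.corner, param, eq_comm]

theorem sides_eq (e : MeshElement) :
    e.sides = range fun i => (e.vertex i, e.vertex (e.kind.next i)) := by
  rcases e with ⟨V₁, V₂, V₃⟩ | ⟨V₁, V₂, V₃, V₄⟩ <;> ext x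
  · change x ∈ ({(V₁, V₂), (V₂, V₃), (V₃, V₁)} : Set (Plane × Plane)) ↔
      ∃ i : Fin 3, ((tri V₁ V₂ V₃).param (CellKind.tri.corner i),
        (tri V₁ V₂ V₃).param (CellKind.tri.corner (CellKind.tri.next i))) = x
    simp [Fin.exists_fin_succ, CellKind.corner, CellKind.next, param, eq_comm]
  · change x ∈ ({(V₁, V₂), (V₂, V₃), (V₃, V₄), (V₄, V₁)} : Set (Plane × Plane)) ↔
      ∃ i : Fin 4, ((quad V₁ V₂ V₃ V₄).param (CellKind.quad.corner i),
        (quad V₁ V₂ V₃ V₄).param (CellKind.quad.corner (CellKind.quad.next i))) = x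
    simp [Fin.exists_fin_succ, CellKind.corner, CellKind.next, param, eq_comm]

theorem isCompact_closedRegion (e : MeshElement) : IsCompact e.closedRegion := by
  rw [closedRegion_eq]
  exact e.kind.isCompact_cell.image (e.contDiff_param (n := 0)).continuous

theorem param_mem (e : MeshElement) {q : ℝ × ℝ} (hq : q ∈ e.kind.cell) :
    e.param q ∈ e.closedRegion := by
  rw [closedRegion_eq]; exact mem_image_of_mem _ hq

theorem vertex_mem (e : MeshElement) (i : Fin e.kind.sides) : e.vertex i ∈ e.closedRegion :=
  e.param_mem (e.kind.corner_mem_cell i)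

theorem IsRegular.injOn {e : MeshElement} (he : e.IsRegular) : InjOn e.param e.kind.cell := by
  rw [← paramDomain_eq]; exact he.1

theorem IsRegular.bijective {e : MeshElement} (he : e.IsRegular) {q : ℝ × ℝ}
    (hq : q ∈ e.kind.cell) : Function.Bijective (e.paramDeriv q) := by
  have := he.2 q (by rwa [paramDomain_eq])
  rwa [(e.hasFDerivAt_param q).fderiv] at this

/-- The derivative of the geometry mapping as an isomorphism. -/
def IsRegular.paramEquiv {e : MeshElement} (he : e.IsRegular) {q : ℝ × ℝ}
    (hq : q ∈ e.kind.cell) : (ℝ × ℝ) ≃L[ℝ] Plane :=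
  ContinuousLinearEquiv.ofBijective (e.paramDeriv q)
    (LinearMap.ker_eq_bot.2 (he.bijective hq).1) (LinearMap.range_eq_top.2 (he.bijective hq).2)

theorem IsRegular.hasFDerivAt_paramEquiv {e : MeshElement} (he : e.IsRegular) {q : ℝ × ℝ}
    (hq : q ∈ e.kind.cell) :
    HasFDerivAt e.param (he.paramEquiv hq : ℝ × ℝ →L[ℝ] Plane) q := e.hasFDerivAt_param q

/-- The inverse of the geometry mapping on the closed element. -/
def paramInv (e : MeshElement) : Plane → ℝ × ℝ := Function.invFunOn e.param e.kind.cell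

theorem paramInv_mem (e : MeshElement) {x : Plane} (hx : x ∈ e.closedRegion) :
    e.paramInv x ∈ e.kind.cell := by
  rw [closedRegion_eq] at hx; exact Function.invFunOn_mem hx

theorem param_paramInv (e : MeshElement) {x : Plane} (hx : x ∈ e.closedRegion) :
    e.param (e.paramInv x) = x := by
  rw [closedRegion_eq] at hx; exact Function.invFunOn_eq hx

theorem IsRegular.paramInv_param {e : MeshElement} (he : e.IsRegular) {q : ℝ × ℝ}
    (hq : q ∈ e.kind.cell) : e.paramInv (e.param q) = q :=
  he.injOn (e.paramInv_mem (e.param_mem hq)) hq (e.param_paramInv (e.param_mem hq))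

/-- A continuous bijection on a compact set is a homeomorphism. -/
theorem IsRegular.continuousOn_paramInv {e : MeshElement} (he : e.IsRegular) :
    ContinuousOn e.paramInv e.closedRegion := by
  rw [continuousOn_iff_isClosed]
  intro t ht
  refine ⟨e.param '' (e.kind.cell ∩ t), ((e.kind.isCompact_cell.inter_right ht).image
    (e.contDiff_param (n := 0)).continuous).isClosed, ?_⟩
  ext x
  constructor
  · rintro ⟨hxt, hx⟩
    exact ⟨⟨e.paramInv x, ⟨e.paramInv_mem hx, hxt⟩, e.param_paramInv hx⟩, hx⟩
  · rintro ⟨⟨q, ⟨hq, hqt⟩, rfl⟩, hx⟩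
    refine ⟨?_, hx⟩
    rwa [mem_preimage, he.paramInv_param hq]

/-- By compactness the inverse of the geometry mapping is continuous, hence it coincides, locally
and on the closed element, with the smooth local inverse. -/
theorem IsRegular.contDiffOn_paramInv {e : MeshElement} (he : e.IsRegular) :
    ContDiffOn ℝ 2 e.paramInv e.closedRegion := by
  intro x hx
  have hq := e.paramInv_mem hx
  have hc : ContDiffAt ℝ 2 e.param (e.paramInv x) := e.contDiff_param.contDiffAt
  have hF := he.hasFDerivAt_paramEquiv hq
  have hloc := hc.to_localInverse hF (by norm_num)
  rw [e.param_paramInv hx] at hloc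
  refine hloc.contDiffWithinAt.congr_of_eventuallyEq_of_mem ?_ hx
  have hl := (hc.hasStrictFDerivAt' hF (by norm_num)).eventually_left_inverse
  have := (he.continuousOn_paramInv x hx).eventually hl
  filter_upwards [this, self_mem_nhdsWithin] with y hy hyR
  rw [e.param_paramInv hyR] at hy
  exact hy.symm

theorem IsRegular.uniqueDiffOn {e : MeshElement} (he : e.IsRegular) :
    UniqueDiffOn ℝ e.closedRegion := by
  rw [closedRegion_eq]
  rintro _ ⟨q, hq, rfl⟩
  exact (e.hasFDerivAt_param q).hasFDerivWithinAt.uniqueDiffWithinAt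
    (e.kind.uniqueDiffOn_cell q hq) (he.bijective hq).2.denseRange

/-- The geometry mapping is open in the interior of the cell. -/
theorem IsRegular.param_mem_openRegion {e : MeshElement} (he : e.IsRegular) {q : ℝ × ℝ}
    (hq : q ∈ interior e.kind.cell) : e.param q ∈ e.openRegion := by
  have hc : ContDiffAt ℝ 1 e.param q := e.contDiff_param.contDiffAt
  have hmap := (hc.hasStrictFDerivAt' (he.hasFDerivAt_paramEquiv (interior_subset hq))
    (by norm_num)).map_nhds_eq_of_equiv
  rw [openRegion, mem_interior_iff_mem_nhds, ← hmap, closedRegion_eq]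
  exact Filter.image_mem_map (mem_interior_iff_mem_nhds.1 hq)

theorem IsRegular.closure_openRegion {e : MeshElement} (he : e.IsRegular) :
    closure e.openRegion = e.closedRegion := by
  refine (closure_minimal interior_subset e.isCompact_closedRegion.isClosed).antisymm ?_
  conv_lhs => rw [closedRegion_eq]
  calc e.param '' e.kind.cell ⊆ e.param '' closure (interior e.kind.cell) :=
        image_mono e.kind.cell_subset_closure_interior
    _ ⊆ closure (e.param '' interior e.kind.cell) :=
        image_closure_subset_closure_image (e.contDiff_param (n := 0)).continuous
    _ ⊆ closure e.openRegion := closure_mono <| by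
        rintro _ ⟨q, hq, rfl⟩; exact he.param_mem_openRegion hq

/-- A point of the closed element that is not interior lies on a side. -/
theorem IsRegular.mem_openRegion_or_mem_side {e : MeshElement} (he : e.IsRegular) {x : Plane}
    (hx : x ∈ e.closedRegion) : x ∈ e.openRegion ∨ ∃ i, ∃ t ∈ Icc (0 : ℝ) 1,
      x = (1 - t) • e.vertex i + t • e.vertex (e.kind.next i) := by
  rw [closedRegion_eq] at hx
  obtain ⟨q, hq, rfl⟩ := hx
  rcases e.kind.mem_interior_or_mem_side hq with h | ⟨i, t, ht, rfl⟩
  · exact .inl (he.param_mem_openRegion h)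
  · exact .inr ⟨i, t, ht, e.param_side i t⟩

/-! ### The chain rule for the pull-back of a function on an element -/

section ChainRule

variable {e : MeshElement} {S : Finset (ℕ × ℕ)} {c : S → ℝ} {g : Plane → ℝ}

/-- The first derivative of a function in the directions of the geometry mapping is a derivative of
its pull-back. -/
theorem fderivWithin_paramDeriv
    (hg : DifferentiableOn ℝ g e.closedRegion)
    (h : ∀ q ∈ e.kind.cell, g (e.param q) = bipartial S 0 0 q c) {q : ℝ × ℝ}
    (hq : q ∈ e.kind.cell) (w : ℝ × ℝ) :
    fderivWithin ℝ g e.closedRegion (e.param q) (e.paramDeriv q w) = bideriv S q w c := by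
  have hmaps : MapsTo e.param e.kind.cell e.closedRegion := fun q hq => e.param_mem hq
  have h1 := (hg _ (e.param_mem hq)).hasFDerivWithinAt.comp q
    (e.hasFDerivAt_param q).hasFDerivWithinAt hmaps
  have h2 : HasFDerivWithinAt (g ∘ e.param) _ e.kind.cell q :=
    HasFDerivWithinAt.congr' (hasFDerivAt_bipartial 0 0 c q).hasFDerivWithinAt h hq
  have := DFunLike.congr_fun ((e.kind.uniqueDiffOn_cell q hq).eq h1 h2) w
  simpa [bideriv_apply, mul_comm] using this

/-- The second derivative of the pull-back has an additional term with the gradient, as the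
geometry mapping is not affine. -/
theorem IsRegular.fderivWithin_fderivWithin_paramDeriv (he : e.IsRegular)
    (hg : ContDiffOn ℝ 2 g e.closedRegion)
    (h : ∀ q ∈ e.kind.cell, g (e.param q) = bipartial S 0 0 q c) {q : ℝ × ℝ}
    (hq : q ∈ e.kind.cell) (z w : ℝ × ℝ) :
    fderivWithin ℝ (fderivWithin ℝ g e.closedRegion) e.closedRegion (e.param q)
        (e.paramDeriv q z) (e.paramDeriv q w)
      + (z.1 * w.2 + z.2 * w.1) * fderivWithin ℝ g e.closedRegion (e.param q) e.twist
      = CellKind.jetSecond (fun a b => bipartial S a b q c) z w := by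
  have hmaps : MapsTo e.param e.kind.cell e.closedRegion := fun q hq => e.param_mem hq
  have hD : DifferentiableOn ℝ (fderivWithin ℝ g e.closedRegion) e.closedRegion :=
    (hg.fderivWithin he.uniqueDiffOn (m := 1) (by norm_num)).differentiableOn (by norm_num)
  have h1 := (hD _ (e.param_mem hq)).hasFDerivWithinAt.comp q
    (e.hasFDerivAt_param q).hasFDerivWithinAt hmaps
  have h2 : HasFDerivAt (fun q => e.paramDeriv q w)
      ((w.2 • ContinuousLinearMap.fst ℝ ℝ ℝ + w.1 • ContinuousLinearMap.snd ℝ ℝ ℝ).smulRight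
        e.twist) q := by
    have : (fun q => e.paramDeriv q w) = fun q =>
        w.1 • (e.du + q.2 • e.twist) + w.2 • (e.dv + q.1 • e.twist) :=
      funext fun q => e.paramDeriv_apply q w
    rw [this]
    have h1 : HasFDerivAt (fun q : ℝ × ℝ => q.1) (ContinuousLinearMap.fst ℝ ℝ ℝ) q :=
      hasFDerivAt_fst
    have h2 : HasFDerivAt (fun q : ℝ × ℝ => q.2) (ContinuousLinearMap.snd ℝ ℝ ℝ) q :=
      hasFDerivAt_snd
    refine ((((hasFDerivAt_const e.du q).add (h2.smul_const e.twist)).const_smul w.1).add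
      (((hasFDerivAt_const e.dv q).add (h1.smul_const e.twist)).const_smul w.2)).congr_fderiv ?_
    ext <;> simp
  have h3 := h1.clm_apply h2.hasFDerivWithinAt
  have h4 : HasFDerivWithinAt (fun q => bideriv S q w c) _ e.kind.cell q :=
    HasFDerivWithinAt.congr' (((hasFDerivAt_bipartial 1 0 c q).const_mul w.1).add
      ((hasFDerivAt_bipartial 0 1 c q).const_mul w.2)).hasFDerivWithinAt
      (fun q _ => bideriv_apply _ _ _) hq
  have h5 := HasFDerivWithinAt.congr' h4 (fun q hq => fderivWithin_paramDeriv
    (hg.differentiableOn (by norm_num)) h hq w) hq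
  have := DFunLike.congr_fun ((e.kind.uniqueDiffOn_cell q hq).eq h3 h5) z
  simp only [add_apply, ContinuousLinearMap.comp_apply,
    ContinuousLinearMap.flip_apply, ContinuousLinearMap.smulRight_apply,
    smul_apply, ContinuousLinearMap.coe_fst', ContinuousLinearMap.coe_snd',
    smul_eq_mul, map_smul, Function.comp_apply] at this
  rw [CellKind.jetSecond]
  linear_combination this

end ChainRule

end MeshElement

/-! ### Interpolation nodes on an edge -/

/-- The parameter of the equidistant point with index `l` on a segment. -/
def edgeNode (p l : ℕ) : ℝ :=
  let N : ℝ := 2 * ((p / 2 : ℕ) : ℝ) - 2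
  ((N - l) / N) * (2 / p) + (l / N) * ((p - 2) / p)

/-- The index of the equidistant point that is the value node `R_l`. -/
def indexR (p l : ℕ) : ℕ :=
  if Odd p then if l ≤ (p - 5) / 2 then l else l + 1
  else if l ≤ (p - 6) / 2 then l else if l = (p - 4) / 2 then (p - 2) / 2 else l + 2

/-- The index of the equidistant point that is the normal derivative node `S_l`. -/
def indexS (p l : ℕ) : ℕ :=
  if Odd p then l else if l ≤ (p - 4) / 2 then l else l + 1

/-- The parameters of the points `R_l`. -/
def nodesR (p : ℕ) : Finset ℝ := (Finset.Icc 1 (p - 5)).image fun l => edgeNode p (indexR p l)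

/-- The parameters of the points `S_l`. -/
def nodesS (p : ℕ) : Finset ℝ := (Finset.Icc 1 (p - 4)).image fun l => edgeNode p (indexS p l)

section Nodes

variable {p : ℕ}

theorem cast_gap_pos (hp : 5 ≤ p) : (0 : ℝ) < 2 * ((p / 2 : ℕ) : ℝ) - 2 := by
  have : 2 ≤ p / 2 := by omega
  have : (2 : ℝ) ≤ ((p / 2 : ℕ) : ℝ) := by exact_mod_cast this
  linarith

theorem edgeNode_eq (hp : 5 ≤ p) (l : ℕ) :
    edgeNode p l = 2 / p + l * ((p - 4) / (p * (2 * ((p / 2 : ℕ) : ℝ) - 2))) := by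
  have h := (cast_gap_pos hp).ne'
  have hp0 : (p : ℝ) ≠ 0 := by positivity
  simp only [edgeNode]
  generalize 2 * ((p / 2 : ℕ) : ℝ) - 2 = N at h ⊢
  field_simp
  ring

theorem equidistantPoint_eq (hp : 5 ≤ p) (A B : Plane) (l : ℕ) :
    equidistantPoint p A B l = (1 - edgeNode p l) • A + edgeNode p l • B := by
  have h := (cast_gap_pos hp).ne'
  have hp0 : (p : ℝ) ≠ 0 := by positivity
  have e : 1 - edgeNode p l = ((2 * ((p / 2 : ℕ) : ℝ) - 2 - l) / (2 * ((p / 2 : ℕ) : ℝ) - 2)) *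
      ((p - 2) / p) + (l / (2 * ((p / 2 : ℕ) : ℝ) - 2)) * (2 / p) := by
    simp only [edgeNode]
    generalize 2 * ((p / 2 : ℕ) : ℝ) - 2 = N at h ⊢
    field_simp
    ring
  rw [e]
  simp only [equidistantPoint, edgeNode]
  module

theorem pointR_eq (hp : 5 ≤ p) (A B : Plane) (l : ℕ) :
    pointR p A B l = (1 - edgeNode p (indexR p l)) • A + edgeNode p (indexR p l) • B := by
  rw [← equidistantPoint_eq hp]
  unfold pointR indexR
  split_ifs <;> rfl

theorem pointS_eq (hp : 5 ≤ p) (A B : Plane) (l : ℕ) :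
    pointS p A B l = (1 - edgeNode p (indexS p l)) • A + edgeNode p (indexS p l) • B := by
  rw [← equidistantPoint_eq hp]
  unfold pointS indexS
  split_ifs <;> rfl

theorem edgeNode_injective (hp : 5 ≤ p) : Function.Injective (edgeNode p) := by
  intro l l' h
  rw [edgeNode_eq hp, edgeNode_eq hp] at h
  have h1 := cast_gap_pos hp
  have h2 : (5 : ℝ) ≤ p := by exact_mod_cast hp
  have h3 : (0 : ℝ) < (p - 4) / (p * (2 * ((p / 2 : ℕ) : ℝ) - 2)) :=
    div_pos (by linarith) (mul_pos (by linarith) h1)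
  have := mul_right_cancel₀ h3.ne' (add_left_cancel h)
  exact_mod_cast this

/-- The equidistant points are symmetric with respect to the midpoint of the edge. -/
theorem edgeNode_reflect (hp : 5 ≤ p) {l l' : ℕ} (h : l + l' = 2 * (p / 2) - 2) :
    1 - edgeNode p l = edgeNode p l' := by
  have h1 := (cast_gap_pos hp).ne'
  have hp0 : (p : ℝ) ≠ 0 := by positivity
  have hl : (l : ℝ) = 2 * ((p / 2 : ℕ) : ℝ) - 2 - l' := by
    have : ((l + l' + 2 : ℕ) : ℝ) = ((2 * (p / 2) : ℕ) : ℝ) := by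
      congr 1
      omega
    push_cast at this ⊢
    linarith
  simp only [edgeNode]
  rw [hl]
  generalize 2 * ((p / 2 : ℕ) : ℝ) - 2 = N at h1 ⊢
  field_simp
  ring

theorem edgeNode_mem_Ioo (hp : 5 ≤ p) {l : ℕ} (hl : l ≤ 2 * (p / 2) - 2) :
    edgeNode p l ∈ Ioo (0 : ℝ) 1 := by
  have h2 : (5 : ℝ) ≤ p := by exact_mod_cast hp
  have pos : ∀ l, 0 < edgeNode p l := fun l => by
    rw [edgeNode_eq hp]
    have h1 := cast_gap_pos hp
    have h3 : (0 : ℝ) < (p - 4) / (p * (2 * ((p / 2 : ℕ) : ℝ) - 2)) :=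
      div_pos (by linarith) (mul_pos (by linarith) h1)
    positivity
  refine ⟨pos l, ?_⟩
  have := edgeNode_reflect hp (l := l) (l' := 2 * (p / 2) - 2 - l) (by omega)
  have := pos (2 * (p / 2) - 2 - l)
  linarith

theorem indexR_reflect (hp : 5 ≤ p) {l : ℕ} (h1 : 1 ≤ l) (h2 : l ≤ p - 5) :
    indexR p l + indexR p (p - 4 - l) = 2 * (p / 2) - 2 := by
  unfold indexR
  rcases Nat.even_or_odd' p with ⟨m, rfl | rfl⟩
  · have : ¬ Odd (2 * m) := by simp
    simp only [this, if_false]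
    split_ifs <;> omega
  · have : Odd (2 * m + 1) := ⟨m, rfl⟩
    simp only [this, if_true]
    split_ifs <;> omega

theorem indexS_reflect (hp : 5 ≤ p) {l : ℕ} (h2 : l ≤ p - 4) :
    indexS p l + indexS p (p - 3 - l) = 2 * (p / 2) - 2 := by
  unfold indexS
  rcases Nat.even_or_odd' p with ⟨m, rfl | rfl⟩
  · have : ¬ Odd (2 * m) := by simp
    simp only [this, if_false]
    split_ifs <;> omega
  · have : Odd (2 * m + 1) := ⟨m, rfl⟩
    simp only [this, if_true]
    omega

theorem indexR_injective (p : ℕ) : InjOn (indexR p) (Finset.Icc 1 (p - 5)) := by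
  intro l hl l' hl' h
  simp at hl hl'
  revert h
  unfold indexR
  split_ifs <;> omega

theorem indexS_injective (p : ℕ) : Function.Injective (indexS p) := by
  intro l l' h
  revert h
  unfold indexS
  split_ifs <;> omega

theorem card_nodesR (hp : 5 ≤ p) : (nodesR p).card = p - 5 := by
  rw [nodesR, Finset.card_image_of_injOn]
  · simp
  · exact (edgeNode_injective hp).comp_injOn (indexR_injective p)

theorem card_nodesS (hp : 5 ≤ p) : (nodesS p).card = p - 4 := by
  rw [nodesS, Finset.card_image_of_injective]
  · simp
  · exact (edgeNode_injective hp).comp (indexS_injective p)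

/-- The nodes are interior to the edge, and their set does not depend on its orientation. -/
theorem nodesR_subset (hp : 5 ≤ p) {t : ℝ} (ht : t ∈ nodesR p) :
    t ∈ Ioo (0 : ℝ) 1 ∧ 1 - t ∈ nodesR p := by
  simp only [nodesR, Finset.mem_image, Finset.mem_Icc] at ht
  obtain ⟨l, ⟨h1, h2⟩, rfl⟩ := ht
  have h := indexR_reflect hp h1 h2
  refine ⟨edgeNode_mem_Ioo hp (by omega), ?_⟩
  rw [edgeNode_reflect hp h]
  exact Finset.mem_image_of_mem _ (by simp; omega)

/-- The nodes are interior to the edge, and their set does not depend on its orientation. -/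
theorem nodesS_subset (hp : 5 ≤ p) {t : ℝ} (ht : t ∈ nodesS p) :
    t ∈ Ioo (0 : ℝ) 1 ∧ 1 - t ∈ nodesS p := by
  simp only [nodesS, Finset.mem_image, Finset.mem_Icc] at ht
  obtain ⟨l, ⟨h1, h2⟩, rfl⟩ := ht
  have h := indexS_reflect hp h2
  refine ⟨edgeNode_mem_Ioo hp (by omega), ?_⟩
  rw [edgeNode_reflect hp h]
  exact Finset.mem_image_of_mem _ (by simp; omega)

end Nodes

/-! ### Trace and normal derivative on an edge -/

/-- A value, a first and a symmetric second derivative at every point of the plane. These are the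
data to be interpolated; they need not be the derivatives of a function. -/
structure JetField : Type where
  val : Plane → ℝ
  grad : Plane → Plane →L[ℝ] ℝ
  hess : Plane → Plane →L[ℝ] Plane →L[ℝ] ℝ
  symm : ∀ x v w, hess x v w = hess x w v

/-- The derivatives at the parameter `x` of a trace `f` and a normal derivative `g` along the edge
from `X` to `Y`, as prescribed at the point `Z` of the edge. -/
structure JetField.EndCondition (φ : JetField) (X Y Z : Plane) (f g : Polynomial ℝ) (x : ℝ) :
    Prop where
  trace_zero : f.eval x = φ.val Z
  trace_one : f.derivative.eval x = φ.grad Z (Y - X)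
  trace_two : f.derivative.derivative.eval x = φ.hess Z (Y - X) (Y - X)
  normal_zero : g.eval x = φ.grad Z (unitNormal X Y)
  normal_one : g.derivative.eval x = φ.hess Z (Y - X) (unitNormal X Y)

/-- The polynomials `f` and `g` are the trace and the normal derivative on the edge from `X` to `Y`
that interpolate the data `φ`. -/
structure JetField.IsEdgePair (φ : JetField) (p : ℕ) (X Y : Plane) (f g : Polynomial ℝ) :
    Prop where
  natDegree_trace : f.natDegree ≤ p
  natDegree_normal : g.natDegree ≤ p - 1
  start : φ.EndCondition X Y X f g 0
  finish : φ.EndCondition X Y Y f g 1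
  trace : ∀ t ∈ nodesR p, f.eval t = φ.val ((1 - t) • X + t • Y)
  normal : ∀ t ∈ nodesS p, g.eval t = φ.grad ((1 - t) • X + t • Y) (unitNormal X Y)

theorem unitNormal_swap (X Y : Plane) : unitNormal Y X = -unitNormal X Y := by
  ext i
  rw [unitNormal, unitNormal, norm_sub_rev]
  fin_cases i <;> simp <;> ring

theorem norm_unitNormal_le (X Y : Plane) : ‖unitNormal X Y‖ ≤ 1 := by
  have : ‖(!₂[(Y - X) 1, -((Y - X) 0)] : Plane)‖ = ‖Y - X‖ := by
    rw [EuclideanSpace.norm_eq, EuclideanSpace.norm_eq]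
    simp only [Fin.sum_univ_two, Real.norm_eq_abs, sq_abs]
    congr 1
    simp
    ring
  rw [unitNormal, norm_smul, this, norm_inv, norm_norm]
  exact inv_mul_le_one

namespace JetField

open Polynomial

/-- Multiplicity `r` at the two end points and one at the inner nodes. -/
def edgeMult (r : ℕ) (t : ℝ) : ℕ := if t = 0 ∨ t = 1 then r else 1

theorem sum_edgeMult (r : ℕ) {s : Finset ℝ} (hs : ∀ t ∈ s, t ∈ Ioo (0 : ℝ) 1) :
    ∑ t ∈ insert 0 (insert 1 s), edgeMult r t = 2 * r + s.card := by
  have h0 : (0 : ℝ) ∉ s := fun h => lt_irrefl _ (hs _ h).1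
  have h1 : (1 : ℝ) ∉ s := fun h => lt_irrefl _ (hs _ h).2
  rw [Finset.sum_insert (by simp [h0]), Finset.sum_insert h1]
  have : ∑ t ∈ s, edgeMult r t = ∑ t ∈ s, 1 := Finset.sum_congr rfl fun t ht => by
    rw [edgeMult, if_neg]; rintro (rfl | rfl) <;> contradiction
  rw [this]
  simp [edgeMult]
  ring

theorem sum_edgeMult_nodesR {p : ℕ} (hp : 5 ≤ p) :
    ∑ t ∈ insert 0 (insert 1 (nodesR p)), edgeMult 3 t = p + 1 := by
  rw [sum_edgeMult 3 fun t ht => (nodesR_subset hp ht).1, card_nodesR hp]; omega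

theorem sum_edgeMult_nodesS {p : ℕ} (hp : 5 ≤ p) :
    ∑ t ∈ insert 0 (insert 1 (nodesS p)), edgeMult 2 t = p - 1 + 1 := by
  rw [sum_edgeMult 2 fun t ht => (nodesS_subset hp ht).1, card_nodesS hp]; omega

variable (φ : JetField) {p : ℕ} (X Y : Plane)

/-- The Hermite data of the trace. -/
def traceData (t : ℝ) (j : ℕ) : ℝ :=
  if j = 0 then φ.val ((1 - t) • X + t • Y)
  else if j = 1 then φ.grad ((1 - t) • X + t • Y) (Y - X)
  else φ.hess ((1 - t) • X + t • Y) (Y - X) (Y - X)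

/-- The Hermite data of the normal derivative. -/
def normalData (t : ℝ) (j : ℕ) : ℝ :=
  if j = 0 then φ.grad ((1 - t) • X + t • Y) (unitNormal X Y)
  else φ.hess ((1 - t) • X + t • Y) (Y - X) (unitNormal X Y)

variable {φ X Y}

/-- An edge pair solves two univariate Hermite problems: multiplicity three, respectively two, at
the end points, and simple nodes in between. -/
theorem isEdgePair_iff (hp : 5 ≤ p) {f g : ℝ[X]} :
    φ.IsEdgePair p X Y f g ↔ f.natDegree ≤ p ∧ g.natDegree ≤ p - 1 ∧
      (∀ t ∈ insert 0 (insert 1 (nodesR p)), ∀ j < edgeMult 3 t,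
        (derivative^[j] f).eval t = φ.traceData X Y t j) ∧
      (∀ t ∈ insert 0 (insert 1 (nodesS p)), ∀ j < edgeMult 2 t,
        (derivative^[j] g).eval t = φ.normalData X Y t j) := by
  constructor
  · intro h
    refine ⟨h.natDegree_trace, h.natDegree_normal, fun t ht j hj => ?_, fun t ht j hj => ?_⟩
    · simp only [Finset.mem_insert] at ht
      rcases ht with rfl | rfl | ht
      · obtain rfl | rfl | rfl : j = 0 ∨ j = 1 ∨ j = 2 := by simp [edgeMult] at hj; omega
        · simpa [traceData] using h.start.trace_zero
        · simpa [traceData] using h.start.trace_one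
        · simpa [traceData] using h.start.trace_two
      · obtain rfl | rfl | rfl : j = 0 ∨ j = 1 ∨ j = 2 := by simp [edgeMult] at hj; omega
        · simpa [traceData] using h.finish.trace_zero
        · simpa [traceData] using h.finish.trace_one
        · simpa [traceData] using h.finish.trace_two
      · have ht' := (nodesR_subset hp ht).1
        have : j = 0 := by
          rw [edgeMult, if_neg (by rintro (rfl | rfl) <;> simp at ht')] at hj; omega
        subst this
        simpa [traceData] using h.trace t ht
    · simp only [Finset.mem_insert] at ht
      rcases ht with rfl | rfl | ht
      · obtain rfl | rfl : j = 0 ∨ j = 1 := by simp [edgeMult] at hj; omega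
        · simpa [normalData] using h.start.normal_zero
        · simpa [normalData] using h.start.normal_one
      · obtain rfl | rfl : j = 0 ∨ j = 1 := by simp [edgeMult] at hj; omega
        · simpa [normalData] using h.finish.normal_zero
        · simpa [normalData] using h.finish.normal_one
      · have ht' := (nodesS_subset hp ht).1
        have : j = 0 := by
          rw [edgeMult, if_neg (by rintro (rfl | rfl) <;> simp at ht')] at hj; omega
        subst this
        simpa [normalData] using h.normal t ht
  · rintro ⟨hf, hg, h1, h2⟩
    have mult : ∀ r t, t ∈ Ioo (0 : ℝ) 1 → 0 < edgeMult r t := fun r t ht => by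
      rw [edgeMult, if_neg (by rintro (rfl | rfl) <;> simp at ht)]; omega
    refine ⟨hf, hg, ⟨?_, ?_, ?_, ?_, ?_⟩, ⟨?_, ?_, ?_, ?_, ?_⟩, fun t ht => ?_, fun t ht => ?_⟩
    · simpa [traceData] using h1 0 (by simp) 0 (by simp [edgeMult])
    · simpa [traceData] using h1 0 (by simp) 1 (by simp [edgeMult])
    · simpa [traceData] using h1 0 (by simp) 2 (by simp [edgeMult])
    · simpa [normalData] using h2 0 (by simp) 0 (by simp [edgeMult])
    · simpa [normalData] using h2 0 (by simp) 1 (by simp [edgeMult])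
    · simpa [traceData] using h1 1 (by simp) 0 (by simp [edgeMult])
    · simpa [traceData] using h1 1 (by simp) 1 (by simp [edgeMult])
    · simpa [traceData] using h1 1 (by simp) 2 (by simp [edgeMult])
    · simpa [normalData] using h2 1 (by simp) 0 (by simp [edgeMult])
    · simpa [normalData] using h2 1 (by simp) 1 (by simp [edgeMult])
    · simpa [traceData] using h1 t (by simp [ht]) 0 (mult _ _ (nodesR_subset hp ht).1)
    · simpa [normalData] using h2 t (by simp [ht]) 0 (mult _ _ (nodesS_subset hp ht).1)

theorem exists_isEdgePair (hp : 5 ≤ p) (φ : JetField) (X Y : Plane) :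
    ∃ f g, φ.IsEdgePair p X Y f g := by
  obtain ⟨f, hf, hf'⟩ := exists_hermite _ _ p (sum_edgeMult_nodesR hp) (φ.traceData X Y)
  obtain ⟨g, hg, hg'⟩ := exists_hermite _ _ (p - 1) (sum_edgeMult_nodesS hp) (φ.normalData X Y)
  exact ⟨f, g, (isEdgePair_iff hp).2 ⟨hf, hg, hf', hg'⟩⟩

theorem IsEdgePair.unique (hp : 5 ≤ p) {f g f' g' : ℝ[X]} (h : φ.IsEdgePair p X Y f g)
    (h' : φ.IsEdgePair p X Y f' g') : f = f' ∧ g = g' := by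
  rw [isEdgePair_iff hp] at h h'
  obtain ⟨a1, a2, a3, a4⟩ := h
  obtain ⟨b1, b2, b3, b4⟩ := h'
  constructor
  · rw [← sub_eq_zero]
    refine eq_zero_of_hermite_eq_zero (insert 0 (insert 1 (nodesR p))) id (injOn_id _)
      (edgeMult 3) ?_ fun t ht j hj => ?_
    · rw [sum_edgeMult_nodesR hp]
      exact Nat.lt_succ_of_le ((natDegree_sub_le _ _).trans (max_le a1 b1))
    · rw [iterate_derivative_sub, eval_sub, sub_eq_zero]
      exact (a3 t ht j hj).trans (b3 t ht j hj).symm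
  · rw [← sub_eq_zero]
    refine eq_zero_of_hermite_eq_zero (insert 0 (insert 1 (nodesS p))) id (injOn_id _)
      (edgeMult 2) ?_ fun t ht j hj => ?_
    · rw [sum_edgeMult_nodesS hp]
      exact Nat.lt_succ_of_le ((natDegree_sub_le _ _).trans (max_le a2 b2))
    · rw [iterate_derivative_sub, eval_sub, sub_eq_zero]
      exact (a4 t ht j hj).trans (b4 t ht j hj).symm

/-- Reversing the orientation of the edge reflects the parameter and changes the sign of the
normal derivative. The sets of nodes are symmetric. -/
theorem IsEdgePair.reverse (hp : 5 ≤ p) {f g : ℝ[X]} (h : φ.IsEdgePair p X Y f g) :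
    φ.IsEdgePair p Y X (f.comp (1 - Polynomial.X)) (-g.comp (1 - Polynomial.X)) := by
  have hd : ∀ f : ℝ[X], (f.comp (1 - Polynomial.X)).natDegree ≤ f.natDegree := fun f => by
    refine natDegree_comp_le.trans ?_
    have : (1 - Polynomial.X : ℝ[X]).natDegree ≤ 1 := by compute_degree
    nlinarith
  have hend : ∀ {Z x}, φ.EndCondition X Y Z f g x →
      φ.EndCondition Y X Z (f.comp (1 - Polynomial.X)) (-g.comp (1 - Polynomial.X)) (1 - x) := by
    intro Z x hx
    have hneg : X - Y = -(Y - X) := by abel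
    constructor
    · simpa using hx.trace_zero
    · rw [hneg, map_neg, ← hx.trace_one]
      simp [derivative_comp]
    · simp only [hneg, map_neg, neg_apply, neg_neg, ← hx.trace_two]
      simp [derivative_comp]
    · rw [unitNormal_swap, map_neg, ← hx.normal_zero]
      simp
    · simp only [hneg, unitNormal_swap X Y, map_neg, neg_apply, neg_neg, ← hx.normal_one]
      simp [derivative_comp]
  have hpt : ∀ t : ℝ, (1 - t) • Y + t • X = (1 - (1 - t)) • X + (1 - t) • Y := fun t => by module
  refine ⟨(hd f).trans h.natDegree_trace, ?_, by simpa using hend h.finish,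
    by simpa using hend h.start, fun t ht => ?_, fun t ht => ?_⟩
  · rw [natDegree_neg]; exact (hd g).trans h.natDegree_normal
  · rw [hpt, ← h.trace _ (nodesR_subset hp ht).2]; simp
  · rw [hpt, unitNormal_swap, map_neg, ← h.normal _ (nodesS_subset hp ht).2]; simp

/-- The data `φ` are bounded by `M` on the set `K`. -/
structure BoundedOn (φ : JetField) (K : Set Plane) (M : ℝ) : Prop where
  val : ∀ x ∈ K, |φ.val x| ≤ M
  grad : ∀ x ∈ K, ∀ v, |φ.grad x v| ≤ ‖v‖ * M
  hess : ∀ x ∈ K, ∀ v w, |φ.hess x v w| ≤ ‖v‖ * ‖w‖ * M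

/-- The trace, its derivative and the normal derivative are bounded by the data on the edge. The
Hermite data are derivatives along the edge of order at most two with respect to its linear
parameter, hence the factor that depends on the length. -/
theorem exists_isEdgePair_bound (hp : 5 ≤ p) : ∃ C : ℝ, 0 ≤ C ∧ ∀ (φ : JetField) (X Y : Plane)
    (f g : ℝ[X]), φ.IsEdgePair p X Y f g → ∀ M : ℝ, φ.BoundedOn (segment ℝ X Y) M →
      ∀ t ∈ Icc (0 : ℝ) 1, |f.eval t| ≤ C * ((1 + ‖Y - X‖) ^ 2 * M) ∧
        |f.derivative.eval t| ≤ C * ((1 + ‖Y - X‖) ^ 2 * M) ∧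
        |g.eval t| ≤ C * ((1 + ‖Y - X‖) ^ 2 * M) := by
  obtain ⟨C, hC, h1⟩ := exists_hermite_bound _ _ p (sum_edgeMult_nodesR hp)
  obtain ⟨C', hC', h2⟩ := exists_hermite_bound _ _ (p - 1) (sum_edgeMult_nodesS hp)
  refine ⟨C + C', add_nonneg hC hC', fun φ X Y f g h M hM t ht => ?_⟩
  have hM0 : 0 ≤ M := (abs_nonneg _).trans (hM.val X (left_mem_segment ℝ X Y))
  rw [isEdgePair_iff hp] at h
  obtain ⟨a1, a2, a3, a4⟩ := h
  set L := ‖Y - X‖ with hL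
  have hL0 : 0 ≤ L := norm_nonneg _
  have hn := norm_unitNormal_le X Y
  have hn0 : 0 ≤ ‖unitNormal X Y‖ := norm_nonneg _
  have hmem : ∀ t ∈ Icc (0 : ℝ) 1, (1 - t) • X + t • Y ∈ segment ℝ X Y := fun t ht =>
    ⟨1 - t, t, by linarith [ht.2], ht.1, by ring, rfl⟩
  have hbig : ∀ a, a ≤ (1 + L) ^ 2 → a * M ≤ (1 + L) ^ 2 * M := fun a ha =>
    mul_le_mul_of_nonneg_right ha hM0
  have b1 : ∀ t ∈ Icc (0 : ℝ) 1, ∀ j, |φ.traceData X Y t j| ≤ (1 + L) ^ 2 * M := by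
    intro t ht j
    unfold traceData
    split_ifs
    · exact (hM.val _ (hmem t ht)).trans (by simpa using hbig 1 (by nlinarith))
    · exact (hM.grad _ (hmem t ht) _).trans (hbig _ (by nlinarith))
    · exact (hM.hess _ (hmem t ht) _ _).trans (hbig _ (by nlinarith))
  have b2 : ∀ t ∈ Icc (0 : ℝ) 1, ∀ j, |φ.normalData X Y t j| ≤ (1 + L) ^ 2 * M := by
    intro t ht j
    unfold normalData
    split_ifs
    · exact (hM.grad _ (hmem t ht) _).trans (hbig _ (by nlinarith))
    · exact (hM.hess _ (hmem t ht) _ _).trans (hbig _ (by nlinarith))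
  have hI : ∀ s : Finset ℝ, (∀ t ∈ s, t ∈ Ioo (0 : ℝ) 1) → ∀ t ∈ insert 0 (insert 1 s),
      t ∈ Icc (0 : ℝ) 1 := by
    intro s hs t ht
    simp only [Finset.mem_insert] at ht
    rcases ht with rfl | rfl | ht
    · simp
    · simp
    · exact Ioo_subset_Icc_self (hs t ht)
  have c1 := h1 f a1 ((1 + L) ^ 2 * M) (fun x hx j hj => by
    rw [a3 x hx j hj]; exact b1 x (hI _ (fun t ht => (nodesR_subset hp ht).1) x hx) j) t ht
  have c2 := h2 g a2 ((1 + L) ^ 2 * M) (fun x hx j hj => by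
    rw [a4 x hx j hj]; exact b2 x (hI _ (fun t ht => (nodesS_subset hp ht).1) x hx) j) t ht
  have hB : 0 ≤ (1 + L) ^ 2 * M := by positivity
  refine ⟨c1.1.trans ?_, c1.2.trans ?_, c2.1.trans ?_⟩ <;>
    exact mul_le_mul_of_nonneg_right (by linarith) hB

end JetField

/-! ### Functions on an element and their edge traces -/

/-- The component of `v` along `Y - X`, as a multiple of `Y - X`. -/
def tangentCoeff (X Y v : Plane) : ℝ := (v 0 * (Y - X) 0 + v 1 * (Y - X) 1) / ‖Y - X‖ ^ 2

/-- The component of `v` along the unit normal of the segment from `X` to `Y`. -/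
def normalCoeff (X Y v : Plane) : ℝ := (v 0 * (Y - X) 1 - v 1 * (Y - X) 0) / ‖Y - X‖

theorem norm_sq_plane (v : Plane) : ‖v‖ ^ 2 = v 0 ^ 2 + v 1 ^ 2 := by
  rw [EuclideanSpace.norm_sq_eq]; simp

theorem normal_tangent_decomposition {X Y : Plane} (h : X ≠ Y) (v : Plane) :
    v = normalCoeff X Y v • unitNormal X Y + tangentCoeff X Y v • (Y - X) := by
  have hL : ‖Y - X‖ ≠ 0 := norm_ne_zero_iff.2 (sub_ne_zero.2 h.symm)
  have hsq := norm_sq_plane (Y - X)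
  simp only [normalCoeff, tangentCoeff, unitNormal]
  generalize Y - X = d at hL hsq ⊢
  generalize ‖d‖ = L at hL hsq ⊢
  ext i
  fin_cases i
  · simp
    field_simp
    linear_combination v 0 * hsq
  · simp
    field_simp
    linear_combination v 1 * hsq

theorem normalCoeff_add (X Y v w : Plane) :
    normalCoeff X Y (v + w) = normalCoeff X Y v + normalCoeff X Y w := by
  simp only [normalCoeff, PiLp.add_apply]; ring

theorem tangentCoeff_add (X Y v w : Plane) :
    tangentCoeff X Y (v + w) = tangentCoeff X Y v + tangentCoeff X Y w := by
  simp only [tangentCoeff, PiLp.add_apply]; ring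

theorem normalCoeff_smul (X Y v : Plane) (a : ℝ) :
    normalCoeff X Y (a • v) = a * normalCoeff X Y v := by
  simp only [normalCoeff, PiLp.smul_apply, smul_eq_mul]; ring

theorem tangentCoeff_smul (X Y v : Plane) (a : ℝ) :
    tangentCoeff X Y (a • v) = a * tangentCoeff X Y v := by
  simp only [tangentCoeff, PiLp.smul_apply, smul_eq_mul]; ring

open Classical in
/-- The derivatives of a function of class `C²` on `K`, continued by zero. -/
def JetField.ofFunction (K : Set Plane) (g : Plane → ℝ) (hK : UniqueDiffOn ℝ K)
    (hK' : K ⊆ closure (interior K)) (hg : ContDiffOn ℝ 2 g K) : JetField where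
  val x := if x ∈ K then g x else 0
  grad x := if x ∈ K then fderivWithin ℝ g K x else 0
  hess x := if x ∈ K then fderivWithin ℝ (fderivWithin ℝ g K) K x else 0
  symm x v w := by
    split_ifs with hx
    · exact (hg x hx).isSymmSndFDerivWithinAt (by simp) hK (hK' hx) hx v w
    · simp

theorem CellKind.innerPoint_mem (k : CellKind) {p : ℕ} (hp : 5 ≤ p) {m : ℕ × ℕ}
    (hm : m ∈ k.inner p) : innerPoint p m ∈ k.cell := by
  have hp0 : (0 : ℝ) < p := by positivity
  cases k
  · have h : ((m.1 + 2 : ℕ) : ℝ) + ((m.2 + 2 : ℕ) : ℝ) ≤ p := by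
      have := mem_lattice_tri.1 hm
      exact_mod_cast (by omega : m.1 + 2 + (m.2 + 2) ≤ p)
    have h1 : (0 : ℝ) ≤ ((m.1 + 2 : ℕ) : ℝ) := by positivity
    have h2 : (0 : ℝ) ≤ ((m.2 + 2 : ℕ) : ℝ) := by positivity
    refine ⟨div_nonneg h1 hp0.le, (div_le_one hp0).2 (by linarith), div_nonneg h2 hp0.le, ?_⟩
    rw [le_sub_iff_add_le, innerPoint, ← add_div, div_le_one hp0]
    linarith
  · have := mem_lattice_quad.1 hm
    exact ⟨mem_Icc_div_nat (by omega), mem_Icc_div_nat (by omega)⟩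

namespace MeshElement

open Polynomial

/-- On the edge from `X` to `Y`, which is contained in `K`, the function `g` has the trace `f`
and the normal derivative `h`. -/
structure HasEdgeTraces (K : Set Plane) (g : Plane → ℝ) (X Y : Plane) (f h : ℝ[X]) : Prop where
  value : ∀ t ∈ Icc (0 : ℝ) 1, g ((1 - t) • X + t • Y) = f.eval t
  normal : ∀ t ∈ Icc (0 : ℝ) 1,
    fderivWithin ℝ g K ((1 - t) • X + t • Y) (unitNormal X Y) = h.eval t

section EdgeTraces

variable {K : Set Plane} {g : Plane → ℝ} {X Y : Plane} {f h : ℝ[X]}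

/-- A functional `l` of a function that is polynomial along an edge may be differentiated along the
edge. -/
theorem derivative_eq_of_eqOn {F : Type*} [NormedAddCommGroup F] [NormedSpace ℝ F]
    {G : Plane → F} (hseg : segment ℝ X Y ⊆ K) (hG : DifferentiableOn ℝ G K) (l : F →L[ℝ] ℝ)
    (h : ∀ t ∈ Icc (0 : ℝ) 1, l (G ((1 - t) • X + t • Y)) = f.eval t) {t : ℝ}
    (ht : t ∈ Icc (0 : ℝ) 1) :
    l (fderivWithin ℝ G K ((1 - t) • X + t • Y) (Y - X)) = (derivative f).eval t := by
  have hmaps : MapsTo (fun t : ℝ => (1 - t) • X + t • Y) (Icc 0 1) K := fun t ht =>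
    hseg ⟨1 - t, t, by linarith [ht.2], ht.1, by ring, rfl⟩
  have h1 : HasDerivAt (fun t : ℝ => (1 - t) • X + t • Y) (Y - X) t := by
    have := (((hasDerivAt_const t (1 : ℝ)).sub (hasDerivAt_id t)).smul_const X).add
      ((hasDerivAt_id t).smul_const Y)
    refine this.congr_deriv ?_
    module
  have h2 := (hG _ (hmaps ht)).hasFDerivWithinAt.comp_hasDerivWithinAt t h1.hasDerivWithinAt hmaps
  have h3 := l.hasFDerivAt.comp_hasDerivWithinAt t h2
  have h4 : HasDerivWithinAt (fun t => f.eval t) ((derivative f).eval t) (Icc 0 1) t :=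
    (f.hasDerivAt t).hasDerivWithinAt
  exact (uniqueDiffOn_Icc zero_lt_one t ht).eq_deriv _ (h3.congr (fun t ht => (h t ht).symm)
    (h t ht).symm) h4

theorem HasEdgeTraces.tangent (H : HasEdgeTraces K g X Y f h) (hseg : segment ℝ X Y ⊆ K)
    (hg : DifferentiableOn ℝ g K) {t : ℝ} (ht : t ∈ Icc (0 : ℝ) 1) :
    fderivWithin ℝ g K ((1 - t) • X + t • Y) (Y - X) = (derivative f).eval t :=
  derivative_eq_of_eqOn hseg hg (ContinuousLinearMap.id ℝ ℝ) H.value ht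

/-- The trace and the normal derivative determine, at every point of the edge, all derivatives of
order at most two except the second derivative in the normal direction. -/
theorem HasEdgeTraces.endCondition (H : HasEdgeTraces K g X Y f h) (hseg : segment ℝ X Y ⊆ K)
    (hK : UniqueDiffOn ℝ K) (hK' : K ⊆ closure (interior K)) (hg : ContDiffOn ℝ 2 g K) {t : ℝ}
    (ht : t ∈ Icc (0 : ℝ) 1) :
    (JetField.ofFunction K g hK hK' hg).EndCondition X Y ((1 - t) • X + t • Y) f h t := by
  have hmem : (1 - t) • X + t • Y ∈ K :=
    hseg ⟨1 - t, t, by linarith [ht.2], ht.1, by ring, rfl⟩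
  have hD : DifferentiableOn ℝ (fderivWithin ℝ g K) K :=
    (hg.fderivWithin hK (m := 1) (by norm_num)).differentiableOn (by norm_num)
  have hg1 := hg.differentiableOn (by norm_num)
  constructor <;> simp only [JetField.ofFunction, if_pos hmem]
  · exact (H.value t ht).symm
  · exact (H.tangent hseg hg1 ht).symm
  · exact (derivative_eq_of_eqOn hseg hD (ContinuousLinearMap.apply ℝ ℝ (Y - X))
      (fun t ht => H.tangent hseg hg1 ht) ht).symm
  · exact (H.normal t ht).symm
  · exact (derivative_eq_of_eqOn hseg hD (ContinuousLinearMap.apply ℝ ℝ (unitNormal X Y))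
      H.normal ht).symm

end EdgeTraces

variable {e : MeshElement}

theorem segment_subset (e : MeshElement) (i : Fin e.kind.sides) :
    segment ℝ (e.vertex i) (e.vertex (e.kind.next i)) ⊆ e.closedRegion := by
  rw [segment_eq_image]
  rintro _ ⟨t, ht, rfl⟩
  simp only
  rw [← e.param_side]
  exact e.param_mem (e.kind.corner_add_smul_along_mem i ht)

theorem IsRegular.vertex_ne (he : e.IsRegular) (i : Fin e.kind.sides) :
    e.vertex i ≠ e.vertex (e.kind.next i) := by
  intro h
  have := he.injOn (e.kind.corner_mem_cell _) (e.kind.corner_mem_cell _) h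
  rw [CellKind.corner_next] at this
  have h0 : e.kind.along i = 0 := by simpa using this.symm
  have := e.kind.along_across_det i
  simp [h0] at this

theorem IsRegular.subset_closure_interior (he : e.IsRegular) :
    e.closedRegion ⊆ closure (interior e.closedRegion) := he.closure_openRegion.ge

/-- The derivatives of a function of class `C²` on a closed element. -/
abbrev IsRegular.jets (he : e.IsRegular) {g : Plane → ℝ} (hg : ContDiffOn ℝ 2 g e.closedRegion) :
    JetField := JetField.ofFunction e.closedRegion g he.uniqueDiffOn he.subset_closure_interior hg

theorem paramDeriv_across (e : MeshElement) (i : Fin e.kind.sides) :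
    e.paramDeriv (e.kind.corner i) (e.kind.across i)
      = -(e.vertex i - e.vertex (e.kind.prev i)) := by
  have := e.paramDeriv_along (e.kind.prev i) 1
  rw [one_smul, ← CellKind.corner_next, CellKind.next_prev] at this
  rw [CellKind.across_eq_neg_along_prev, map_neg, this]

/-- The directions of the two sides that meet at a vertex span the plane. -/
theorem IsRegular.exists_combination (he : e.IsRegular) (i : Fin e.kind.sides) (v : Plane) :
    ∃ a b : ℝ, v = a • (e.vertex (e.kind.next i) - e.vertex i)
      + b • (e.vertex i - e.vertex (e.kind.prev i)) := by
  obtain ⟨w, rfl⟩ := (he.bijective (e.kind.corner_mem_cell i)).2 v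
  have hdet := e.kind.along_across_det i
  have hw : w = (w.1 * (e.kind.across i).2 - w.2 * (e.kind.across i).1) • e.kind.along i
      + ((e.kind.along i).1 * w.2 - (e.kind.along i).2 * w.1) • e.kind.across i := by
    ext
    · simp only [Prod.fst_add, Prod.smul_fst, smul_eq_mul]
      linear_combination (-w.1) * hdet
    · simp only [Prod.snd_add, Prod.smul_snd, smul_eq_mul]
      linear_combination (-w.2) * hdet
  refine ⟨w.1 * (e.kind.across i).2 - w.2 * (e.kind.across i).1,
    -((e.kind.along i).1 * w.2 - (e.kind.along i).2 * w.1), ?_⟩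
  conv_lhs => rw [hw]
  rw [map_add, map_smul, map_smul, paramDeriv_across]
  have := e.paramDeriv_along i 0
  rw [zero_smul, add_zero] at this
  rw [this]
  module

/-- The traces on the two sides that meet at a vertex determine all derivatives of order at most
two at the vertex. -/
theorem IsRegular.jets_vertex_eq (he : e.IsRegular) {g : Plane → ℝ}
    (hg : ContDiffOn ℝ 2 g e.closedRegion) {φ : JetField} {p : ℕ}
    (f h : Fin e.kind.sides → ℝ[X])
    (hφ : ∀ i, φ.IsEdgePair p (e.vertex i) (e.vertex (e.kind.next i)) (f i) (h i))
    (hT : ∀ i, HasEdgeTraces e.closedRegion g (e.vertex i) (e.vertex (e.kind.next i)) (f i) (h i))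
    (i : Fin e.kind.sides) :
    (he.jets hg).val (e.vertex i) = φ.val (e.vertex i) ∧
      (he.jets hg).grad (e.vertex i) = φ.grad (e.vertex i) ∧
      (he.jets hg).hess (e.vertex i) = φ.hess (e.vertex i) := by
  set j := e.kind.prev i with hj
  have hji : e.kind.next j = i := e.kind.next_prev i
  have out := (hT i).endCondition (e.segment_subset i) he.uniqueDiffOn
    he.subset_closure_interior hg (t := 0) (by simp)
  have inc := (hT j).endCondition (e.segment_subset j) he.uniqueDiffOn
    he.subset_closure_interior hg (t := 1) (by simp)
  have out' := (hφ i).start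
  have inc' := (hφ j).finish
  have hnei := he.vertex_ne i
  have hnej := he.vertex_ne j
  rw [hji] at inc inc' hnej
  simp only [sub_zero, one_smul, zero_smul, add_zero, sub_self, zero_add] at out inc
  have hess_eq : ∀ {X Y Z : Plane} {f h f' h' : ℝ[X]} {x : ℝ}, X ≠ Y →
      (he.jets hg).EndCondition X Y Z f h x → φ.EndCondition X Y Z f h x → ∀ v,
      (he.jets hg).hess Z (Y - X) v = φ.hess Z (Y - X) v := by
    intro X Y Z f h f' h' x hne h1 h2 v
    rw [normal_tangent_decomposition hne v]
    simp only [map_add, map_smul, ← h1.normal_one, ← h2.normal_one, ← h1.trace_two,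
      ← h2.trace_two]
  have a1 := hess_eq (f' := 0) (h' := 0) hnei out out'
  have a2 := hess_eq (f' := 0) (h' := 0) hnej inc inc'
  refine ⟨out.trace_zero.symm.trans out'.trace_zero, ?_, ?_⟩
  · ext v
    rw [normal_tangent_decomposition hnei v]
    simp only [map_add, map_smul, ← out.normal_zero, ← out'.normal_zero, ← out.trace_one,
      ← out'.trace_one]
  · ext v w
    obtain ⟨a, b, rfl⟩ := he.exists_combination i v
    simp only [map_add, map_smul, add_apply, smul_apply]
    rw [a1 w, a2 w]

/-- The derivative of the geometry mapping in the cross direction, along a side. -/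
theorem paramDeriv_across_side (e : MeshElement) (i : Fin e.kind.sides) (t : ℝ) :
    e.paramDeriv (e.kind.corner i + t • e.kind.along i) (e.kind.across i)
      = e.paramDeriv (e.kind.corner i) (e.kind.across i)
        + t • (((e.kind.along i).1 * (e.kind.across i).2
          + (e.kind.along i).2 * (e.kind.across i).1) • e.twist) := by
  rw [paramDeriv_add]
  simp only [Prod.smul_fst, Prod.smul_snd, smul_eq_mul]
  module

/-- The cross derivative on the parameter domain that belongs to a trace `f` and a normal
derivative `h` on a side. -/
def pulledBackCross (e : MeshElement) (i : Fin e.kind.sides) (f h : ℝ[X]) : ℝ[X] :=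
  let X := e.vertex i
  let Y := e.vertex (e.kind.next i)
  let m := e.paramDeriv (e.kind.corner i) (e.kind.across i)
  let m' := ((e.kind.along i).1 * (e.kind.across i).2
    + (e.kind.along i).2 * (e.kind.across i).1) • e.twist
  (C (normalCoeff X Y m) + C (normalCoeff X Y m') * Polynomial.X) * h
    + (C (tangentCoeff X Y m) + C (tangentCoeff X Y m') * Polynomial.X) * derivative f

theorem eval_pulledBackCross (e : MeshElement) (i : Fin e.kind.sides) (f h : ℝ[X]) (t : ℝ) :
    (e.pulledBackCross i f h).eval t
      = normalCoeff (e.vertex i) (e.vertex (e.kind.next i))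
          (e.paramDeriv (e.kind.corner i + t • e.kind.along i) (e.kind.across i)) * h.eval t
        + tangentCoeff (e.vertex i) (e.vertex (e.kind.next i))
          (e.paramDeriv (e.kind.corner i + t • e.kind.along i) (e.kind.across i))
            * (derivative f).eval t := by
  rw [paramDeriv_across_side, normalCoeff_add, tangentCoeff_add, normalCoeff_smul _ _ _ t,
    tangentCoeff_smul _ _ _ t]
  simp [pulledBackCross]
  ring

theorem natDegree_pulledBackCross_le (e : MeshElement) {p : ℕ} (hp : 5 ≤ p)
    (i : Fin e.kind.sides) {f h : ℝ[X]} (hf : f.natDegree ≤ p) (hh : h.natDegree ≤ p - 1) :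
    (e.pulledBackCross i f h).natDegree ≤ e.kind.crossDegree p := by
  have hf' : (derivative f).natDegree ≤ p - 1 := (natDegree_derivative_le f).trans (by omega)
  have hlin : ∀ (a b : ℝ) (g : ℝ[X]), g.natDegree ≤ p - 1 →
      ((C a + C b * Polynomial.X) * g).natDegree ≤ p := by
    intro a b g hg
    have : (C a + C b * Polynomial.X : ℝ[X]).natDegree ≤ 1 := by compute_degree
    exact natDegree_mul_le.trans (by omega)
  rcases e with ⟨V₁, V₂, V₃⟩ | ⟨V₁, V₂, V₃, V₄⟩
  · have h0 : ∀ X Y, normalCoeff X Y 0 = 0 := fun X Y => by simp [normalCoeff]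
    have h0' : ∀ X Y, tangentCoeff X Y 0 = 0 := fun X Y => by simp [tangentCoeff]
    simp only [pulledBackCross, twist, smul_zero, h0, h0', map_zero, zero_mul, add_zero]
    exact natDegree_add_le_of_degree_le ((natDegree_C_mul_le _ _).trans hh)
      ((natDegree_C_mul_le _ _).trans hf')
  · exact natDegree_add_le_of_degree_le (hlin _ _ _ hh) (hlin _ _ _ hf')

/-- The partial derivatives of the pull-back of a function with derivatives `φ`. -/
def pulledBackJet (e : MeshElement) (φ : JetField) (q : ℝ × ℝ) (a b : ℕ) : ℝ :=
  let x := e.param q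
  let u := e.paramDeriv q (1, 0)
  let v := e.paramDeriv q (0, 1)
  if (a, b) = (0, 0) then φ.val x
  else if (a, b) = (1, 0) then φ.grad x u
  else if (a, b) = (0, 1) then φ.grad x v
  else if (a, b) = (2, 0) then φ.hess x u u
  else if (a, b) = (1, 1) then φ.hess x u v + φ.grad x e.twist
  else φ.hess x v v

theorem paramDeriv_basis (e : MeshElement) (q w : ℝ × ℝ) :
    e.paramDeriv q w = w.1 • e.paramDeriv q (1, 0) + w.2 • e.paramDeriv q (0, 1) := by
  simp [paramDeriv_apply]

theorem jetFirst_pulledBackJet (e : MeshElement) (φ : JetField) (q w : ℝ × ℝ) :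
    CellKind.jetFirst (e.pulledBackJet φ q) w = φ.grad (e.param q) (e.paramDeriv q w) := by
  rw [paramDeriv_basis]
  simp [CellKind.jetFirst, pulledBackJet]

theorem jetSecond_pulledBackJet (e : MeshElement) (φ : JetField) (q z w : ℝ × ℝ) :
    CellKind.jetSecond (e.pulledBackJet φ q) z w
      = φ.hess (e.param q) (e.paramDeriv q z) (e.paramDeriv q w)
        + (z.1 * w.2 + z.2 * w.1) * φ.grad (e.param q) e.twist := by
  rw [paramDeriv_basis e q z, paramDeriv_basis e q w]
  have := φ.symm (e.param q) (e.paramDeriv q (1, 0)) (e.paramDeriv q (0, 1))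
  simp only [CellKind.jetSecond, pulledBackJet, map_add, map_smul, add_apply, smul_apply,
    smul_eq_mul, Prod.mk.injEq, OfNat.ofNat_ne_zero, OfNat.ofNat_ne_one, OfNat.zero_ne_ofNat,
    OfNat.one_ne_ofNat, one_ne_zero, zero_ne_one, and_true, and_false,
    and_self, if_true, if_false]
  rw [this]
  ring

/-- At an end point of a side, the pulled back trace and cross derivative match the pulled back
derivatives at the vertex. This is the compatibility of the traces of two adjacent sides. -/
theorem IsRegular.matchesJet_of_endCondition (he : e.IsRegular) {φ : JetField}
    (i : Fin e.kind.sides) {f h : ℝ[X]} {t : ℝ} {q : ℝ × ℝ}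
    (hq : q = e.kind.corner i + t • e.kind.along i)
    (H : φ.EndCondition (e.vertex i) (e.vertex (e.kind.next i)) (e.param q) f h t) :
    CellKind.MatchesJet (e.pulledBackJet φ q) (e.kind.along i) (e.kind.across i) f
      (e.pulledBackCross i f h) t := by
  have hne := he.vertex_ne i
  have hal : e.paramDeriv q (e.kind.along i) = e.vertex (e.kind.next i) - e.vertex i := by
    rw [hq]; exact e.paramDeriv_along i t
  have htw : ((e.kind.along i).1 * (e.kind.along i).2) * φ.grad (e.param q) e.twist = 0 := by
    rw [← smul_eq_mul, ← map_smul, e.along_mul_twist, map_zero]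
  have hdec := fun v => congrArg (φ.grad (e.param q)) (normal_tangent_decomposition hne v)
  have hdec2 := fun v => congrArg (φ.hess (e.param q) (e.vertex (e.kind.next i) - e.vertex i))
    (normal_tangent_decomposition hne v)
  simp only [map_add, map_smul, smul_eq_mul] at hdec hdec2
  constructor
  · simpa [pulledBackJet] using H.trace_zero
  · rw [jetFirst_pulledBackJet, hal]; exact H.trace_one
  · rw [jetSecond_pulledBackJet, hal, H.trace_two]
    linear_combination (-2) * htw
  · rw [jetFirst_pulledBackJet, hdec, eval_pulledBackCross, H.normal_zero, H.trace_one, hq]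
  · rw [jetSecond_pulledBackJet, hal, hdec2, ← smul_eq_mul (_ + _), ← map_smul, hdec, hq,
      paramDeriv_across_side, ← hq, ← H.normal_one, ← H.normal_zero, ← H.trace_one, ← H.trace_two,
      normalCoeff_add, tangentCoeff_add, normalCoeff_smul _ _ _ t, tangentCoeff_smul _ _ _ t]
    simp [pulledBackCross]
    ring

/-- A function on the closed element, given by its pull-back to the parameter domain. -/
def pushForward (e : MeshElement) {S : Finset (ℕ × ℕ)} (c : S → ℝ) (x : Plane) : ℝ :=
  bipartial S 0 0 (e.paramInv x) c

theorem IsRegular.pushForward_param (he : e.IsRegular) {S : Finset (ℕ × ℕ)} (c : S → ℝ)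
    {q : ℝ × ℝ} (hq : q ∈ e.kind.cell) : e.pushForward c (e.param q) = bipartial S 0 0 q c := by
  rw [pushForward, he.paramInv_param hq]

theorem IsRegular.contDiffOn_pushForward (he : e.IsRegular) {S : Finset (ℕ × ℕ)} (c : S → ℝ) :
    ContDiffOn ℝ 2 (e.pushForward c) e.closedRegion :=
  (contDiff_bipartial 0 0 c).comp_contDiffOn he.contDiffOn_paramInv

/-- The image of the cross direction is transversal to the side. -/
theorem IsRegular.normalCoeff_ne_zero (he : e.IsRegular) (i : Fin e.kind.sides) {t : ℝ}
    (ht : t ∈ Icc (0 : ℝ) 1) :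
    normalCoeff (e.vertex i) (e.vertex (e.kind.next i))
      (e.paramDeriv (e.kind.corner i + t • e.kind.along i) (e.kind.across i)) ≠ 0 := by
  intro h0
  have h := normal_tangent_decomposition (he.vertex_ne i)
    (e.paramDeriv (e.kind.corner i + t • e.kind.along i) (e.kind.across i))
  rw [h0, zero_smul, zero_add, ← e.paramDeriv_along i t, ← map_smul] at h
  have h2 := (he.bijective (e.kind.corner_add_smul_along_mem i ht)).1 h
  have hdet := e.kind.along_across_det i
  rw [h2] at hdet
  simp only [Prod.smul_fst, Prod.smul_snd, smul_eq_mul] at hdet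
  exact zero_ne_one (by linear_combination hdet)

/-- The pull-back of a function with given traces has the corresponding cross derivative. -/
theorem IsRegular.bideriv_across_eq (he : e.IsRegular) {g : Plane → ℝ} {S : Finset (ℕ × ℕ)}
    {c : S → ℝ} (hg : DifferentiableOn ℝ g e.closedRegion)
    (hc : ∀ q ∈ e.kind.cell, g (e.param q) = bipartial S 0 0 q c) {i : Fin e.kind.sides}
    {f h : ℝ[X]}
    (hT : HasEdgeTraces e.closedRegion g (e.vertex i) (e.vertex (e.kind.next i)) f h) {t : ℝ}
    (ht : t ∈ Icc (0 : ℝ) 1) :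
    bideriv S (e.kind.corner i + t • e.kind.along i) (e.kind.across i) c
      = (e.pulledBackCross i f h).eval t := by
  have hq := e.kind.corner_add_smul_along_mem i ht
  rw [← fderivWithin_paramDeriv hg hc hq, e.param_side, eval_pulledBackCross,
    normal_tangent_decomposition (he.vertex_ne i) (e.paramDeriv _ _)]
  rw [← hT.normal t ht, ← hT.tangent (e.segment_subset i) hg ht]
  simp only [map_add, map_smul, smul_eq_mul]
  rw [← normal_tangent_decomposition (he.vertex_ne i) (e.paramDeriv _ _)]

/-- Arbitrary data are interpolated on an element by a function whose traces and normal
derivatives on the sides are those prescribed by the data on the sides alone. -/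
theorem IsRegular.exists_interpolant (he : e.IsRegular) {p : ℕ} (hp : 5 ≤ p) (φ : JetField) :
    ∃ c : e.kind.exponents p → ℝ,
      (∀ i f h, φ.IsEdgePair p (e.vertex i) (e.vertex (e.kind.next i)) f h →
        HasEdgeTraces e.closedRegion (e.pushForward c) (e.vertex i) (e.vertex (e.kind.next i))
          f h) ∧
      ∀ m ∈ e.kind.inner p, e.pushForward c (e.param (CellKind.innerPoint p m))
        = φ.val (e.param (CellKind.innerPoint p m)) := by
  choose f h hfh using fun i =>
    JetField.exists_isEdgePair hp φ (e.vertex i) (e.vertex (e.kind.next i))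
  obtain ⟨c, h1, h2, h3⟩ := e.kind.exists_of_compatible_traces hp
    (fun i => e.pulledBackJet φ (e.kind.corner i)) f (fun i => e.pulledBackCross i (f i) (h i))
    (fun i => (hfh i).natDegree_trace)
    (fun i => e.natDegree_pulledBackCross_le hp i (hfh i).natDegree_trace (hfh i).natDegree_normal)
    (fun i => he.matchesJet_of_endCondition i (by simp) (hfh i).start)
    (fun i => he.matchesJet_of_endCondition i (by rw [CellKind.corner_next]; simp) (hfh i).finish)
    (fun m => φ.val (e.param (CellKind.innerPoint p m)))
  refine ⟨c, fun i f' h' H => ?_, fun m hm => ?_⟩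
  · obtain ⟨rfl, rfl⟩ := (hfh i).unique hp H
    have hpg : ∀ q ∈ e.kind.cell, e.pushForward c (e.param q) = _ := fun q hq =>
      he.pushForward_param c hq
    have hdiff := (he.contDiffOn_pushForward c).differentiableOn (by norm_num)
    have hval : ∀ t ∈ Icc (0 : ℝ) 1,
        e.pushForward c ((1 - t) • e.vertex i + t • e.vertex (e.kind.next i)) = (f i).eval t :=
      fun t ht => by
        rw [← e.param_side, hpg _ (e.kind.corner_add_smul_along_mem i ht), h1]
    refine ⟨hval, fun t ht => ?_⟩
    have hq := e.kind.corner_add_smul_along_mem i ht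
    have e1 := fderivWithin_paramDeriv hdiff hpg hq (e.kind.across i)
    have e2 := derivative_eq_of_eqOn (e.segment_subset i) hdiff (ContinuousLinearMap.id ℝ ℝ)
      hval ht
    rw [h2, eval_pulledBackCross, e.param_side] at e1
    have e3 := congrArg (fderivWithin ℝ (e.pushForward c) e.closedRegion
      ((1 - t) • e.vertex i + t • e.vertex (e.kind.next i))) (normal_tangent_decomposition
        (he.vertex_ne i) (e.paramDeriv (e.kind.corner i + t • e.kind.along i) (e.kind.across i)))
    rw [e1] at e3
    simp only [map_add, map_smul, smul_eq_mul, ContinuousLinearMap.id_apply] at e2 e3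
    rw [← e2] at e3
    exact (mul_left_cancel₀ (he.normalCoeff_ne_zero i ht) (add_right_cancel e3)).symm
  · rw [he.pushForward_param c (e.kind.innerPoint_mem hp hm), h3 m hm]

end MeshElement

/-! ### Local polynomials -/

namespace MeshElement

open CellKind in
theorem isLocalPolynomial_iff (e : MeshElement) (p : ℕ) (f : ℝ × ℝ → ℝ) :
    e.IsLocalPolynomial p f ↔ ∃ c : e.kind.exponents p → ℝ,
      ∀ q ∈ e.kind.cell, f q = bipartial (e.kind.exponents p) 0 0 q c := by
  have hsum : ∀ (S : Finset (ℕ × ℕ)) (P : MvPolynomial (Fin 2) ℝ),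
      (∀ d ∈ P.support, (d 0, d 1) ∈ S) → ∃ c : S → ℝ, ∀ q : ℝ × ℝ,
        MvPolynomial.eval ![q.1, q.2] P = bipartial S 0 0 q c := by
    intro S P hP
    refine ⟨fun m => P.coeff (Finsupp.single 0 m.1.1 + Finsupp.single 1 m.1.2), fun q => ?_⟩
    rw [MvPolynomial.eval_eq', bipartial_zero_zero]
    have hd : ∀ d : Fin 2 →₀ ℕ, Finsupp.single 0 (d 0) + Finsupp.single 1 (d 1) = d := by
      intro d
      ext i
      fin_cases i <;> simp
    refine Finset.sum_bij_ne_zero (fun d hd _ => ⟨(d 0, d 1), hP d hd⟩) (fun _ _ _ =>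
      Finset.mem_univ _) ?_ ?_ ?_
    · intro a ha _ b hb _ hab
      simp only [Subtype.mk.injEq, Prod.mk.injEq] at hab
      rw [← hd a, ← hd b, hab.1, hab.2]
    · intro m _ hm
      refine ⟨Finsupp.single 0 m.1.1 + Finsupp.single 1 m.1.2, ?_, ?_, ?_⟩
      · rw [MvPolynomial.mem_support_iff]
        exact right_ne_zero_of_mul hm
      · simpa [Fin.prod_univ_two, mul_comm] using hm
      · simp
    · intro d _ _
      simp only [hd, Fin.prod_univ_two, Matrix.cons_val_zero, Matrix.cons_val_one]
      ring
  have hback : ∀ (S : Finset (ℕ × ℕ)) (c : S → ℝ) (q : ℝ × ℝ),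
      MvPolynomial.eval ![q.1, q.2] (∑ m : S, MvPolynomial.monomial
        (Finsupp.single (0 : Fin 2) m.1.1 + Finsupp.single 1 m.1.2) (c m))
        = bipartial S 0 0 q c := by
    intro S c q
    rw [bipartial_zero_zero, map_sum]
    refine Finset.sum_congr rfl fun m _ => ?_
    rw [MvPolynomial.eval_monomial, Finsupp.prod_fintype _ _ (by simp)]
    simp [Fin.prod_univ_two, mul_comm]
  constructor
  · rintro ⟨P, hdeg, hP⟩
    obtain ⟨c, hc⟩ := hsum (e.kind.exponents p) P (by
      intro d hd
      rcases e with ⟨V₁, V₂, V₃⟩ | ⟨V₁, V₂, V₃, V₄⟩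
      · refine mem_lattice_tri.2 ?_
        have := (MvPolynomial.le_totalDegree hd).trans hdeg
        rw [Finsupp.sum_fintype _ _ (by simp)] at this
        simp only [Fin.sum_univ_two] at this
        simp only
        omega
      · refine mem_lattice_quad.2 ?_
        have h0 := (MvPolynomial.degreeOf_le_iff.1 hdeg.1) d hd
        have h1 := (MvPolynomial.degreeOf_le_iff.1 hdeg.2) d hd
        simp only
        omega)
    refine ⟨c, fun q hq => ?_⟩
    rw [hP q (by rwa [paramDomain_eq]), hc]
  · rintro ⟨c, hc⟩
    refine ⟨∑ m : e.kind.exponents p, MvPolynomial.monomial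
        (Finsupp.single (0 : Fin 2) m.1.1 + Finsupp.single 1 m.1.2) (c m), ?_, fun q hq => ?_⟩
    · have hle : ∀ d ∈ (∑ m : e.kind.exponents p, MvPolynomial.monomial
          (Finsupp.single (0 : Fin 2) m.1.1 + Finsupp.single 1 m.1.2) (c m)).support,
          (d 0, d 1) ∈ e.kind.exponents p := by
        intro d hd
        have := MvPolynomial.support_sum hd
        simp only [Finset.mem_biUnion] at this
        obtain ⟨m, _, hm⟩ := this
        have hdm := Finset.mem_singleton.1 (MvPolynomial.support_monomial_subset hm)
        subst hdm
        simp
      generalize (∑ m : e.kind.exponents p, MvPolynomial.monomial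
          (Finsupp.single (0 : Fin 2) m.1.1 + Finsupp.single 1 m.1.2) (c m)) = P at hle
      rcases e with ⟨V₁, V₂, V₃⟩ | ⟨V₁, V₂, V₃, V₄⟩
      · refine Finset.sup_le fun d hd => ?_
        have := mem_lattice_tri.1 (hle d hd)
        rw [Finsupp.sum_fintype _ _ (by simp)]
        simp only [Fin.sum_univ_two] at *
        omega
      · refine ⟨MvPolynomial.degreeOf_le_iff.2 fun d hd => ?_,
          MvPolynomial.degreeOf_le_iff.2 fun d hd => ?_⟩ <;>
        · have := mem_lattice_quad.1 (hle d hd)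
          simp only at this
          omega
    · rw [hback, hc q (by rwa [← paramDomain_eq])]

end MeshElement

/-! ### The mesh -/

/-- A function that has the same derivative at `x` relative to each of finitely many closed sets
that contain `x` is differentiable relative to their union. -/
theorem hasFDerivWithinAt_biUnion {ι F : Type*} [NormedAddCommGroup F] [NormedSpace ℝ F]
    {f : Plane → F} {f' : Plane →L[ℝ] F} {x : Plane} (s : Finset ι) (K : ι → Set Plane)
    (hK : ∀ i ∈ s, IsClosed (K i)) (h : ∀ i ∈ s, x ∈ K i → HasFDerivWithinAt f f' (K i) x) :
    HasFDerivWithinAt f f' (⋃ i ∈ s, K i) x := by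
  classical
  induction s using Finset.induction_on with
  | empty => simp
  | insert a s _ ih =>
    rw [Finset.set_biUnion_insert]
    refine HasFDerivWithinAt.union ?_ (ih (fun i hi => hK i (Finset.mem_insert_of_mem hi))
      fun i hi => h i (Finset.mem_insert_of_mem hi))
    by_cases hx : x ∈ K a
    · exact h a (Finset.mem_insert_self _ _) hx
    · refine HasFDerivWithinAt.of_notMem_closure ?_
      rwa [(hK a (Finset.mem_insert_self _ _)).closure_eq]

theorem continuousOn_biUnion_finset {ι F : Type*} [TopologicalSpace F]
    {f : Plane → F} (s : Finset ι) (K : ι → Set Plane)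
    (hK : ∀ i ∈ s, IsClosed (K i)) (h : ∀ i ∈ s, ContinuousOn f (K i)) :
    ContinuousOn f (⋃ i ∈ s, K i) := by
  classical
  induction s using Finset.induction_on with
  | empty => simp
  | insert a s _ ih =>
    rw [Finset.set_biUnion_insert]
    exact (h a (Finset.mem_insert_self _ _)).union_of_isClosed
      (ih (fun i hi => hK i (Finset.mem_insert_of_mem hi))
      fun i hi => h i (Finset.mem_insert_of_mem hi)) (hK a (Finset.mem_insert_self _ _))
      (isClosed_biUnion_finset fun i hi => hK i (Finset.mem_insert_of_mem hi))

theorem volume_openSegment (A B : Plane) : volume (openSegment ℝ A B) = 0 := by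
  have hne : affineSpan ℝ {A, B} ≠ ⊤ := by
    intro h
    have h1 := finrank_vectorSpan_insert_le_set ℝ ({B} : Set Plane) A
    rw [← direction_affineSpan, h, AffineSubspace.direction_top] at h1
    simp at h1
  refine measure_mono_null ?_ (Measure.addHaar_affineSubspace volume _ hne)
  refine (openSegment_subset_segment ℝ A B).trans ?_
  rw [← convexHull_pair]
  exact convexHull_subset_affineSpan _

namespace MixedMesh

open MeshElement

variable (M : MixedMesh)

/-- Every side of an element is an edge, up to its orientation. -/
theorem exists_edge_of_side {e : MeshElement} (he : e ∈ M.elements) (i : Fin e.kind.sides) :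
    ∃ E ∈ M.edges, (E = (e.vertex i, e.vertex (e.kind.next i)) ∨
      E = (e.vertex (e.kind.next i), e.vertex i)) ∧
      openSegment ℝ E.1 E.2 = openSegment ℝ (e.vertex i) (e.vertex (e.kind.next i)) := by
  rcases M.element_sides e he (e.vertex i, e.vertex (e.kind.next i))
    (by rw [sides_eq]; exact mem_range_self i) with h | h
  · exact ⟨_, h, .inl rfl, rfl⟩
  · exact ⟨_, h, .inr rfl, openSegment_symm ℝ _ _⟩

theorem vertex_mem_vertices {e : MeshElement} (he : e ∈ M.elements) (i : Fin e.kind.sides) :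
    e.vertex i ∈ M.vertices := by
  obtain ⟨E, hE, rfl | rfl, _⟩ := M.exists_edge_of_side he i
  · exact (M.edge_endpoints _ hE).1
  · exact (M.edge_endpoints _ hE).2

/-- A point of a closed element is interior, or lies in an open side, or is a vertex. -/
theorem mem_closedRegion_cases {e : MeshElement} (he : e ∈ M.elements) {x : Plane}
    (hx : x ∈ e.closedRegion) : x ∈ e.openRegion ∨
      (∃ i, x ∈ openSegment ℝ (e.vertex i) (e.vertex (e.kind.next i))) ∨ ∃ i, x = e.vertex i := by
  rcases (M.element_regular e he).mem_openRegion_or_mem_side hx with h | ⟨i, t, ht, rfl⟩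
  · exact .inl h
  · right
    rcases eq_or_lt_of_le ht.1 with rfl | h0
    · exact .inr ⟨i, by simp⟩
    rcases eq_or_lt_of_le ht.2 with rfl | h1
    · exact .inr ⟨e.kind.next i, by simp⟩
    · exact .inl ⟨i, 1 - t, t, by linarith, h0, by ring, rfl⟩

theorem eq_vertex_of_mem_vertices {e : MeshElement} (he : e ∈ M.elements) {x : Plane}
    (hx : x ∈ e.closedRegion) (hv : x ∈ M.vertices) : ∃ i, x = e.vertex i := by
  rcases M.mem_closedRegion_cases he hx with h | ⟨i, h⟩ | h
  · exact absurd h (M.elements_vertices_disjoint e he x hv)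
  · obtain ⟨E, hE, _, hseg⟩ := M.exists_edge_of_side he i
    rw [← hseg] at h
    exact absurd h (M.edges_vertices_disjoint E hE x hv)
  · exact h

/-- An open edge that meets a closed element is one of its sides, as the parts of the mesh are
disjoint. -/
theorem mem_openSegment_of_edge {e : MeshElement} (he : e ∈ M.elements) {x : Plane}
    (hx : x ∈ e.closedRegion) {E : Plane × Plane} (hE : E ∈ M.edges)
    (hxE : x ∈ openSegment ℝ E.1 E.2) : ∃ i, E = (e.vertex i, e.vertex (e.kind.next i)) ∨
      E = (e.vertex (e.kind.next i), e.vertex i) := by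
  rcases M.mem_closedRegion_cases he hx with h | ⟨i, h⟩ | ⟨i, rfl⟩
  · exact absurd hxE (disjoint_left.1 (M.elements_edges_disjoint e he E hE) h)
  · obtain ⟨E', hE', hor, hseg⟩ := M.exists_edge_of_side he i
    rw [← hseg] at h
    have : E = E' := by
      by_contra hne
      exact disjoint_left.1 (M.edges_disjoint E hE E' hE' hne) hxE h
    exact ⟨i, this ▸ hor⟩
  · exact absurd hxE (M.edges_vertices_disjoint E hE _ (M.vertex_mem_vertices he i))

/-- The edges and vertices are a null set, so that the elements are dense in the open domain. -/
theorem closure_domain_eq : closure M.domain = ⋃ e ∈ M.elements, e.closedRegion := by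
  have hclosed : IsClosed (⋃ e ∈ M.elements, e.closedRegion) :=
    isClosed_biUnion_finset fun e _ => e.isCompact_closedRegion.isClosed
  refine (closure_minimal ?_ hclosed).antisymm ?_
  · have hopen : IsOpen (M.domain \ ⋃ e ∈ M.elements, e.closedRegion) :=
      M.isOpen_domain.sdiff hclosed
    have hnull : volume (M.domain \ ⋃ e ∈ M.elements, e.closedRegion) = 0 := by
      refine measure_mono_null
        (t := (⋃ E ∈ M.edges, openSegment ℝ E.1 E.2) ∪ (M.vertices : Set Plane)) ?_ ?_
      · rintro x ⟨hx, hx'⟩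
        have hcl := subset_closure hx
        rw [M.closure_domain] at hcl
        rcases hcl with (h | h) | h
        · exact absurd (iUnion₂_mono (fun e _ => interior_subset) h) hx'
        · exact .inl h
        · exact .inr h
      · rw [measure_union_null_iff]
        exact ⟨(measure_biUnion_null_iff M.edges.countable_toSet).2
          fun E _ => volume_openSegment _ _, M.vertices.finite_toSet.measure_zero _⟩
    have := (hopen.measure_eq_zero_iff volume).1 hnull
    exact sdiff_eq_empty.1 this
  · refine iUnion₂_subset fun e he => ?_
    rw [← (M.element_regular e he).closure_openRegion]
    refine closure_minimal ?_ isClosed_closure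
    rw [M.closure_domain]
    exact fun x hx => .inl (.inl (mem_biUnion he hx))

theorem closedRegion_subset {e : MeshElement} (he : e ∈ M.elements) :
    e.closedRegion ⊆ closure M.domain := by
  rw [M.closure_domain_eq]; exact subset_biUnion_of_mem (u := fun e => closedRegion e) he

theorem uniqueDiffOn_closure_domain : UniqueDiffOn ℝ (closure M.domain) := by
  intro x hx
  rw [M.closure_domain_eq, mem_iUnion₂] at hx
  obtain ⟨e, he, hxe⟩ := hx
  exact ((M.element_regular e he).uniqueDiffOn x hxe).mono (M.closedRegion_subset he)

/-- Every edge is a side of an element, up to its orientation. -/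
theorem exists_side_of_edge {E : Plane × Plane} (hE : E ∈ M.edges) :
    ∃ e ∈ M.elements, ∃ i, E = (e.vertex i, e.vertex (e.kind.next i)) ∨
      E = (e.vertex (e.kind.next i), e.vertex i) := by
  have hx : (1 / 2 : ℝ) • E.1 + (1 / 2 : ℝ) • E.2 ∈ openSegment ℝ E.1 E.2 :=
    ⟨1 / 2, 1 / 2, by norm_num, by norm_num, by norm_num, rfl⟩
  have hcl : (1 / 2 : ℝ) • E.1 + (1 / 2 : ℝ) • E.2 ∈ closure M.domain := by
    rw [M.closure_domain]
    exact .inl (.inr (mem_biUnion hE hx))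
  rw [M.closure_domain_eq, mem_iUnion₂] at hcl
  obtain ⟨e, he, hxe⟩ := hcl
  exact ⟨e, he, M.mem_openSegment_of_edge he hxe hE hx⟩

/-- Two elements meet in common vertices and in common sides. -/
theorem inter_cases {e e' : MeshElement} (he : e ∈ M.elements) (he' : e' ∈ M.elements)
    (hne : e ≠ e') {x : Plane} (hx : x ∈ e.closedRegion) (hx' : x ∈ e'.closedRegion) :
    (∃ i j, x = e.vertex i ∧ x = e'.vertex j) ∨
    ∃ i j, x ∈ openSegment ℝ (e.vertex i) (e.vertex (e.kind.next i)) ∧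
      ((e'.vertex j = e.vertex i ∧ e'.vertex (e'.kind.next j) = e.vertex (e.kind.next i)) ∨
       (e'.vertex j = e.vertex (e.kind.next i) ∧ e'.vertex (e'.kind.next j) = e.vertex i)) := by
  rcases M.mem_closedRegion_cases he hx with h | ⟨i, h⟩ | ⟨i, rfl⟩
  · exfalso
    rw [← (M.element_regular e' he').closure_openRegion] at hx'
    obtain ⟨y, hy, hy'⟩ := mem_closure_iff.1 hx' _ isOpen_interior h
    exact disjoint_left.1 (M.elements_disjoint e he e' he' hne) hy hy'
  · right
    obtain ⟨E, hE, hor, hseg⟩ := M.exists_edge_of_side he i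
    obtain ⟨j, hj⟩ := M.mem_openSegment_of_edge he' hx' hE (hseg ▸ h)
    refine ⟨i, j, h, ?_⟩
    rcases hor with rfl | rfl <;> rcases hj with hj | hj <;> simp only [Prod.mk.injEq] at hj
    · exact .inl ⟨hj.1.symm, hj.2.symm⟩
    · exact .inr ⟨hj.2.symm, hj.1.symm⟩
    · exact .inr ⟨hj.1.symm, hj.2.symm⟩
    · exact .inl ⟨hj.2.symm, hj.1.symm⟩
  · obtain ⟨j, hj⟩ := M.eq_vertex_of_mem_vertices he' hx' (M.vertex_mem_vertices he i)
    exact .inl ⟨i, j, rfl, hj⟩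

end MixedMesh

/-! ### Interpolation in the Argyris-like space -/

namespace MeshElement

open Polynomial

/-- Reversing the edge changes the sign of its unit normal. -/
theorem HasEdgeTraces.of_reverse {K : Set Plane} {g : Plane → ℝ} {X Y : Plane} {f h : ℝ[X]}
    (H : HasEdgeTraces K g Y X (f.comp (1 - Polynomial.X)) (-h.comp (1 - Polynomial.X))) :
    HasEdgeTraces K g X Y f h := by
  have hpt : ∀ t : ℝ, (1 - (1 - t)) • Y + (1 - t) • X = (1 - t) • X + t • Y := fun t => by module
  have hI : ∀ t ∈ Icc (0 : ℝ) 1, 1 - t ∈ Icc (0 : ℝ) 1 := fun t ht =>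
    ⟨by linarith [ht.2], by linarith [ht.1]⟩
  constructor <;> intro t ht
  · have := H.value (1 - t) (hI t ht)
    rw [hpt] at this
    simpa using this
  · have := H.normal (1 - t) (hI t ht)
    rw [hpt, unitNormal_swap, map_neg] at this
    simpa using this

end MeshElement

namespace MixedMesh

open MeshElement Polynomial

variable (M : MixedMesh)

/-- Two functions that interpolate the same data on two elements agree, together with their
derivatives of first order, where the elements meet. -/
theorem eq_and_fderivWithin_eq {p : ℕ} (hp : 5 ≤ p) (φ : JetField) {e e' : MeshElement}
    (he : e ∈ M.elements) (he' : e' ∈ M.elements) {g g' : Plane → ℝ}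
    (hg : ContDiffOn ℝ 2 g e.closedRegion) (hg' : ContDiffOn ℝ 2 g' e'.closedRegion)
    (hT : ∀ i f h, φ.IsEdgePair p (e.vertex i) (e.vertex (e.kind.next i)) f h →
        HasEdgeTraces e.closedRegion g (e.vertex i) (e.vertex (e.kind.next i)) f h)
    (hT' : ∀ i f h, φ.IsEdgePair p (e'.vertex i) (e'.vertex (e'.kind.next i)) f h →
        HasEdgeTraces e'.closedRegion g' (e'.vertex i) (e'.vertex (e'.kind.next i)) f h)
    (hne : e ≠ e') {x : Plane} (hx : x ∈ e.closedRegion) (hx' : x ∈ e'.closedRegion) :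
    g x = g' x ∧ fderivWithin ℝ g e.closedRegion x = fderivWithin ℝ g' e'.closedRegion x := by
  have hreg := M.element_regular e he
  have hreg' := M.element_regular e' he'
  rcases M.inter_cases he he' hne hx hx' with ⟨i, j, h1, h2⟩ | ⟨i, j, hxi, hij⟩
  · choose f h hfh using fun i =>
      JetField.exists_isEdgePair hp φ (e.vertex i) (e.vertex (e.kind.next i))
    choose f' h' hfh' using fun i =>
      JetField.exists_isEdgePair hp φ (e'.vertex i) (e'.vertex (e'.kind.next i))
    obtain ⟨a1, a2, _⟩ := hreg.jets_vertex_eq hg f h hfh (fun i => hT i _ _ (hfh i)) i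
    obtain ⟨b1, b2, _⟩ := hreg'.jets_vertex_eq hg' f' h' hfh' (fun i => hT' i _ _ (hfh' i)) j
    rw [← h1] at a1 a2
    rw [← h2] at b1 b2
    simp only [JetField.ofFunction, if_pos hx, if_pos hx'] at a1 a2 b1 b2
    exact ⟨a1.trans b1.symm, a2.trans b2.symm⟩
  · obtain ⟨f, h, hfh⟩ :=
      JetField.exists_isEdgePair hp φ (e.vertex i) (e.vertex (e.kind.next i))
    have H := hT i f h hfh
    have hseg' : segment ℝ (e.vertex i) (e.vertex (e.kind.next i)) ⊆ e'.closedRegion := by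
      rcases hij with ⟨h1, h2⟩ | ⟨h1, h2⟩
      · rw [← h1, ← h2]; exact e'.segment_subset j
      · rw [← h1, ← h2, segment_symm]; exact e'.segment_subset j
    have H' : HasEdgeTraces e'.closedRegion g' (e.vertex i) (e.vertex (e.kind.next i)) f h := by
      rcases hij with ⟨h1, h2⟩ | ⟨h1, h2⟩
      · rw [← h1, ← h2] at hfh ⊢
        exact hT' j f h hfh
      · have := hfh.reverse hp
        rw [← h1, ← h2] at this ⊢
        exact (hT' j _ _ this).of_reverse
    obtain ⟨a, t, ha, ht, hat, rfl⟩ := hxi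
    obtain rfl : a = 1 - t := by linarith
    have htI : t ∈ Icc (0 : ℝ) 1 := ⟨ht.le, by linarith⟩
    refine ⟨(H.value t htI).trans (H'.value t htI).symm, ?_⟩
    ext v
    rw [normal_tangent_decomposition (hreg.vertex_ne i) v]
    simp only [map_add, map_smul]
    rw [H.normal t htI, H'.normal t htI,
      H.tangent (e.segment_subset i) (hg.differentiableOn (by norm_num)) htI,
      H'.tangent hseg' (hg'.differentiableOn (by norm_num)) htI]

/-- Arbitrary data are interpolated by a member of the Argyris-like space. The interpolants of the
elements fit together since their traces and normal derivatives on an edge depend only on the data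
on this edge. -/
theorem exists_mem_argyrisSpace {p : ℕ} (hp : 5 ≤ p) (φ : JetField) :
    ∃ Φ ∈ M.argyrisSpace p, ∀ e ∈ M.elements, ∃ g : Plane → ℝ, EqOn Φ g e.closedRegion ∧
      ContDiffOn ℝ 2 g e.closedRegion ∧
      (∀ i f h, φ.IsEdgePair p (e.vertex i) (e.vertex (e.kind.next i)) f h →
        HasEdgeTraces e.closedRegion g (e.vertex i) (e.vertex (e.kind.next i)) f h) ∧
      ∀ m ∈ e.kind.inner p, g (e.param (CellKind.innerPoint p m))
        = φ.val (e.param (CellKind.innerPoint p m)) := by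
  classical
  choose! c hT hin using fun (e : MeshElement) (he : e ∈ M.elements) =>
    (M.element_regular e he).exists_interpolant hp φ
  set g : MeshElement → Plane → ℝ := fun e => e.pushForward (c e) with hgdef
  have hg : ∀ e ∈ M.elements, ContDiffOn ℝ 2 (g e) e.closedRegion := fun e he =>
    (M.element_regular e he).contDiffOn_pushForward (c e)
  have hagree : ∀ e ∈ M.elements, ∀ e' ∈ M.elements, ∀ x ∈ e.closedRegion, x ∈ e'.closedRegion →
      g e x = g e' x ∧ fderivWithin ℝ (g e) e.closedRegion x
        = fderivWithin ℝ (g e') e'.closedRegion x := by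
    intro e he e' he' x hx hx'
    by_cases hne : e = e'
    · subst hne; exact ⟨rfl, rfl⟩
    · exact M.eq_and_fderivWithin_eq hp φ he he' (hg e he) (hg e' he') (hT e he) (hT e' he') hne
        hx hx'
  -- the interpolants and their gradients are glued by a choice of an element at every point
  let sel : Plane → MeshElement := fun x =>
    if h : ∃ e ∈ M.elements, x ∈ e.closedRegion then h.choose else .tri 0 0 0
  have hsel : ∀ e ∈ M.elements, ∀ x ∈ e.closedRegion,
      sel x ∈ M.elements ∧ x ∈ (sel x).closedRegion := by
    intro e he x hx
    have h : ∃ e ∈ M.elements, x ∈ e.closedRegion := ⟨e, he, hx⟩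
    have : sel x = h.choose := dif_pos h
    rw [this]
    exact h.choose_spec
  let Φ : Plane → ℝ := fun x => g (sel x) x
  let D : Plane → Plane →L[ℝ] ℝ := fun x => fderivWithin ℝ (g (sel x)) (sel x).closedRegion x
  have hΦ : ∀ e ∈ M.elements, EqOn Φ (g e) e.closedRegion := fun e he x hx =>
    (hagree _ (hsel e he x hx).1 e he x (hsel e he x hx).2 hx).1
  have hD : ∀ e ∈ M.elements, EqOn D (fderivWithin ℝ (g e) e.closedRegion) e.closedRegion :=
    fun e he x hx => (hagree _ (hsel e he x hx).1 e he x (hsel e he x hx).2 hx).2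
  have hclosed : ∀ e ∈ M.elements, IsClosed e.closedRegion := fun e _ =>
    e.isCompact_closedRegion.isClosed
  have hderiv : ∀ x, HasFDerivWithinAt Φ (D x) (closure M.domain) x := by
    intro x
    rw [M.closure_domain_eq]
    refine hasFDerivWithinAt_biUnion _ _ hclosed fun e he hx => ?_
    rw [hD e he hx]
    exact (((hg e he).differentiableOn (by norm_num)) x hx).hasFDerivWithinAt.congr'
      (fun y hy => hΦ e he hy) hx
  have hfD : ∀ x ∈ closure M.domain, fderivWithin ℝ Φ (closure M.domain) x = D x := fun x hx =>
    (hderiv x).fderivWithin (M.uniqueDiffOn_closure_domain x hx)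
  have hDg : ∀ e ∈ M.elements, ContDiffOn ℝ 1 (fderivWithin ℝ (g e) e.closedRegion)
      e.closedRegion := fun e he =>
    (hg e he).fderivWithin (M.element_regular e he).uniqueDiffOn (by norm_num)
  refine ⟨Φ, ⟨?_, ?_, ?_, ?_⟩, fun e he => ⟨g e, hΦ e he, hg e he, hT e he, hin e he⟩⟩
  · rw [show (1 : WithTop ℕ∞) = 0 + 1 by norm_num,
      contDiffOn_succ_iff_fderivWithin M.uniqueDiffOn_closure_domain]
    refine ⟨fun x _ => (hderiv x).differentiableWithinAt, by simp, ?_⟩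
    rw [contDiffOn_zero]
    refine ContinuousOn.congr ?_ hfD
    rw [M.closure_domain_eq]
    exact continuousOn_biUnion_finset _ _ hclosed fun e he =>
      (hDg e he).continuousOn.congr (hD e he)
  · intro e he
    rw [isLocalPolynomial_iff]
    refine ⟨c e, fun q hq => ?_⟩
    rw [Function.comp_apply, hΦ e he (e.param_mem hq)]
    exact (M.element_regular e he).pushForward_param (c e) hq
  · intro V hV
    by_cases hVc : V ∈ closure M.domain
    swap
    · exact (HasFDerivWithinAt.of_notMem_closure (f' := 0)
        (by rwa [closure_closure])).differentiableWithinAt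
    -- at a vertex the gradients of all elements have the second derivative given by the data
    have : HasFDerivWithinAt D (φ.hess V) (closure M.domain) V := by
      rw [M.closure_domain_eq]
      refine hasFDerivWithinAt_biUnion _ _ hclosed fun e he hx => ?_
      obtain ⟨i, hi⟩ := M.eq_vertex_of_mem_vertices he hx hV
      have hreg := M.element_regular e he
      choose f h hfh using fun i =>
        JetField.exists_isEdgePair hp φ (e.vertex i) (e.vertex (e.kind.next i))
      obtain ⟨_, _, a3⟩ := hreg.jets_vertex_eq (hg e he) f h hfh
        (fun i => hT e he i _ _ (hfh i)) i
      rw [← hi] at a3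
      simp only [JetField.ofFunction, if_pos hx] at a3
      rw [← a3]
      exact (((hDg e he).differentiableOn (by norm_num)) V hx).hasFDerivWithinAt.congr'
        (fun y hy => hD e he hy) hx
    exact (this.congr' hfD hVc).differentiableWithinAt
  · intro E hE
    obtain ⟨e, he, i, hEi⟩ := M.exists_side_of_edge hE
    obtain ⟨f, h, hfh⟩ :=
      JetField.exists_isEdgePair hp φ (e.vertex i) (e.vertex (e.kind.next i))
    have hfh' := hfh.reverse hp
    have H := hT e he i f h hfh
    have key : ∃ f h : ℝ[X], h.natDegree ≤ p - 1 ∧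
        HasEdgeTraces e.closedRegion (g e) E.1 E.2 f h := by
      rcases hEi with rfl | rfl
      · exact ⟨f, h, hfh.natDegree_normal, H⟩
      · refine ⟨f.comp (1 - Polynomial.X), -h.comp (1 - Polynomial.X),
          hfh'.natDegree_normal, HasEdgeTraces.of_reverse ?_⟩
        have e1 : ∀ f : ℝ[X], (f.comp (1 - Polynomial.X)).comp (1 - Polynomial.X) = f := fun f => by
          rw [comp_assoc]; simp
        rw [neg_comp, neg_neg, e1, e1]
        exact H
    have hseg : segment ℝ E.1 E.2 ⊆ e.closedRegion := by
      rcases hEi with rfl | rfl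
      · exact e.segment_subset i
      · rw [segment_symm]; exact e.segment_subset i
    obtain ⟨f', h', hdeg, H'⟩ := key
    refine ⟨h', hdeg, fun v hv => ?_⟩
    have hmem : (1 - v) • E.1 + v • E.2 ∈ e.closedRegion :=
      hseg ⟨1 - v, v, by linarith [hv.2], hv.1.le, by ring, rfl⟩
    rw [dirDerivWithin, hfD _ (M.closedRegion_subset he hmem), hD e he hmem]
    exact H'.normal v (Ioo_subset_Icc_self hv)

end MixedMesh

/-! ### Partial derivatives in the plane -/

theorem plane_basis (v : Plane) : v = v 0 • (!₂[1, 0] : Plane) + v 1 • (!₂[0, 1] : Plane) := by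
  ext i
  fin_cases i <;> simp

theorem norm_basis_zero : ‖(!₂[1, 0] : Plane)‖ = 1 := by
  rw [EuclideanSpace.norm_eq]; simp

theorem norm_basis_one : ‖(!₂[0, 1] : Plane)‖ = 1 := by
  rw [EuclideanSpace.norm_eq]; simp

theorem abs_apply_zero_le (v : Plane) : |v 0| ≤ ‖v‖ := PiLp.norm_apply_le v 0

theorem abs_apply_one_le (v : Plane) : |v 1| ≤ ‖v‖ := PiLp.norm_apply_le v 1

/-- The partial derivatives of order at most two that belong to the data `φ`, indexed by
`(0, 0)`, `(1, 0)`, `(0, 1)`, `(2, 0)`, `(1, 1)` and `(0, 2)`; the last value is repeated for all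
other indices. -/
def JetField.coord (φ : JetField) (x : Plane) : ℕ × ℕ → ℝ
  | (0, 0) => φ.val x
  | (1, 0) => φ.grad x !₂[1, 0]
  | (0, 1) => φ.grad x !₂[0, 1]
  | (2, 0) => φ.hess x !₂[1, 0] !₂[1, 0]
  | (1, 1) => φ.hess x !₂[1, 0] !₂[0, 1]
  | _ => φ.hess x !₂[0, 1] !₂[0, 1]

theorem Nat.add_le_two_cases {a b : ℕ} (h : a + b ≤ 2) :
    (a, b) = (0, 0) ∨ (a, b) = (1, 0) ∨ (a, b) = (0, 1) ∨ (a, b) = (2, 0) ∨ (a, b) = (1, 1) ∨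
      (a, b) = (0, 2) := by
  simp only [Prod.mk.injEq]
  omega

theorem dirDerivWithin_dirDerivWithin {K : Set Plane} {g : Plane → ℝ} {x : Plane}
    (hg : DifferentiableWithinAt ℝ (fderivWithin ℝ g K) K x) (hK : UniqueDiffWithinAt ℝ K x)
    (v w : Plane) : dirDerivWithin K v (dirDerivWithin K w g) x
      = fderivWithin ℝ (fderivWithin ℝ g K) K x v w := by
  have : HasFDerivWithinAt (dirDerivWithin K w g) _ K x :=
    (ContinuousLinearMap.apply ℝ ℝ w).hasFDerivAt.comp_hasFDerivWithinAt x hg.hasFDerivWithinAt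
  rw [dirDerivWithin, this.fderivWithin hK]
  rfl

theorem partialWithin_eq_coord {K : Set Plane} {g : Plane → ℝ} (hK : UniqueDiffOn ℝ K)
    (hK' : K ⊆ closure (interior K)) (hg : ContDiffOn ℝ 2 g K) {x : Plane} (hx : x ∈ K) {a b : ℕ}
    (hab : a + b ≤ 2) :
    partialWithin K a b g x = (JetField.ofFunction K g hK hK' hg).coord x (a, b) := by
  have hD : DifferentiableWithinAt ℝ (fderivWithin ℝ g K) K x :=
    (hg.fderivWithin hK (m := 1) (by norm_num)).differentiableOn (by norm_num) x hx
  have h2 := dirDerivWithin_dirDerivWithin hD (hK x hx)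
  rcases Nat.add_le_two_cases hab with h | h | h | h | h | h <;>
    rw [h] <;> obtain ⟨rfl, rfl⟩ := Prod.mk.inj h <;>
    simp only [JetField.coord, JetField.ofFunction, if_pos hx]
  · rfl
  · rfl
  · rfl
  · exact h2 _ _
  · exact h2 _ _
  · exact h2 _ _

namespace JetField

variable {φ ψ : JetField} {x : Plane}

theorem grad_eq_coord (φ : JetField) (x v : Plane) :
    φ.grad x v = v 0 * φ.coord x (1, 0) + v 1 * φ.coord x (0, 1) := by
  conv_lhs => rw [plane_basis v]
  simp [coord]

theorem hess_eq_coord (φ : JetField) (x v w : Plane) :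
    φ.hess x v w = v 0 * w 0 * φ.coord x (2, 0) + (v 0 * w 1 + v 1 * w 0) * φ.coord x (1, 1)
      + v 1 * w 1 * φ.coord x (0, 2) := by
  conv_lhs => rw [plane_basis v, plane_basis w]
  simp only [map_add, map_smul, add_apply, smul_apply, smul_eq_mul, coord]
  rw [φ.symm x !₂[0, 1] !₂[1, 0]]
  ring

/-- The partial derivatives of order at most two at a point determine the data there. -/
theorem eq_of_coord_eq
    (h : ∀ a b : ℕ, a + b ≤ 2 → φ.coord x (a, b) = ψ.coord x (a, b)) :
    φ.val x = ψ.val x ∧ φ.grad x = ψ.grad x ∧ φ.hess x = ψ.hess x := by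
  refine ⟨h 0 0 (by norm_num), ?_, ?_⟩
  · ext v
    rw [grad_eq_coord, grad_eq_coord, h 1 0 (by norm_num), h 0 1 (by norm_num)]
  · ext v w
    rw [hess_eq_coord, hess_eq_coord, h 2 0 le_rfl, h 1 1 le_rfl, h 0 2 le_rfl]

theorem coord_congr (h0 : φ.val x = ψ.val x) (h1 : φ.grad x = ψ.grad x)
    (h2 : φ.hess x = ψ.hess x) (ab : ℕ × ℕ) : φ.coord x ab = ψ.coord x ab := by
  unfold coord
  split <;> simp only [h0, h1, h2]

theorem boundedOn_of_coord {K : Set Plane} {M : ℝ} (hM : 0 ≤ M)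
    (h : ∀ x ∈ K, ∀ a b : ℕ, a + b ≤ 2 → |φ.coord x (a, b)| ≤ M) : φ.BoundedOn K (4 * M) := by
  have hle : ∀ v : Plane, |v 0| ≤ ‖v‖ ∧ |v 1| ≤ ‖v‖ := fun v =>
    ⟨abs_apply_zero_le v, abs_apply_one_le v⟩
  refine ⟨fun x hx => (h x hx 0 0 (by norm_num)).trans (by linarith), fun x hx v => ?_,
    fun x hx v w => ?_⟩
  · rw [grad_eq_coord]
    have h1 := mul_le_mul (hle v).1 (h x hx 1 0 (by norm_num)) (abs_nonneg _) (norm_nonneg v)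
    have h2 := mul_le_mul (hle v).2 (h x hx 0 1 (by norm_num)) (abs_nonneg _) (norm_nonneg v)
    refine (abs_add_le _ _).trans ?_
    rw [abs_mul, abs_mul]
    nlinarith [norm_nonneg v, mul_nonneg (norm_nonneg v) hM]
  · have key : ∀ {r s t : ℝ}, |r| ≤ ‖v‖ → |s| ≤ ‖w‖ → |t| ≤ M →
        |r * s * t| ≤ ‖v‖ * ‖w‖ * M := fun hr hs ht => by
      rw [abs_mul, abs_mul]
      gcongr
    have e1 := key (hle v).1 (hle w).1 (h x hx 2 0 le_rfl)
    have e2 := key (hle v).1 (hle w).2 (h x hx 1 1 le_rfl)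
    have e3 := key (hle v).2 (hle w).1 (h x hx 1 1 le_rfl)
    have e4 := key (hle v).2 (hle w).2 (h x hx 0 2 le_rfl)
    rw [hess_eq_coord, abs_le]
    rw [abs_le] at e1 e2 e3 e4
    constructor <;> linarith

theorem BoundedOn.coord_le {K : Set Plane} {M : ℝ} (h : φ.BoundedOn K M) (hx : x ∈ K)
    (ab : ℕ × ℕ) : |φ.coord x ab| ≤ M := by
  have h1 := h.grad x hx
  have h2 := h.hess x hx
  unfold JetField.coord
  split
  · exact h.val x hx
  · simpa [norm_basis_zero] using h1 !₂[1, 0]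
  · simpa [norm_basis_one] using h1 !₂[0, 1]
  · simpa [norm_basis_zero] using h2 !₂[1, 0] !₂[1, 0]
  · simpa [norm_basis_zero, norm_basis_one] using h2 !₂[1, 0] !₂[0, 1]
  · simpa [norm_basis_one] using h2 !₂[0, 1] !₂[0, 1]

end JetField

/-! ### The local interpolant -/

namespace MeshElement

open Polynomial

variable {e : MeshElement} {p : ℕ}

/-- The index sets `interiorIndices` and `inner` differ by a shift by `(2, 2)`. -/
theorem forall_interiorIndices_iff {P : Plane → Prop} :
    (∀ m ∈ e.interiorIndices p, P (e.pointQ p m)) ↔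
      ∀ m ∈ e.kind.inner p, P (e.param (CellKind.innerPoint p m)) := by
  have key : ∀ m : ℕ × ℕ, (m.1 + 2, m.2 + 2) ∈ e.interiorIndices p ↔ m ∈ e.kind.inner p := by
    intro m
    rcases e with ⟨V₁, V₂, V₃⟩ | ⟨V₁, V₂, V₃, V₄⟩
    · change _ ↔ m ∈ CellKind.tri.lattice (p - 5)
      rw [CellKind.mem_lattice_tri]
      simp only [interiorIndices, mem_ofPred_eq]
      omega
    · change _ ↔ m ∈ CellKind.quad.lattice (p - 3)
      rw [CellKind.mem_lattice_quad]
      simp only [interiorIndices, mem_ofPred_eq]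
      omega
  have ge : ∀ m ∈ e.interiorIndices p, 2 ≤ m.1 ∧ 2 ≤ m.2 := by
    intro m hm
    rcases e with ⟨V₁, V₂, V₃⟩ | ⟨V₁, V₂, V₃, V₄⟩
    · exact ⟨hm.1, hm.2.1⟩
    · exact ⟨hm.1, hm.2.2.1⟩
  constructor
  · intro h m hm
    exact h _ ((key m).2 hm)
  · rintro h ⟨a, b⟩ hm
    obtain ⟨h1, h2⟩ := ge _ hm
    obtain ⟨a, rfl⟩ := Nat.exists_eq_add_of_le' h1
    obtain ⟨b, rfl⟩ := Nat.exists_eq_add_of_le' h2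
    exact h (a, b) ((key (a, b)).1 hm)

/-- The interpolation conditions in terms of traces and normal derivatives on the sides. -/
theorem IsRegular.isEdgePair_of_interpolates (he : e.IsRegular) (hp : 5 ≤ p) {ψ g : Plane → ℝ}
    (hψ : ContDiffOn ℝ 2 ψ e.closedRegion) (hg : ContDiffOn ℝ 2 g e.closedRegion)
    (H : e.Interpolates p ψ g) (i : Fin e.kind.sides) {f h : ℝ[X]} (hf : f.natDegree ≤ p)
    (hh : h.natDegree ≤ p - 1)
    (hT : HasEdgeTraces e.closedRegion g (e.vertex i) (e.vertex (e.kind.next i)) f h) :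
    (he.jets hψ).IsEdgePair p (e.vertex i) (e.vertex (e.kind.next i)) f h := by
  have hv : ∀ j, (he.jets hg).val (e.vertex j) = (he.jets hψ).val (e.vertex j) ∧
      (he.jets hg).grad (e.vertex j) = (he.jets hψ).grad (e.vertex j) ∧
      (he.jets hg).hess (e.vertex j) = (he.jets hψ).hess (e.vertex j) := fun j =>
    JetField.eq_of_coord_eq fun a b hab => by
      rw [← partialWithin_eq_coord _ _ _ (e.vertex_mem j) hab,
        ← partialWithin_eq_coord _ _ _ (e.vertex_mem j) hab]
      exact H.vertex _ (by rw [corners_eq]; exact mem_range_self j) a b hab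
  have hend : ∀ {j : Fin e.kind.sides} {X Y : Plane} {t : ℝ},
      (he.jets hg).EndCondition X Y (e.vertex j) f h t →
        (he.jets hψ).EndCondition X Y (e.vertex j) f h t := by
    intro j X Y t a
    obtain ⟨h0, h1, h2⟩ := hv j
    exact ⟨a.trace_zero.trans h0, a.trace_one.trans (by rw [h1]), a.trace_two.trans (by rw [h2]),
      a.normal_zero.trans (by rw [h1]), a.normal_one.trans (by rw [h2])⟩
  have hside : (e.vertex i, e.vertex (e.kind.next i)) ∈ e.sides := by
    rw [sides_eq]; exact mem_range_self i
  have hpt : ∀ t ∈ Icc (0 : ℝ) 1,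
      (1 - t) • e.vertex i + t • e.vertex (e.kind.next i) ∈ e.closedRegion := fun t ht =>
    e.segment_subset i ⟨1 - t, t, by linarith [ht.2], ht.1, by ring, rfl⟩
  refine ⟨hf, hh, hend ?_, hend ?_, fun t ht => ?_, fun t ht => ?_⟩
  · simpa using hT.endCondition (e.segment_subset i) he.uniqueDiffOn
      he.subset_closure_interior hg (t := 0) (by simp)
  · simpa using hT.endCondition (e.segment_subset i) he.uniqueDiffOn
      he.subset_closure_interior hg (t := 1) (by simp)
  · have htI := Ioo_subset_Icc_self (nodesR_subset hp ht).1
    simp only [nodesR, Finset.mem_image, Finset.mem_Icc] at ht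
    obtain ⟨l, ⟨h1, h2⟩, rfl⟩ := ht
    have := H.edge_value _ hside l h1 h2
    rw [pointR_eq hp, hT.value _ htI] at this
    rw [this]
    simp only [JetField.ofFunction, if_pos (hpt _ htI)]
  · have htI := Ioo_subset_Icc_self (nodesS_subset hp ht).1
    simp only [nodesS, Finset.mem_image, Finset.mem_Icc] at ht
    obtain ⟨l, ⟨h1, h2⟩, rfl⟩ := ht
    have := H.edge_normal _ hside l h1 h2
    rw [pointS_eq hp, dirDerivWithin, hT.normal _ htI] at this
    rw [this]
    simp only [JetField.ofFunction, if_pos (hpt _ htI), dirDerivWithin]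

/-- The converse: a function with the traces and normal derivatives of `ψ` and with the same
values at the interior points interpolates `ψ`. -/
theorem IsRegular.interpolates_of_isEdgePair (he : e.IsRegular) (hp : 5 ≤ p) {ψ g : Plane → ℝ}
    (hψ : ContDiffOn ℝ 2 ψ e.closedRegion) (hg : ContDiffOn ℝ 2 g e.closedRegion)
    (hT : ∀ i f h, (he.jets hψ).IsEdgePair p (e.vertex i) (e.vertex (e.kind.next i)) f h →
        HasEdgeTraces e.closedRegion g (e.vertex i) (e.vertex (e.kind.next i)) f h)
    (hin : ∀ m ∈ e.kind.inner p, g (e.param (CellKind.innerPoint p m))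
        = ψ (e.param (CellKind.innerPoint p m))) :
    e.Interpolates p ψ g := by
  choose f h hfh using fun i =>
    JetField.exists_isEdgePair hp (he.jets hψ) (e.vertex i) (e.vertex (e.kind.next i))
  have hpt : ∀ i, ∀ t ∈ Icc (0 : ℝ) 1,
      (1 - t) • e.vertex i + t • e.vertex (e.kind.next i) ∈ e.closedRegion := fun i t ht =>
    e.segment_subset i ⟨1 - t, t, by linarith [ht.2], ht.1, by ring, rfl⟩
  refine ⟨?_, ?_, ?_, forall_interiorIndices_iff (P := fun x => g x = ψ x) |>.2 hin⟩
  · intro V hV a b hab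
    rw [corners_eq] at hV
    obtain ⟨i, rfl⟩ := hV
    rw [partialWithin_eq_coord he.uniqueDiffOn he.subset_closure_interior hg (e.vertex_mem i) hab,
      partialWithin_eq_coord he.uniqueDiffOn he.subset_closure_interior hψ (e.vertex_mem i) hab]
    obtain ⟨h0, h1, h2⟩ := he.jets_vertex_eq hg f h hfh (fun i => hT i _ _ (hfh i)) i
    exact JetField.coord_congr h0 h1 h2 _
  · intro s hs l h1 h2
    rw [sides_eq] at hs
    obtain ⟨i, rfl⟩ := hs
    have hl : edgeNode p (indexR p l) ∈ nodesR p :=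
      Finset.mem_image_of_mem _ (Finset.mem_Icc.2 ⟨h1, h2⟩)
    have htI := Ioo_subset_Icc_self (nodesR_subset hp hl).1
    have := (hfh i).trace _ hl
    simp only [JetField.ofFunction, if_pos (hpt i _ htI)] at this
    rw [pointR_eq hp, (hT i _ _ (hfh i)).value _ htI, this]
  · intro s hs l h1 h2
    rw [sides_eq] at hs
    obtain ⟨i, rfl⟩ := hs
    have hl : edgeNode p (indexS p l) ∈ nodesS p :=
      Finset.mem_image_of_mem _ (Finset.mem_Icc.2 ⟨h1, h2⟩)
    have htI := Ioo_subset_Icc_self (nodesS_subset hp hl).1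
    have := (hfh i).normal _ hl
    simp only [JetField.ofFunction, if_pos (hpt i _ htI)] at this
    rw [pointS_eq hp, dirDerivWithin, dirDerivWithin, (hT i _ _ (hfh i)).normal _ htI, this]

end MeshElement

namespace MixedMesh

open MeshElement Polynomial

variable {M : MixedMesh} {e : MeshElement} {p : ℕ}

/-- On an element, a member of the Argyris-like space has polynomial traces and normal
derivatives, the latter of degree at most `p - 1`. -/
theorem exists_hasEdgeTraces (he : e ∈ M.elements) {φ g : Plane → ℝ}
    (hφ : φ ∈ M.argyrisSpace p) (hgφ : EqOn g φ e.closedRegion) :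
    ∃ c : e.kind.exponents p → ℝ, (∀ q ∈ e.kind.cell, g (e.param q) = bipartial _ 0 0 q c) ∧
      ContDiffOn ℝ 2 g e.closedRegion ∧
      ∀ i, ∃ f h : ℝ[X], f.natDegree ≤ p ∧ h.natDegree ≤ p - 1 ∧
        HasEdgeTraces e.closedRegion g (e.vertex i) (e.vertex (e.kind.next i)) f h := by
  obtain ⟨hφ1, hφ2, -, hφ4⟩ := hφ
  have hreg := M.element_regular e he
  obtain ⟨c, hc⟩ := (isLocalPolynomial_iff e p _).1 (hφ2 e he)
  have hgc : ∀ q ∈ e.kind.cell, g (e.param q) = bipartial _ 0 0 q c := fun q hq =>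
    (hgφ (e.param_mem hq)).trans (hc q hq)
  have hg : ContDiffOn ℝ 2 g e.closedRegion :=
    (hreg.contDiffOn_pushForward c).congr fun x hx => by
      rw [← e.param_paramInv hx, hgc _ (e.paramInv_mem hx),
        hreg.pushForward_param c (e.paramInv_mem hx)]
  refine ⟨c, hgc, hg, fun i => ?_⟩
  have hfd : ∀ x ∈ e.closedRegion,
      fderivWithin ℝ φ (closure M.domain) x = fderivWithin ℝ g e.closedRegion x := fun x hx => by
    have h1 := ((hφ1.differentiableOn (by norm_num)) x
      (M.closedRegion_subset he hx)).hasFDerivWithinAt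
    exact (((h1.mono (M.closedRegion_subset he)).congr' hgφ hx).fderivWithin
      (hreg.uniqueDiffOn x hx)).symm
  have hpt : ∀ t ∈ Icc (0 : ℝ) 1,
      (1 - t) • e.vertex i + t • e.vertex (e.kind.next i) ∈ e.closedRegion := fun t ht =>
    e.segment_subset i ⟨1 - t, t, by linarith [ht.2], ht.1, by ring, rfl⟩
  obtain ⟨h, hdeg, hIoo⟩ : ∃ h : ℝ[X], h.natDegree ≤ p - 1 ∧ ∀ t ∈ Ioo (0 : ℝ) 1,
      fderivWithin ℝ g e.closedRegion ((1 - t) • e.vertex i + t • e.vertex (e.kind.next i))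
        (unitNormal (e.vertex i) (e.vertex (e.kind.next i))) = h.eval t := by
    obtain ⟨E, hE, hEi, -⟩ := M.exists_edge_of_side he i
    obtain ⟨P, hP, hPe⟩ := hφ4 E hE
    rcases hEi with rfl | rfl
    · refine ⟨P, hP, fun t ht => ?_⟩
      rw [← hPe t ht, dirDerivWithin, hfd _ (hpt t (Ioo_subset_Icc_self ht))]
    · refine ⟨-P.comp (1 - Polynomial.X), ?_, fun t ht => ?_⟩
      · rw [natDegree_neg]
        refine natDegree_comp_le.trans ?_
        have : (1 - Polynomial.X : ℝ[X]).natDegree ≤ 1 := by compute_degree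
        nlinarith
      · have h1 := hPe (1 - t) ⟨by linarith [ht.2], by linarith [ht.1]⟩
        have h2 : (1 - (1 - t)) • e.vertex (e.kind.next i) + (1 - t) • e.vertex i
            = (1 - t) • e.vertex i + t • e.vertex (e.kind.next i) := by module
        simp only [h2, dirDerivWithin] at h1
        rw [hfd _ (hpt t (Ioo_subset_Icc_self ht)), unitNormal_swap, map_neg] at h1
        simp only [eval_neg, eval_comp, eval_sub, eval_one, eval_X]
        linarith
  refine ⟨e.kind.tracePolynomial _ i c, h, e.kind.natDegree_tracePolynomial_le p i c, hdeg,
    fun t ht => ?_, fun t ht => ?_⟩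
  · rw [CellKind.eval_tracePolynomial, ← e.param_side,
      hgc _ (e.kind.corner_add_smul_along_mem i ht)]
  · -- the identity extends to the end points by continuity
    have hcont : ContinuousOn (fun t : ℝ => fderivWithin ℝ g e.closedRegion
        ((1 - t) • e.vertex i + t • e.vertex (e.kind.next i))
        (unitNormal (e.vertex i) (e.vertex (e.kind.next i)))) (Icc 0 1) := by
      have h1 : ContinuousOn (fderivWithin ℝ g e.closedRegion) e.closedRegion :=
        hg.continuousOn_fderivWithin hreg.uniqueDiffOn (by norm_num)
      exact (h1.comp (by fun_prop) hpt).clm_apply continuousOn_const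
    refine EqOn.of_subset_closure (s := Ioo 0 1) hIoo hcont h.continuous.continuousOn
      Ioo_subset_Icc_self ?_ ht
    rw [closure_Ioo zero_ne_one]

/-- The structure of a local interpolant: its pull-back is a polynomial, and its traces and normal
derivatives are those that are prescribed by the data. -/
theorem IsLocalInterpolant.exists_traces (hp : 5 ≤ p) (he : e ∈ M.elements) {ψ g : Plane → ℝ}
    (hψ : ContDiffOn ℝ 2 ψ e.closedRegion) (H : M.IsLocalInterpolant p e ψ g) :
    ∃ c : e.kind.exponents p → ℝ, (∀ q ∈ e.kind.cell, g (e.param q) = bipartial _ 0 0 q c) ∧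
      ContDiffOn ℝ 2 g e.closedRegion ∧
      (∀ i f h, ((M.element_regular e he).jets hψ).IsEdgePair p (e.vertex i)
        (e.vertex (e.kind.next i)) f h →
        HasEdgeTraces e.closedRegion g (e.vertex i) (e.vertex (e.kind.next i)) f h) ∧
      ∀ m ∈ e.kind.inner p, bipartial _ 0 0 (CellKind.innerPoint p m) c
        = ψ (e.param (CellKind.innerPoint p m)) := by
  obtain ⟨⟨φ, hφ, hgφ⟩, Hint⟩ := H
  obtain ⟨c, hc, hg, hT⟩ := exists_hasEdgeTraces he hφ hgφ
  refine ⟨c, hc, hg, fun i f h hfh => ?_, fun m hm => ?_⟩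
  · obtain ⟨f', h', d1, d2, hT'⟩ := hT i
    obtain ⟨rfl, rfl⟩ := hfh.unique hp ((M.element_regular e he).isEdgePair_of_interpolates hp hψ
      hg Hint i d1 d2 hT')
    exact hT'
  · rw [← hc _ (e.kind.innerPoint_mem hp hm)]
    exact (forall_interiorIndices_iff (P := fun x => g x = ψ x)).1 Hint.interior_value m hm

/-- The data are the derivatives of `ψ`, continued by zero outside the element. -/
theorem exists_isLocalInterpolant (hp : 5 ≤ p) (he : e ∈ M.elements) {ψ : Plane → ℝ}
    (hψ : ContDiffOn ℝ 2 ψ e.closedRegion) : ∃ g, M.IsLocalInterpolant p e ψ g := by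
  have hreg := M.element_regular e he
  obtain ⟨Φ, hΦ, h⟩ := M.exists_mem_argyrisSpace hp (hreg.jets hψ)
  obtain ⟨g, hgΦ, hg, hT, hin⟩ := h e he
  refine ⟨g, ⟨Φ, hΦ, hgΦ.symm⟩, hreg.interpolates_of_isEdgePair hp hψ hg hT fun m hm => ?_⟩
  rw [hin m hm]
  simp only [JetField.ofFunction, if_pos (e.param_mem (e.kind.innerPoint_mem hp hm))]

/-- The pull-back of the difference of two local interpolants vanishes to second order on the
boundary and vanishes at the interior points. -/
theorem IsLocalInterpolant.eqOn (hp : 5 ≤ p) (he : e ∈ M.elements) {ψ g g' : Plane → ℝ}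
    (hψ : ContDiffOn ℝ 2 ψ e.closedRegion) (H : M.IsLocalInterpolant p e ψ g)
    (H' : M.IsLocalInterpolant p e ψ g') : EqOn g g' e.closedRegion := by
  have hreg := M.element_regular e he
  obtain ⟨c, hc, hg, hT, hin⟩ := H.exists_traces hp he hψ
  obtain ⟨c', hc', hg', hT', hin'⟩ := H'.exists_traces hp he hψ
  have h0 : c - c' = 0 := by
    refine CellKind.eq_zero_of_vanishesOnBoundary hp ⟨fun i t ht => ?_, fun i t ht => ?_⟩
      fun m hm => ?_
    all_goals rw [map_sub, sub_eq_zero]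
    · obtain ⟨f, h, hfh⟩ := JetField.exists_isEdgePair hp (hreg.jets hψ) (e.vertex i)
        (e.vertex (e.kind.next i))
      have hq := e.kind.corner_add_smul_along_mem i ht
      rw [← hc _ hq, ← hc' _ hq, e.param_side, (hT i f h hfh).value t ht,
        (hT' i f h hfh).value t ht]
    · obtain ⟨f, h, hfh⟩ := JetField.exists_isEdgePair hp (hreg.jets hψ) (e.vertex i)
        (e.vertex (e.kind.next i))
      rw [hreg.bideriv_across_eq (hg.differentiableOn (by norm_num)) hc (hT i f h hfh) ht,
        hreg.bideriv_across_eq (hg'.differentiableOn (by norm_num)) hc' (hT' i f h hfh) ht]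
    · rw [hin m hm, hin' m hm]
  intro x hx
  rw [← e.param_paramInv hx, hc _ (e.paramInv_mem hx), hc' _ (e.paramInv_mem hx),
    sub_eq_zero.1 h0]

theorem isLocalInterpolant_localProjector (hp : 5 ≤ p) (he : e ∈ M.elements) {ψ : Plane → ℝ}
    (hψ : ContDiffOn ℝ 2 ψ e.closedRegion) :
    M.IsLocalInterpolant p e ψ (M.localProjector p e ψ) :=
  Classical.epsilon_spec (exists_isLocalInterpolant hp he hψ)

end MixedMesh

/-! ### Shape regularity -/

/-- The determinant of two plane vectors. -/
def planeDet (v w : Plane) : ℝ := v 0 * w 1 - v 1 * w 0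

theorem inner_plane (v w : Plane) : inner ℝ v w = v 0 * w 0 + v 1 * w 1 := by
  rw [PiLp.inner_apply]
  simp [mul_comm]

theorem abs_planeDet_eq (v w : Plane) :
    |planeDet v w| = Real.sin (InnerProductGeometry.angle v w) * (‖v‖ * ‖w‖) := by
  rw [InnerProductGeometry.sin_angle_mul_norm_mul_norm, ← Real.sqrt_sq_eq_abs]
  congr 1
  simp only [inner_plane, planeDet]
  ring

theorem abs_planeDet_le (v w : Plane) : |planeDet v w| ≤ ‖v‖ * ‖w‖ := by
  rw [abs_planeDet_eq]
  exact mul_le_of_le_one_left (by positivity) (Real.sin_le_one _)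

/-- Twice the area of a triangle. -/
def doubleArea (A B C : Plane) : ℝ := |planeDet (B - A) (C - A)|

theorem doubleArea_rotate (A B C : Plane) : doubleArea B C A = doubleArea A B C := by
  simp only [doubleArea, planeDet, PiLp.sub_apply]
  congr 1
  ring

theorem doubleArea_eq (A B C : Plane) :
    doubleArea A B C = Real.sin (EuclideanGeometry.angle A B C) * (dist A B * dist C B) := by
  rw [dist_eq_norm, dist_eq_norm, EuclideanGeometry.angle, vsub_eq_sub, vsub_eq_sub,
    ← abs_planeDet_eq]
  simp only [doubleArea, planeDet, PiLp.sub_apply]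
  rw [← abs_neg]
  congr 1
  ring

namespace AnglesAtLeast

variable {ρ : ℝ} {A B C : Plane}

theorem rotate (h : AnglesAtLeast ρ A B C) : AnglesAtLeast ρ B C A := ⟨h.2.1, h.2.2, h.1⟩

/-- The area is the product of two sides and the sine of the angle between them, and this angle is
neither small nor close to `π`, as the angles add up to `π`. -/
theorem mul_dist_le_doubleArea (hρ : 0 < ρ) (h : AnglesAtLeast ρ A B C)
    (h0 : doubleArea A B C ≠ 0) :
    Real.sin (min ρ 1) * (dist A B * dist C B) ≤ doubleArea A B C := by
  have hBA : B ≠ A := by rintro rfl; simp [doubleArea, planeDet] at h0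
  have hsum := EuclideanGeometry.angle_add_angle_add_angle_eq_pi C hBA
  obtain ⟨h1, h2, h3⟩ := h
  have hr : min ρ 1 ≤ ρ := min_le_left _ _
  have hr1 : min ρ 1 ≤ 1 := min_le_right _ _
  have hr0 : 0 < min ρ 1 := lt_min hρ one_pos
  have hpi := Real.pi_gt_three
  rw [doubleArea_eq]
  refine mul_le_mul_of_nonneg_right ?_ (by positivity)
  -- the angle lies between `min ρ 1` and `π - min ρ 1`
  rcases le_total (EuclideanGeometry.angle A B C) (Real.pi / 2) with hle | hle
  · exact Real.sin_le_sin_of_le_of_le_pi_div_two (by linarith) hle (by linarith)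
  · rw [← Real.sin_pi_sub (EuclideanGeometry.angle A B C)]
    exact Real.sin_le_sin_of_le_of_le_pi_div_two (by linarith) (by linarith) (by linarith)

/-- Two sides of a shape regular triangle are comparable. -/
theorem mul_dist_le (hρ : 0 < ρ) (h : AnglesAtLeast ρ A B C) (h0 : doubleArea A B C ≠ 0) :
    Real.sin (min ρ 1) * dist A B ≤ dist A C ∧ Real.sin (min ρ 1) * dist C B ≤ dist A C := by
  have h1 := h.mul_dist_le_doubleArea hρ h0
  have hAB : 0 < dist A B := dist_pos.2 (by rintro rfl; simp [doubleArea, planeDet] at h0)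
  have hCB : 0 < dist C B := dist_pos.2 (by
    rintro rfl
    rw [← doubleArea_rotate] at h0
    simp [doubleArea, planeDet] at h0)
  have hC : doubleArea A B C ≤ dist C B * dist A C := by
    rw [← doubleArea_rotate, doubleArea_eq, dist_comm B C]
    exact mul_le_of_le_one_left (by positivity) (Real.sin_le_one _)
  have hA : doubleArea A B C ≤ dist A B * dist A C := by
    rw [← doubleArea_rotate, ← doubleArea_rotate, doubleArea_eq, dist_comm C A, dist_comm B A,
      mul_comm (dist A B)]
    exact mul_le_of_le_one_left (by positivity) (Real.sin_le_one _)
  constructor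
  · refine le_of_mul_le_mul_right ?_ hCB
    linarith
  · refine le_of_mul_le_mul_right ?_ hAB
    linarith

/-- All pairs of sides of a shape regular triangle are comparable. -/
theorem comparable (hρ : 0 < ρ) (h : AnglesAtLeast ρ A B C) (h0 : doubleArea A B C ≠ 0) :
    (Real.sin (min ρ 1) * dist A B ≤ dist A C ∧ Real.sin (min ρ 1) * dist B C ≤ dist A C) ∧
    (Real.sin (min ρ 1) * dist B C ≤ dist A B ∧ Real.sin (min ρ 1) * dist A C ≤ dist A B) ∧
    (Real.sin (min ρ 1) * dist A C ≤ dist B C ∧ Real.sin (min ρ 1) * dist A B ≤ dist B C) := by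
  have h0' : doubleArea B C A ≠ 0 := by rwa [doubleArea_rotate]
  have h0'' : doubleArea C A B ≠ 0 := by rwa [doubleArea_rotate]
  have h1 := h.mul_dist_le hρ h0
  have h2 := h.rotate.mul_dist_le hρ h0'
  have h3 := h.rotate.rotate.mul_dist_le hρ h0''
  rw [dist_comm C B] at h1 h3
  rw [dist_comm B A] at h2 h3
  rw [dist_comm C A] at h3
  exact ⟨h1, h2, h3⟩

end AnglesAtLeast

namespace MeshElement

variable {e : MeshElement}

/-- The determinant of the derivative of the geometry mapping. -/
def jacobian (e : MeshElement) (q : ℝ × ℝ) : ℝ :=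
  planeDet (e.du + q.2 • e.twist) (e.dv + q.1 • e.twist)

theorem jacobian_apply (e : MeshElement) (q : ℝ × ℝ) :
    e.jacobian q = planeDet e.du e.dv + q.1 * planeDet e.du e.twist
      + q.2 * planeDet e.twist e.dv := by
  simp only [jacobian, planeDet, PiLp.add_apply, PiLp.smul_apply, smul_eq_mul]
  ring

theorem IsRegular.jacobian_ne_zero (he : e.IsRegular) {q : ℝ × ℝ} (hq : q ∈ e.kind.cell) :
    e.jacobian q ≠ 0 := by
  intro h
  have hinj := (he.bijective hq).1
  have hz : ∀ w, e.paramDeriv q w = 0 → w = 0 := fun w hw =>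
    hinj (hw.trans (map_zero _).symm)
  set a := e.du + q.2 • e.twist with ha
  set b := e.dv + q.1 • e.twist with hb
  have hdet : a 0 * b 1 - a 1 * b 0 = 0 := h
  have h1 := hz (b 1, -a 1) (by
    rw [paramDeriv_apply, ← ha, ← hb]
    ext i
    fin_cases i <;> simp <;> linarith)
  have h2 := hz (b 0, -a 0) (by
    rw [paramDeriv_apply, ← ha, ← hb]
    ext i
    fin_cases i <;> simp <;> linarith)
  simp only [Prod.mk_eq_zero, neg_eq_zero] at h1 h2
  have h3 := hz (1, 0) (by
    rw [paramDeriv_apply, ← ha, ← hb]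
    ext i
    fin_cases i <;> simp [h1, h2])
  simp at h3

/-- The Jacobian is affine and has a constant sign, so that its absolute value is smallest at a
corner. -/
theorem IsRegular.le_abs_jacobian (he : e.IsRegular) {δ : ℝ}
    (h : ∀ i, δ ≤ |e.jacobian (e.kind.corner i)|) {q : ℝ × ℝ} (hq : q ∈ e.kind.cell) :
    δ ≤ |e.jacobian q| := by
  have hcont : Continuous e.jacobian := by
    simp only [funext e.jacobian_apply]
    fun_prop
  have hsign : (∀ q ∈ e.kind.cell, 0 < e.jacobian q) ∨ ∀ q ∈ e.kind.cell, e.jacobian q < 0 := by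
    by_contra! hcon
    obtain ⟨⟨q, hq, hq0⟩, ⟨q', hq', hq0'⟩⟩ := hcon
    obtain ⟨r, hr, hr0⟩ := e.kind.convex_cell.isPreconnected.intermediate_value hq hq'
      hcont.continuousOn ⟨hq0, hq0'⟩
    exact he.jacobian_ne_zero hr hr0
  have key : ∀ s : ℝ, (∀ i, δ ≤ s * e.jacobian (e.kind.corner i)) → δ ≤ s * e.jacobian q := by
    intro s hs
    rcases e with ⟨V₁, V₂, V₃⟩ | ⟨V₁, V₂, V₃, V₄⟩
    · have h0 := hs (0 : Fin 3)
      simp only [jacobian, twist, smul_zero, add_zero] at h0 ⊢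
      exact h0
    · have h0 := hs (0 : Fin 4)
      have h1 := hs (1 : Fin 4)
      have h2 := hs (2 : Fin 4)
      have h3 := hs (3 : Fin 4)
      obtain ⟨⟨u0, u1⟩, v0, v1⟩ := hq
      rw [jacobian_apply] at h0 h1 h2 h3 ⊢
      generalize planeDet (du _) (dv _) = a at *
      generalize planeDet (du _) (twist _) = b at *
      generalize planeDet (twist _) (dv _) = d at *
      simp only [kind, CellKind.corner, Matrix.cons_val_zero, Matrix.cons_val_one,
        Matrix.cons_val] at h0 h1 h2 h3
      have w00 := mul_nonneg (sub_nonneg.2 u1) (sub_nonneg.2 v1)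
      have w10 := mul_nonneg u0 (sub_nonneg.2 v1)
      have w11 := mul_nonneg u0 v0
      have w01 := mul_nonneg (sub_nonneg.2 u1) v0
      linarith [mul_le_mul_of_nonneg_left h0 w00, mul_le_mul_of_nonneg_left h1 w10,
        mul_le_mul_of_nonneg_left h2 w11, mul_le_mul_of_nonneg_left h3 w01]
  rcases hsign with hs | hs
  · rw [abs_of_pos (hs q hq), ← one_mul (e.jacobian q)]
    refine key 1 fun i => ?_
    rw [one_mul, ← abs_of_pos (hs _ (e.kind.corner_mem_cell i))]
    exact h i
  · rw [abs_of_neg (hs q hq), ← neg_one_mul]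
    refine key (-1) fun i => ?_
    rw [neg_one_mul, ← abs_of_neg (hs _ (e.kind.corner_mem_cell i))]
    exact h i

theorem IsRegular.diam_closedRegion (he : e.IsRegular) :
    Metric.diam e.closedRegion = Metric.diam e.openRegion := by
  rw [← he.closure_openRegion, Metric.diam_closure]

theorem IsRegular.dist_le_diam (he : e.IsRegular) {x y : Plane} (hx : x ∈ e.closedRegion)
    (hy : y ∈ e.closedRegion) : dist x y ≤ Metric.diam e.openRegion := by
  rw [← he.diam_closedRegion]
  exact Metric.dist_le_diam_of_mem e.isCompact_closedRegion.isBounded hx hy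

theorem param_mem_of_convex {s : Set Plane} (hs : Convex ℝ s) (h : ∀ i, e.vertex i ∈ s)
    {q : ℝ × ℝ} (hq : q ∈ e.kind.cell) : e.param q ∈ s := by
  rcases e with ⟨V₁, V₂, V₃⟩ | ⟨V₁, V₂, V₃, V₄⟩
  · obtain ⟨h1, h2, h3, h4⟩ := hq
    have hV := fun i : Fin 3 => h i
    simp only [Fin.forall_fin_succ, vertex, CellKind.corner, kind] at hV
    obtain ⟨hV1, hV2, hV3, -⟩ := hV
    simp [param] at hV1 hV2 hV3
    have := hs.sum_mem (t := Finset.univ) (w := ![1 - q.1 - q.2, q.1, q.2]) (z := ![V₁, V₂, V₃])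
      (by intro i _; fin_cases i <;> simp <;> linarith) (by simp [Fin.sum_univ_succ])
      (by intro i _; fin_cases i <;> simpa)
    simpa [Fin.sum_univ_succ, param, add_assoc] using this
  · obtain ⟨⟨u0, u1⟩, v0, v1⟩ := hq
    have hV := fun i : Fin 4 => h i
    simp only [Fin.forall_fin_succ, vertex, CellKind.corner, kind] at hV
    obtain ⟨hV1, hV2, hV3, hV4, -⟩ := hV
    simp [param] at hV1 hV2 hV3 hV4
    have := hs (hs hV1 hV2 (sub_nonneg.2 u1) u0 (by ring))
      (hs hV4 hV3 (sub_nonneg.2 u1) u0 (by ring)) (sub_nonneg.2 v1) v0 (by ring)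
    convert this using 1
    simp only [param]
    module

/-- An element lies in every disc that contains its vertices. -/
theorem IsRegular.diam_le (he : e.IsRegular) {x : Plane} {r : ℝ} (hr : 0 ≤ r)
    (h : ∀ i, dist (e.vertex i) x ≤ r) : Metric.diam e.openRegion ≤ 2 * r := by
  rw [← he.diam_closedRegion]
  refine (Metric.diam_mono (t := Metric.closedBall x r) ?_ Metric.isBounded_closedBall).trans
    (Metric.diam_closedBall hr)
  rw [closedRegion_eq]
  rintro _ ⟨q, hq, rfl⟩
  exact param_mem_of_convex (convex_closedBall x r) h hq

/-- On a shape regular element, the sides and the Jacobian at the corners are bounded below in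
terms of the diameter. -/
theorem IsRegular.le_of_isShapeRegular (he : e.IsRegular) {ρ : ℝ} (hρ : 0 < ρ)
    (h : e.IsShapeRegular ρ) {δ : ℝ}
    (hδ : δ = Real.sin (min ρ 1) ^ 2 * Metric.diam e.openRegion / 2) :
    (∀ i, δ ≤ dist (e.vertex i) (e.vertex (e.kind.next i))) ∧
      ∀ i, Real.sin (min ρ 1) * δ ^ 2 ≤ |e.jacobian (e.kind.corner i)| := by
  have hs0 : 0 < Real.sin (min ρ 1) := Real.sin_pos_of_pos_of_lt_pi (lt_min hρ one_pos)
    (by linarith [min_le_right ρ 1, Real.pi_gt_three])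
  have hs1 := Real.sin_le_one (min ρ 1)
  have hjac := fun i => he.jacobian_ne_zero (e.kind.corner_mem_cell i)
  have hδ0 : 0 ≤ δ := by rw [hδ]; positivity
  have hsq : ∀ {x y z : ℝ}, δ ≤ x → δ ≤ y → Real.sin (min ρ 1) * (x * y) ≤ z →
      Real.sin (min ρ 1) * δ ^ 2 ≤ z := fun hx hy hz => by
    refine le_trans (mul_le_mul_of_nonneg_left ?_ hs0.le) hz
    rw [sq]
    exact mul_le_mul hx hy hδ0 (hδ0.trans hx)
  -- a bound for the distances of the vertices from one of them gives a bound for the diameter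
  have hdiam : ∀ (x : Plane) (L : ℝ), 0 ≤ L →
      (∀ i, Real.sin (min ρ 1) ^ 2 * dist (e.vertex i) x ≤ L) → δ ≤ L := by
    intro x L hL hi
    have := he.diam_le (x := x) (r := L / Real.sin (min ρ 1) ^ 2) (by positivity) fun i => by
      rw [le_div_iff₀ (by positivity), mul_comm]; exact hi i
    rw [hδ, div_le_iff₀ two_pos]
    calc Real.sin (min ρ 1) ^ 2 * Metric.diam e.openRegion
        ≤ Real.sin (min ρ 1) ^ 2 * (2 * (L / Real.sin (min ρ 1) ^ 2)) := by gcongr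
      _ = L * 2 := by field_simp
  have hsL : ∀ x : ℝ, 0 ≤ x → Real.sin (min ρ 1) ^ 2 * x ≤ Real.sin (min ρ 1) * x := fun x hx => by
    nlinarith [mul_nonneg hs0.le hx]
  have hsL' : ∀ x : ℝ, 0 ≤ x → Real.sin (min ρ 1) ^ 2 * x ≤ x := fun x hx => by
    nlinarith [mul_nonneg hs0.le hx]
  have hss : ∀ x y z : ℝ, Real.sin (min ρ 1) * x ≤ y → Real.sin (min ρ 1) * y ≤ z →
      Real.sin (min ρ 1) ^ 2 * x ≤ z := fun x y z hx hy => by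
    nlinarith [mul_le_mul_of_nonneg_left hx hs0.le]
  rcases e with ⟨V₁, V₂, V₃⟩ | ⟨V₁, V₂, V₃, V₄⟩
  · have hj : ∀ i, |(tri V₁ V₂ V₃).jacobian ((tri V₁ V₂ V₃).kind.corner i)|
        = doubleArea V₁ V₂ V₃ := fun i => by simp [jacobian, doubleArea, du, dv, twist]
    have h0 : doubleArea V₁ V₂ V₃ ≠ 0 := by
      rw [← hj (0 : Fin 3)]; exact abs_ne_zero.2 (hjac _)
    obtain ⟨⟨a1, a2⟩, ⟨b1, b2⟩, ⟨c1, c2⟩⟩ := AnglesAtLeast.comparable hρ h h0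
    have hd : ∀ L, 0 ≤ L → Real.sin (min ρ 1) ^ 2 * dist V₁ V₂ ≤ L →
        Real.sin (min ρ 1) ^ 2 * dist V₁ V₃ ≤ L → δ ≤ L := fun L hL h2 h3 => by
      refine hdiam V₁ L hL fun i => ?_
      change Fin 3 at i
      fin_cases i
      · simpa [vertex, kind, CellKind.corner, param] using hL
      · simpa [vertex, kind, CellKind.corner, param, dist_comm] using h2
      · simpa [vertex, kind, CellKind.corner, param, dist_comm] using h3
    have d12 : δ ≤ dist V₁ V₂ := hd _ dist_nonneg (hsL' _ dist_nonneg)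
      ((hsL _ dist_nonneg).trans b2)
    have d23 : δ ≤ dist V₂ V₃ := hd _ dist_nonneg ((hsL _ dist_nonneg).trans c2)
      ((hsL _ dist_nonneg).trans c1)
    have d13 : δ ≤ dist V₁ V₃ := hd _ dist_nonneg ((hsL _ dist_nonneg).trans a1)
      (hsL' _ dist_nonneg)
    refine ⟨fun i => ?_, fun i => ?_⟩
    · change Fin 3 at i
      fin_cases i
      · simpa [vertex, kind, CellKind.corner, CellKind.next, param] using d12
      · simpa [vertex, kind, CellKind.corner, CellKind.next, param] using d23
      · simpa [vertex, kind, CellKind.corner, CellKind.next, param, dist_comm] using d13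
    · rw [hj]
      exact hsq d12 (by rwa [dist_comm]) (AnglesAtLeast.mul_dist_le_doubleArea hρ h h0)
  · obtain ⟨h123, h134, h124, h234⟩ := h
    have j0 : |(quad V₁ V₂ V₃ V₄).jacobian (0, 0)| = doubleArea V₁ V₂ V₄ := by
      simp [jacobian, doubleArea, du, dv]
    have j1 : |(quad V₁ V₂ V₃ V₄).jacobian (1, 0)| = doubleArea V₁ V₂ V₃ := by
      simp only [jacobian, doubleArea, du, dv, twist, planeDet, PiLp.add_apply, PiLp.sub_apply,
        PiLp.smul_apply, smul_eq_mul]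
      congr 1; ring
    have j2 : |(quad V₁ V₂ V₃ V₄).jacobian (1, 1)| = doubleArea V₂ V₃ V₄ := by
      simp only [jacobian, doubleArea, du, dv, twist, planeDet, PiLp.add_apply, PiLp.sub_apply,
        PiLp.smul_apply, smul_eq_mul]
      congr 1; ring
    have j3 : |(quad V₁ V₂ V₃ V₄).jacobian (0, 1)| = doubleArea V₁ V₃ V₄ := by
      simp only [jacobian, doubleArea, du, dv, twist, planeDet, PiLp.add_apply, PiLp.sub_apply,
        PiLp.smul_apply, smul_eq_mul]
      congr 1; ring
    have n0 : doubleArea V₁ V₂ V₄ ≠ 0 := by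
      rw [← j0]; exact abs_ne_zero.2 (hjac (0 : Fin 4))
    have n1 : doubleArea V₁ V₂ V₃ ≠ 0 := by
      rw [← j1]; exact abs_ne_zero.2 (hjac (1 : Fin 4))
    have n2 : doubleArea V₂ V₃ V₄ ≠ 0 := by
      rw [← j2]; exact abs_ne_zero.2 (hjac (2 : Fin 4))
    have n3 : doubleArea V₁ V₃ V₄ ≠ 0 := by
      rw [← j3]; exact abs_ne_zero.2 (hjac (3 : Fin 4))
    obtain ⟨⟨a1, a2⟩, ⟨b1, b2⟩, ⟨c1, c2⟩⟩ := h123.comparable hρ n1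
    obtain ⟨⟨a1', a2'⟩, ⟨b1', b2'⟩, ⟨c1', c2'⟩⟩ := h134.comparable hρ n3
    obtain ⟨⟨a1'', a2''⟩, ⟨b1'', b2''⟩, ⟨c1'', c2''⟩⟩ := h124.comparable hρ n0
    have hd : ∀ L, 0 ≤ L → Real.sin (min ρ 1) ^ 2 * dist V₁ V₂ ≤ L →
        Real.sin (min ρ 1) ^ 2 * dist V₁ V₃ ≤ L →
        Real.sin (min ρ 1) ^ 2 * dist V₁ V₄ ≤ L → δ ≤ L := fun L hL h2 h3 h4 => by
      refine hdiam V₁ L hL fun i => ?_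
      change Fin 4 at i
      fin_cases i
      · simpa [vertex, kind, CellKind.corner, param] using hL
      · simpa [vertex, kind, CellKind.corner, param, dist_comm] using h2
      · simpa [vertex, kind, CellKind.corner, param, dist_comm] using h3
      · simpa [vertex, kind, CellKind.corner, param, dist_comm] using h4
    have d12 : δ ≤ dist V₁ V₂ := hd _ dist_nonneg (hsL' _ dist_nonneg)
      ((hsL _ dist_nonneg).trans b2) ((hsL _ dist_nonneg).trans b2'')
    have d23 : δ ≤ dist V₂ V₃ := hd _ dist_nonneg ((hsL _ dist_nonneg).trans c2)
      ((hsL _ dist_nonneg).trans c1) (hss _ _ _ b2'' c2)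
    have d34 : δ ≤ dist V₃ V₄ := hd _ dist_nonneg (hss _ _ _ a1 c2')
      ((hsL _ dist_nonneg).trans c2') ((hsL _ dist_nonneg).trans c1')
    have d14 : δ ≤ dist V₁ V₄ := hd _ dist_nonneg ((hsL _ dist_nonneg).trans a1'')
      ((hsL _ dist_nonneg).trans a1') (hsL' _ dist_nonneg)
    refine ⟨fun i => ?_, fun i => ?_⟩
    · change Fin 4 at i
      fin_cases i
      · simpa [vertex, kind, CellKind.corner, CellKind.next, param] using d12
      · simpa [vertex, kind, CellKind.corner, CellKind.next, param] using d23
      · simpa [vertex, kind, CellKind.corner, CellKind.next, param] using d34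
      · simpa [vertex, kind, CellKind.corner, CellKind.next, param, dist_comm] using d14
    · -- at each vertex, the area of the triangle formed with its two neighbours
      change Fin 4 at i
      fin_cases i
      · refine hsq d14 d12 ?_
        have := h124.rotate.rotate.mul_dist_le_doubleArea hρ (by
          rwa [doubleArea_rotate, doubleArea_rotate])
        rw [doubleArea_rotate, doubleArea_rotate, dist_comm V₄, dist_comm V₂, ← j0] at this
        exact this
      · refine hsq d12 d23 ?_
        have := h123.mul_dist_le_doubleArea hρ n1
        rw [dist_comm V₃, ← j1] at this
        exact this
      · refine hsq d23 d34 ?_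
        have := h234.mul_dist_le_doubleArea hρ n2
        rw [dist_comm V₄, ← j2] at this
        exact this
      · refine hsq d34 d14 ?_
        have := h134.rotate.mul_dist_le_doubleArea hρ (by rwa [doubleArea_rotate])
        rw [doubleArea_rotate, ← j3] at this
        exact this

end MeshElement

/-! ### Estimates on an element -/

theorem abs_normalCoeff_le (X Y v : Plane) : |normalCoeff X Y v| ≤ ‖v‖ := by
  have h : |v 0 * (Y - X) 1 - v 1 * (Y - X) 0| ≤ ‖v‖ * ‖Y - X‖ := abs_planeDet_le v (Y - X)
  rw [normalCoeff, abs_div, abs_norm]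
  exact div_le_of_le_mul₀ (norm_nonneg _) (norm_nonneg _) h

theorem abs_tangentCoeff_le (X Y v : Plane) : |tangentCoeff X Y v| ≤ ‖v‖ / ‖Y - X‖ := by
  have h := abs_real_inner_le_norm v (Y - X)
  rw [inner_plane] at h
  rw [tangentCoeff, abs_div, abs_of_nonneg (sq_nonneg ‖Y - X‖), sq, ← div_div]
  rcases (norm_nonneg (Y - X)).eq_or_lt with h0 | h0
  · simp [← h0]
  · refine div_le_div_of_nonneg_right ?_ h0.le
    rw [div_le_iff₀ h0]
    exact h

theorem BddAbove.le_c2Norm {K : Set Plane} {f : Plane → ℝ}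
    (h : BddAbove {r : ℝ | ∃ x ∈ K, ∃ a b : ℕ, a + b ≤ 2 ∧ r = |partialWithin K a b f x|})
    {x : Plane} (hx : x ∈ K) {a b : ℕ} (hab : a + b ≤ 2) :
    |partialWithin K a b f x| ≤ c2Norm K f := le_csSup h ⟨x, hx, a, b, hab, rfl⟩

theorem c2Norm_nonneg (K : Set Plane) (f : Plane → ℝ) : 0 ≤ c2Norm K f := by
  refine Real.sSup_nonneg ?_
  rintro _ ⟨x, _, a, b, _, rfl⟩
  exact abs_nonneg _

/-- A function of class `C²` on a compact set has bounded derivatives, with a bound given by its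
`C²`-norm. -/
theorem JetField.boundedOn_ofFunction {K : Set Plane} (hc : IsCompact K) {f : Plane → ℝ}
    (hK : UniqueDiffOn ℝ K) (hK' : K ⊆ closure (interior K)) (hf : ContDiffOn ℝ 2 f K) :
    (JetField.ofFunction K f hK hK' hf).BoundedOn K (4 * c2Norm K f) := by
  have hf1 : ContDiffOn ℝ 1 (fderivWithin ℝ f K) K := hf.fderivWithin hK (by norm_num)
  obtain ⟨B₀, h0⟩ := hc.exists_bound_of_continuousOn hf.continuousOn
  obtain ⟨B₁, h1⟩ := hc.exists_bound_of_continuousOn hf1.continuousOn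
  obtain ⟨B₂, h2⟩ := hc.exists_bound_of_continuousOn
    (hf1.continuousOn_fderivWithin hK (by norm_num))
  have hB : (JetField.ofFunction K f hK hK' hf).BoundedOn K (max B₀ (max B₁ B₂)) := by
    constructor <;> intro x hx <;> simp only [JetField.ofFunction, if_pos hx]
    · exact (h0 x hx).trans (le_max_left _ _)
    · intro v
      refine ((fderivWithin ℝ f K x).le_opNorm v).trans ?_
      rw [mul_comm]
      exact mul_le_mul_of_nonneg_left ((h1 x hx).trans
        ((le_max_left _ _).trans (le_max_right _ _))) (norm_nonneg v)
    · intro v w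
      refine ((fderivWithin ℝ (fderivWithin ℝ f K) K x).le_opNorm₂ v w).trans ?_
      rw [mul_assoc, mul_comm]
      exact mul_le_mul_of_nonneg_left ((h2 x hx).trans
        ((le_max_right _ _).trans (le_max_right _ _))) (by positivity)
  refine JetField.boundedOn_of_coord (c2Norm_nonneg K f) fun x hx a b hab => ?_
  rw [← partialWithin_eq_coord hK hK' hf hx hab]
  refine BddAbove.le_c2Norm ⟨max B₀ (max B₁ B₂), ?_⟩ hx hab
  rintro _ ⟨y, hy, a, b, hab, rfl⟩
  rw [partialWithin_eq_coord hK hK' hf hy hab]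
  exact hB.coord_le hy _

theorem JetField.BoundedOn.mono {φ : JetField} {K K' : Set Plane} {M : ℝ} (h : φ.BoundedOn K M)
    (hK : K' ⊆ K) : φ.BoundedOn K' M :=
  ⟨fun x hx => h.val x (hK hx), fun x hx => h.grad x (hK hx), fun x hx => h.hess x (hK hx)⟩

theorem CellKind.abs_le_one_of_mem (k : CellKind) {q : ℝ × ℝ} (hq : q ∈ k.cell) :
    |q.1| ≤ 1 ∧ |q.2| ≤ 1 := by
  cases k
  · obtain ⟨h1, h2, h3, h4⟩ := hq
    exact ⟨abs_le.2 ⟨by linarith, h2⟩, abs_le.2 ⟨by linarith, by linarith⟩⟩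
  · obtain ⟨⟨h1, h2⟩, h3, h4⟩ := hq
    exact ⟨abs_le.2 ⟨by linarith, h2⟩, abs_le.2 ⟨by linarith, h4⟩⟩

theorem CellKind.abs_across_le_one (k : CellKind) (i : Fin k.sides) :
    |(k.across i).1| ≤ 1 ∧ |(k.across i).2| ≤ 1 := by
  cases k <;> fin_cases i <;> simp [across]

namespace MeshElement

variable {e : MeshElement}

/-- The size of an element is at most `θ`, its sides have at least the length `δ`, and its
Jacobian is at least `δ`. -/
structure HasSize (e : MeshElement) (θ δ : ℝ) : Prop where
  dist_le : ∀ x ∈ e.closedRegion, ∀ y ∈ e.closedRegion, dist x y ≤ θ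
  le_side : ∀ i, δ ≤ ‖e.vertex (e.kind.next i) - e.vertex i‖
  le_jacobian : ∀ q ∈ e.kind.cell, δ ≤ |e.jacobian q|

/-- Shape regularity and the diameter control the size of an element. -/
theorem exists_hasSize {ρ θ : ℝ} (hρ : 0 < ρ) (hθ : 0 < θ) : ∃ δ : ℝ, 0 < δ ∧
    ∀ e : MeshElement, e.IsRegular → e.IsShapeRegular ρ → Metric.diam e.openRegion = θ →
      e.HasSize θ δ := by
  have hs0 : 0 < Real.sin (min ρ 1) := Real.sin_pos_of_pos_of_lt_pi (lt_min hρ one_pos)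
    (by linarith [min_le_right ρ 1, Real.pi_gt_three])
  set δ := Real.sin (min ρ 1) ^ 2 * θ / 2 with hδ
  have hδ0 : 0 < δ := by positivity
  refine ⟨min δ (Real.sin (min ρ 1) * δ ^ 2), lt_min hδ0 (by positivity),
    fun e he hsh hdiam => ?_⟩
  obtain ⟨h1, h2⟩ := he.le_of_isShapeRegular hρ hsh (δ := δ) (by rw [hdiam])
  refine ⟨fun x hx y hy => (he.dist_le_diam hx hy).trans hdiam.le, fun i => ?_, fun q hq => ?_⟩
  · rw [← dist_eq_norm, dist_comm]
    exact (min_le_left _ _).trans (h1 i)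
  · exact he.le_abs_jacobian (fun i => (min_le_right _ _).trans (h2 i)) hq

namespace HasSize

variable {θ δ : ℝ}

theorem norm_vertex_sub_le (h : e.HasSize θ δ) (i j : Fin e.kind.sides) :
    ‖e.vertex j - e.vertex i‖ ≤ θ := by
  rw [← dist_eq_norm]
  exact h.dist_le _ (e.vertex_mem j) _ (e.vertex_mem i)

theorem norm_coeff_le (h : e.HasSize θ δ) : ‖e.du‖ ≤ θ ∧ ‖e.dv‖ ≤ θ ∧ ‖e.twist‖ ≤ 2 * θ := by
  have hv := h.norm_vertex_sub_le
  rcases e with ⟨V₁, V₂, V₃⟩ | ⟨V₁, V₂, V₃, V₄⟩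
  · have h1 := hv (0 : Fin 3) (1 : Fin 3)
    have h2 := hv (0 : Fin 3) (2 : Fin 3)
    have h0 := (norm_nonneg _).trans h1
    simp [vertex, kind, CellKind.corner, param] at h1 h2
    exact ⟨h1, h2, by simp [twist, h0]⟩
  · have h1 := hv (0 : Fin 4) (1 : Fin 4)
    have h2 := hv (0 : Fin 4) (3 : Fin 4)
    have h3 := hv (3 : Fin 4) (2 : Fin 4)
    simp [vertex, kind, CellKind.corner, param] at h1 h2 h3
    refine ⟨h1, h2, ?_⟩
    have : (quad V₁ V₂ V₃ V₄).twist = (V₃ - V₄) - (V₂ - V₁) := by simp only [twist]; abel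
    rw [this]
    exact (norm_sub_le _ _).trans (by linarith)

theorem norm_columns_le (h : e.HasSize θ δ) {q : ℝ × ℝ} (hq : q ∈ e.kind.cell) :
    ‖e.du + q.2 • e.twist‖ ≤ 3 * θ ∧ ‖e.dv + q.1 • e.twist‖ ≤ 3 * θ := by
  obtain ⟨h1, h2, h3⟩ := h.norm_coeff_le
  have hq' := e.kind.abs_le_one_of_mem hq
  have key : ∀ s : ℝ, |s| ≤ 1 → ‖s • e.twist‖ ≤ 2 * θ := fun s hs => by
    rw [norm_smul, Real.norm_eq_abs]
    exact (mul_le_of_le_one_left (norm_nonneg _) hs).trans h3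
  exact ⟨(norm_add_le _ _).trans (by linarith [key _ hq'.2]),
    (norm_add_le _ _).trans (by linarith [key _ hq'.1])⟩

theorem norm_paramDeriv_across_le (h : e.HasSize θ δ) {q : ℝ × ℝ} (hq : q ∈ e.kind.cell)
    (i : Fin e.kind.sides) : ‖e.paramDeriv q (e.kind.across i)‖ ≤ 6 * θ := by
  obtain ⟨h1, h2⟩ := h.norm_columns_le hq
  obtain ⟨h3, h4⟩ := e.kind.abs_across_le_one i
  rw [paramDeriv_apply]
  refine (norm_add_le _ _).trans ?_
  rw [norm_smul, norm_smul, Real.norm_eq_abs, Real.norm_eq_abs]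
  linarith [mul_le_of_le_one_left (norm_nonneg (e.du + q.2 • e.twist)) h3,
    mul_le_of_le_one_left (norm_nonneg (e.dv + q.1 • e.twist)) h4]

/-- Cramer's rule for the derivative of the geometry mapping. -/
theorem exists_paramDeriv_eq (h : e.HasSize θ δ) (hδ : 0 < δ) {q : ℝ × ℝ} (hq : q ∈ e.kind.cell)
    (v : Plane) : ∃ w : ℝ × ℝ, e.paramDeriv q w = v ∧ |w.1| ≤ 3 * θ / δ * ‖v‖ ∧
      |w.2| ≤ 3 * θ / δ * ‖v‖ := by
  have hJ := h.le_jacobian q hq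
  obtain ⟨h1, h2⟩ := h.norm_columns_le hq
  have hJ0 : e.jacobian q ≠ 0 := abs_pos.1 (hδ.trans_le hJ)
  have hpd := fun w => e.paramDeriv_apply q w
  unfold jacobian at hJ hJ0
  generalize e.du + q.2 • e.twist = a at *
  generalize e.dv + q.1 • e.twist = b at *
  have bound : ∀ {r : ℝ} {z : Plane}, |r| ≤ ‖v‖ * ‖z‖ → ‖z‖ ≤ 3 * θ →
      |r / planeDet a b| ≤ 3 * θ / δ * ‖v‖ := by
    intro r z hr hz
    have hθ : 0 ≤ 3 * θ := (norm_nonneg z).trans hz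
    rw [abs_div, div_mul_eq_mul_div]
    refine div_le_div₀ (by positivity) (hr.trans ?_) hδ hJ
    rw [mul_comm]
    exact mul_le_mul_of_nonneg_right hz (norm_nonneg v)
  refine ⟨(planeDet v b / planeDet a b, planeDet a v / planeDet a b), ?_,
    bound (abs_planeDet_le v b) h2, bound ?_ h1⟩
  · rw [hpd]
    ext i
    simp only [PiLp.add_apply, PiLp.smul_apply, smul_eq_mul]
    rw [div_mul_eq_mul_div, div_mul_eq_mul_div, ← add_div, div_eq_iff hJ0]
    fin_cases i <;> simp [planeDet] <;> ring
  · rw [mul_comm]; exact abs_planeDet_le a v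

/-- A bound for the partial derivatives of the pull-back gives a bound for the derivatives. -/
theorem boundedOn_jets (h : e.HasSize θ δ) (hδ : 0 < δ) (he : e.IsRegular) {g : Plane → ℝ}
    (hg : ContDiffOn ℝ 2 g e.closedRegion) {S : Finset (ℕ × ℕ)} {c : S → ℝ}
    (hc : ∀ q ∈ e.kind.cell, g (e.param q) = bipartial S 0 0 q c) {M : ℝ}
    (hM : ∀ q ∈ e.kind.cell, ∀ a < 3, ∀ b < 3, |bipartial S a b q c| ≤ M) :
    (he.jets hg).BoundedOn e.closedRegion
      ((1 + 2 * (3 * θ / δ) + 4 * (3 * θ / δ) ^ 2 + 2 * (3 * θ / δ) ^ 2 *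
        (2 * (3 * θ / δ) * (2 * θ))) * M) := by
  have hθ : 0 ≤ θ := (norm_nonneg _).trans h.norm_coeff_le.1
  obtain ⟨q₀, hq₀⟩ := e.kind.interior_cell_nonempty
  have hM0 : 0 ≤ M := (abs_nonneg _).trans
    (hM q₀ (interior_subset hq₀) 0 (by norm_num) 0 (by norm_num))
  set W := 3 * θ / δ with hW
  have hW0 : 0 ≤ W := by positivity
  have hgrad : ∀ q ∈ e.kind.cell, ∀ v,
      |fderivWithin ℝ g e.closedRegion (e.param q) v| ≤ 2 * W * ‖v‖ * M := by
    intro q hq v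
    obtain ⟨w, rfl, h1, h2⟩ := h.exists_paramDeriv_eq hδ hq v
    rw [fderivWithin_paramDeriv (hg.differentiableOn (by norm_num)) hc hq, bideriv_apply]
    refine (abs_add_le _ _).trans ?_
    rw [abs_mul, abs_mul]
    have b1 := mul_le_mul h1 (hM q hq 1 (by norm_num) 0 (by norm_num)) (abs_nonneg _)
      (by positivity)
    have b2 := mul_le_mul h2 (hM q hq 0 (by norm_num) 1 (by norm_num)) (abs_nonneg _)
      (by positivity)
    linarith
  constructor <;> intro x hx <;> simp only [JetField.ofFunction, if_pos hx] <;>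
    (rw [closedRegion_eq] at hx; obtain ⟨q, hq, rfl⟩ := hx)
  · rw [hc q hq]
    refine (hM q hq 0 (by norm_num) 0 (by norm_num)).trans ?_
    refine le_mul_of_one_le_left hM0 ?_
    have : 0 ≤ 2 * W + 4 * W ^ 2 + 2 * W ^ 2 * (2 * W * (2 * θ)) := by positivity
    linarith
  · intro v
    refine (hgrad q hq v).trans ?_
    have : 0 ≤ ‖v‖ * ((1 + 4 * W ^ 2 + 2 * W ^ 2 * (2 * W * (2 * θ))) * M) := by positivity
    linarith
  · intro v v'
    obtain ⟨z, hz, z1, z2⟩ := h.exists_paramDeriv_eq hδ hq v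
    obtain ⟨w, hw, w1, w2⟩ := h.exists_paramDeriv_eq hδ hq v'
    have e1 := he.fderivWithin_fderivWithin_paramDeriv hg hc hq z w
    rw [hz, hw, CellKind.jetSecond] at e1
    have tw : |fderivWithin ℝ g e.closedRegion (e.param q) e.twist| ≤ 2 * W * (2 * θ) * M := by
      refine (hgrad q hq e.twist).trans ?_
      have := h.norm_coeff_le.2.2
      gcongr
    have key : ∀ {r s t N : ℝ}, |r| ≤ W * ‖v‖ → |s| ≤ W * ‖v'‖ → |t| ≤ N →
        |r * s * t| ≤ W * ‖v‖ * (W * ‖v'‖) * N := fun hr hs ht => by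
      rw [abs_mul, abs_mul]
      gcongr
    have t1 := key z1 w1 (hM q hq 2 (by norm_num) 0 (by norm_num))
    have t2 := key z1 w2 (hM q hq 1 (by norm_num) 1 (by norm_num))
    have t3 := key z2 w1 (hM q hq 1 (by norm_num) 1 (by norm_num))
    have t4 := key z2 w2 (hM q hq 0 (by norm_num) 2 (by norm_num))
    have t5 := key z1 w2 tw
    have t6 := key z2 w1 tw
    have hpos : 0 ≤ ‖v‖ * ‖v'‖ * ((1 + 2 * W) * M) := by positivity
    rw [abs_le] at t1 t2 t3 t4 t5 t6 ⊢
    constructor <;> nlinarith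

end HasSize

end MeshElement

namespace MixedMesh

open MeshElement Polynomial

variable {M : MixedMesh} {e : MeshElement} {p : ℕ}

/-- The derivatives of order at most two of the local interpolant are bounded by those of the
interpolated function. -/
theorem exists_interpolant_bound (hp : 5 ≤ p) {θ δ : ℝ} (hδ : 0 < δ) (hθ : 0 < θ) :
    ∃ C : ℝ, 0 ≤ C ∧ ∀ (M : MixedMesh) (e : MeshElement) (he : e ∈ M.elements), e.HasSize θ δ →
      ∀ (ψ g : Plane → ℝ) (_ : ContDiffOn ℝ 2 ψ e.closedRegion)
        (hg : ContDiffOn ℝ 2 g e.closedRegion), M.IsLocalInterpolant p e ψ g →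
        ((M.element_regular e he).jets hg).BoundedOn e.closedRegion
          (C * c2Norm e.closedRegion ψ) := by
  obtain ⟨C₁, hC₁, hedge⟩ := JetField.exists_isEdgePair_bound hp
  -- one constant for triangles and quadrilaterals
  choose K hK0 hK using fun k : CellKind => k.exists_bipartial_bound hp
  set K' := max (K .tri) (K .quad) with hK'
  have hKle : ∀ k, K k ≤ K' := fun k => by
    cases k
    · exact le_max_left _ _
    · exact le_max_right _ _
  have hK'0 : 0 ≤ K' := (hK0 .tri).trans (hKle .tri)
  set W := 1 + 2 * (3 * θ / δ) + 4 * (3 * θ / δ) ^ 2 + 2 * (3 * θ / δ) ^ 2 *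
    (2 * (3 * θ / δ) * (2 * θ)) with hW
  set B := C₁ * (1 + θ) ^ 2 with hB
  refine ⟨W * (K' * ((1 + B + 6 * θ * B + 6 * θ / δ * B) * 4)), by positivity,
    fun M e he hsize ψ g hψ hg H => ?_⟩
  have hreg := M.element_regular e he
  obtain ⟨c, hc, -, hT, hin⟩ := H.exists_traces hp he hψ
  set N := c2Norm e.closedRegion ψ with hN
  have hN0 : 0 ≤ N := c2Norm_nonneg _ _
  have hb : (hreg.jets hψ).BoundedOn e.closedRegion (4 * N) :=
    JetField.boundedOn_ofFunction e.isCompact_closedRegion _ _ hψ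
  have hpair : ∀ i, ∃ f h : ℝ[X],
      HasEdgeTraces e.closedRegion g (e.vertex i) (e.vertex (e.kind.next i)) f h ∧
      ∀ t ∈ Icc (0 : ℝ) 1, |f.eval t| ≤ B * (4 * N) ∧ |f.derivative.eval t| ≤ B * (4 * N) ∧
        |h.eval t| ≤ B * (4 * N) := by
    intro i
    obtain ⟨f, h, hfh⟩ := JetField.exists_isEdgePair hp (hreg.jets hψ) (e.vertex i)
      (e.vertex (e.kind.next i))
    refine ⟨f, h, hT i f h hfh, fun t ht => ?_⟩
    have hle : C₁ * ((1 + ‖e.vertex (e.kind.next i) - e.vertex i‖) ^ 2 * (4 * N))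
        ≤ B * (4 * N) := by
      rw [hB, mul_assoc]
      have := hsize.norm_vertex_sub_le i (e.kind.next i)
      gcongr
    obtain ⟨a1, a2, a3⟩ := hedge _ _ _ f h hfh (4 * N) (hb.mono (e.segment_subset i)) t ht
    exact ⟨a1.trans hle, a2.trans hle, a3.trans hle⟩
  have hB0 : 0 ≤ B * (4 * N) := by positivity
  have hq0 : 0 ≤ 6 * θ * (B * (4 * N)) := by positivity
  have hr0 : 0 ≤ 6 * θ / δ * (B * (4 * N)) := by positivity
  have hcell : ∀ q ∈ e.kind.cell, ∀ a < 3, ∀ b < 3, |bipartial (e.kind.exponents p) a b q c|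
      ≤ K' * ((1 + B + 6 * θ * B + 6 * θ / δ * B) * (4 * N)) := by
    intro q hq a ha b hb'
    refine (hK e.kind c ((1 + B + 6 * θ * B + 6 * θ / δ * B) * (4 * N)) (fun i t ht => ?_)
      (fun i t ht => ?_) (fun m hm => ?_) q hq a ha b hb').trans
      (mul_le_mul_of_nonneg_right (hKle _) (by positivity))
    · obtain ⟨f, h, hfh, hbd⟩ := hpair i
      rw [← hc _ (e.kind.corner_add_smul_along_mem i ht), e.param_side, hfh.value t ht]
      linarith [(hbd t ht).1]
    · obtain ⟨f, h, hfh, hbd⟩ := hpair i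
      obtain ⟨-, h1, h2⟩ := hbd t ht
      have hq := e.kind.corner_add_smul_along_mem i ht
      rw [hreg.bideriv_across_eq (hg.differentiableOn (by norm_num)) hc hfh ht,
        eval_pulledBackCross]
      have hn := hsize.norm_paramDeriv_across_le hq i
      have hn1 := (abs_normalCoeff_le (e.vertex i) (e.vertex (e.kind.next i)) _).trans hn
      have ht1 : |tangentCoeff (e.vertex i) (e.vertex (e.kind.next i)) (e.paramDeriv
          (e.kind.corner i + t • e.kind.along i) (e.kind.across i))| ≤ 6 * θ / δ :=
        (abs_tangentCoeff_le _ _ _).trans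
          (div_le_div₀ (by positivity) hn hδ (hsize.le_side i))
      refine (abs_add_le _ _).trans ?_
      rw [abs_mul, abs_mul]
      linarith [mul_le_mul hn1 h2 (abs_nonneg _) (by positivity),
        mul_le_mul ht1 h1 (abs_nonneg _) (by positivity)]
    · rw [hin m hm]
      have := hb.val _ (e.param_mem (e.kind.innerPoint_mem hp hm))
      simp only [JetField.ofFunction, if_pos (e.param_mem (e.kind.innerPoint_mem hp hm))] at this
      linarith
  convert hsize.boundedOn_jets hδ hreg hg hc hcell using 1
  ring

end MixedMesh

namespace MeshElement

variable {e : MeshElement}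

/-- In the interior, derivatives relative to the open and to the closed element agree. -/
theorem IsRegular.partialWithin_openRegion (he : e.IsRegular) {g : Plane → ℝ}
    (hg : ContDiffOn ℝ 2 g e.closedRegion) {x : Plane} (hx : x ∈ e.openRegion) {a b : ℕ}
    (hab : a + b ≤ 2) :
    partialWithin e.openRegion a b g x = (he.jets hg).coord x (a, b) := by
  have hsub : e.openRegion ⊆ e.closedRegion := interior_subset
  have hopen : IsOpen e.openRegion := isOpen_interior
  have hD : DifferentiableOn ℝ (fderivWithin ℝ g e.closedRegion) e.closedRegion :=
    (hg.fderivWithin he.uniqueDiffOn (m := 1) (by norm_num)).differentiableOn (by norm_num)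
  have h1 : ∀ y ∈ e.openRegion,
      fderivWithin ℝ g e.openRegion y = fderivWithin ℝ g e.closedRegion y := fun y hy =>
    fderivWithin_subset hsub (hopen.uniqueDiffOn y hy)
      (hg.differentiableOn (by norm_num) y (hsub hy))
  have h2 : fderivWithin ℝ (fderivWithin ℝ g e.openRegion) e.openRegion x
      = fderivWithin ℝ (fderivWithin ℝ g e.closedRegion) e.closedRegion x := by
    rw [fderivWithin_congr h1 (h1 x hx)]
    exact fderivWithin_subset hsub (hopen.uniqueDiffOn x hx) (hD x (hsub hx))
  rw [partialWithin_eq_coord hopen.uniqueDiffOn (by rw [hopen.interior_eq]; exact subset_closure)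
    (hg.mono hsub) hx hab]
  refine JetField.coord_congr ?_ ?_ ?_ _ <;>
    simp only [JetField.ofFunction, if_pos hx, if_pos (hsub hx)]
  · exact h1 x hx
  · exact h2

/-- A set of diameter at most `θ` has at most the area of a disc of radius `θ`. -/
theorem volume_le_of_dist_le {s : Set Plane} {θ : ℝ} (h : ∀ x ∈ s, ∀ y ∈ s, dist x y ≤ θ) :
    volume s ≤ volume (Metric.closedBall (0 : Plane) θ) := by
  rcases s.eq_empty_or_nonempty with rfl | ⟨x, hx⟩
  · simp
  · refine (measure_mono fun y hy => Metric.mem_closedBall.2 (h y hy x hx)).trans ?_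
    rw [Measure.addHaar_closedBall_center]

theorem IsRegular.sobolevNorm_le (he : e.IsRegular) {θ N : ℝ}
    (hθ : ∀ x ∈ e.closedRegion, ∀ y ∈ e.closedRegion, dist x y ≤ θ) {g : Plane → ℝ}
    (hg : ContDiffOn ℝ 2 g e.closedRegion) (hb : (he.jets hg).BoundedOn e.closedRegion N) :
    sobolevNorm e.openRegion 2 g
      ≤ ENNReal.ofReal
          (3 * (volume (Metric.closedBall (0 : Plane) θ)).toReal ^ (1 / 2 : ℝ) * N) := by
  have hsub : e.openRegion ⊆ e.closedRegion := interior_subset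
  set V := volume (Metric.closedBall (0 : Plane) θ) with hV
  have hVtop : V ≠ ∞ := measure_closedBall_lt_top.ne
  set Y : ℝ≥0∞ := V ^ (1 / 2 : ℝ) * ENNReal.ofReal N with hY
  have hterm : ∀ a b : ℕ, a + b ≤ 2 →
      eLpNorm (partialWithin e.openRegion a b g) 2 (volume.restrict e.openRegion) ≤ Y := by
    intro a b hab
    refine (eLpNorm_le_of_ae_bound (C := N) ?_).trans ?_
    · refine (ae_restrict_iff' isOpen_interior.measurableSet).2 (.of_forall fun x hx => ?_)
      rw [he.partialWithin_openRegion hg hx hab, Real.norm_eq_abs]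
      exact hb.coord_le (hsub hx) _
    · rw [Measure.restrict_apply_univ, hY]
      have : (2 : ℝ≥0∞).toReal⁻¹ = (1 / 2 : ℝ) := by norm_num
      rw [this]
      gcongr
      exact volume_le_of_dist_le fun x hx y hy => hθ x (hsub hx) y (hsub hy)
  have hN0 : 0 ≤ N := (abs_nonneg _).trans
    (hb.val _ (e.param_mem (interior_subset e.kind.interior_cell_nonempty.some_mem)))
  -- there are six partial derivatives of order at most two
  have hsum : ∑ l ∈ Finset.range (2 + 1), sobolevSeminormSq e.openRegion l g ≤ (3 * Y) ^ 2 := by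
    have hsq : ∀ a b : ℕ, a + b ≤ 2 →
        eLpNorm (partialWithin e.openRegion a b g) 2 (volume.restrict e.openRegion) ^ 2
          ≤ Y ^ 2 := fun a b hab => pow_le_pow_left' (hterm a b hab) 2
    calc ∑ l ∈ Finset.range (2 + 1), sobolevSeminormSq e.openRegion l g
        ≤ ∑ l ∈ Finset.range (2 + 1), (l + 1 : ℕ) • Y ^ 2 := by
          refine Finset.sum_le_sum fun l hl => ?_
          rw [← Finset.Nat.card_antidiagonal l]
          refine Finset.sum_le_card_nsmul _ _ _ fun ab hab => hsq _ _ ?_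
          have := Finset.HasAntidiagonal.mem_antidiagonal.1 hab
          have := Finset.mem_range.1 hl
          omega
      _ = 6 * Y ^ 2 := by
          simp only [Finset.sum_range_succ, Finset.range_zero, Finset.sum_empty, nsmul_eq_mul]
          push_cast
          ring
      _ ≤ (3 * Y) ^ 2 := by
          rw [mul_pow 3 Y]
          have h6 : (6 : ℝ≥0∞) ≤ 3 ^ 2 := by norm_num
          exact mul_le_mul' h6 le_rfl
  calc sobolevNorm e.openRegion 2 g ≤ ((3 * Y) ^ 2) ^ (1 / 2 : ℝ) := by
        unfold sobolevNorm
        gcongr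
    _ = 3 * Y := by
        rw [← ENNReal.rpow_natCast, ← ENNReal.rpow_mul]
        norm_num
    _ = _ := by
        rw [hY, ENNReal.ofReal_mul (by positivity), ENNReal.ofReal_mul (by norm_num),
          ← ENNReal.ofReal_rpow_of_nonneg ENNReal.toReal_nonneg (by norm_num),
          ENNReal.ofReal_toReal hVtop, mul_assoc]
        norm_num

theorem IsRegular.eLpNorm_top_le (he : e.IsRegular) {N : ℝ} {g : Plane → ℝ}
    (hg : ContDiffOn ℝ 2 g e.closedRegion) (hb : (he.jets hg).BoundedOn e.closedRegion N) :
    eLpNorm g ∞ (volume.restrict e.openRegion) ≤ ENNReal.ofReal N := by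
  rw [eLpNorm_exponent_top]
  refine eLpNormEssSup_le_of_ae_bound ?_
  refine (ae_restrict_iff' isOpen_interior.measurableSet).2 (.of_forall fun x hx => ?_)
  have hx' : x ∈ e.closedRegion := interior_subset hx
  have := hb.val x hx'
  simp only [JetField.ofFunction, if_pos hx'] at this
  exact this

end MeshElement

end

theorem mainTheorem8 (p : ℕ) (hp : 5 ≤ p) (ρ : ℝ) (hρ : 0 < ρ) (θ : ℝ) (hθ : 0 < θ) :
    ∃ σ : ℝ, 0 < σ ∧
      ∀ (M : MixedMesh) (e : MeshElement), e ∈ M.elements → e.IsShapeRegular ρ →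
        Metric.diam e.openRegion = θ →
        ∀ ψ : Plane → ℝ, ContDiffOn ℝ 2 ψ e.closedRegion →
          (M.IsLocalInterpolant p e ψ (M.localProjector p e ψ) ∧
            (∀ g : Plane → ℝ, M.IsLocalInterpolant p e ψ g →
              EqOn g (M.localProjector p e ψ) e.closedRegion) ∧
            ContDiffOn ℝ 2 (M.localProjector p e ψ) e.closedRegion) ∧
          sobolevNorm e.openRegion 2 (M.localProjector p e ψ)
            ≤ ENNReal.ofReal (σ * c2Norm e.closedRegion ψ) ∧
          eLpNorm (M.localProjector p e ψ) ∞ (volume.restrict e.openRegion)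
            ≤ ENNReal.ofReal (σ * c2Norm e.closedRegion ψ) := by
  obtain ⟨δ, hδ, hsize⟩ := MeshElement.exists_hasSize hρ hθ
  obtain ⟨C, hC, hbound⟩ := MixedMesh.exists_interpolant_bound hp hδ hθ
  set B := 3 * (volume (Metric.closedBall (0 : Plane) θ)).toReal ^ (1 / 2 : ℝ) with hB
  have hB0 : 0 ≤ B := by positivity
  refine ⟨(B + 1) * C + 1, by positivity, fun M e he hsh hdiam ψ hψ => ?_⟩
  have hreg := M.element_regular e he
  have H := MixedMesh.isLocalInterpolant_localProjector hp he hψ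
  obtain ⟨-, -, hg, -⟩ := H.exists_traces hp he hψ
  have hs := hsize e hreg hsh hdiam
  have hb := hbound M e he hs ψ _ hψ hg H
  have hN := c2Norm_nonneg e.closedRegion ψ
  have hBC := mul_nonneg (mul_nonneg hB0 hC) hN
  have hCN := mul_nonneg hC hN
  refine ⟨⟨H, fun g hg' => hg'.eqOn hp he hψ H, hg⟩, ?_, ?_⟩
  · refine (hreg.sobolevNorm_le hs.dist_le hg hb).trans (ENNReal.ofReal_le_ofReal ?_)
    rw [← hB]
    linarith
  · refine (hreg.eLpNorm_top_le hg hb).trans (ENNReal.ofReal_le_ofReal ?_)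
    linarith
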